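/- Let $G$ be a finite group; $\hat\gamma$ denotes the conjugacy class of $\gamma\in G$. **The group $\mathbb B_G$.** Let $\Lambda_G$ be the commutative monoid (under concatenation) of unordered tuples $[\hat\gamma_1,\dots,\hat\gamma_q]$, $q\ge 0$, of conjugacy classes of $G$ with $\gamma_1\cdots\gamma_q\in[G,G]$, where entries $\hat 1$ may be dropped. $\mathbb B_G$ is the quotient of $\Lambda_G$ by the congruence generated by $[\hat\gamma,\hat\gamma^{-1}]=0$, $\gamma\in G$; it is an abelian group, with $-[\hat\gamma_1,\dots,\hat\gamma_q]=[\hat\gamma_1^{-1},\dots,\hat\gamma_q^{-1}]$. **The target.** $R_{\mathbb C}G$ is the additive group of the complex representation ring (the group of virtual characters), and $E_G\le R_{\mathbb C}G$ is the subgroup generated by the induced representations $\mathrm{Ind}_H^G\rho_0$, where $H$ runs over all subgroups of $G$ and $\rho_0$ is the one-dimensional trivial representation of $H$. **Actions on surfaces.** Let $G$ act effectively, by orientation preserving diffeomorphisms, on a connected closed oriented surface $S$. (The action may be given by the induced action on a $G$-invariant cell decomposition of $S$ with trivalent $1$-skeleton whose vertices and edges are permuted freely, so that points with non-trivial stabilizer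 are centres of $2$-cells; every action has such a decomposition, and homology and the intersection pairing are computed cellularly from it.) Its *singular orbit data* is the unordered tuple $\{\hat\gamma_1,\dots,\hat\gamma_q\}$ with one entry for each orbit of points with non-trivial stabilizer, where $\gamma_i$ is the generator of the stabilizer of a point $x_i$ of the $i$-th orbit that rotates the tangent space at $x_i$ by $+2\pi/\nu_i$, $\nu_i$ being the order of $\gamma_i$. A homomorphism $\rho:G\to U(g)$ is a *unitary representation of the action* if there is a real linear isomorphism $e:H_1(S;\mathbb R)\to\mathbb C^g$ with $e(\gamma x)=\rho(\gamma)e(x)$ for $\gamma\in G$ and $\mathrm{Im}\langle e(x),e(y)\rangle=x\cdot y$ for all $x,y\in H_1(S;\mathbb R)$, where $x\cdot y$ is the intersection pairing and $\langle z,w\rangle=\sum_k\bar z_kw_k$. **Theorem.** There is exactly one group homomorphism $$\theta:\mathbb B_G\to R_{\mathbb C}G/E_G$$ induced by the unitary representations on the first homology of surfaces, i.e. such that $\theta([\hat\gamma_1,\dots,\hat\gamma_q])$ is the class of $\rho$ whenever $\rho$ is a unitary representation of an action of $G$ with singular orbit data $\{\hat\gamma_1,\dots,\hat\gamma_q\}$.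 This $\theta$ is injective on the free part of $\mathbb B_G$: its restriction to every torsion-free subgroup of $\mathbb B_G$ is injective (equivalently, $\theta(\alpha)\neq 0$ for every $\alpha\in\mathbb B_G$ of infinite order). -/

import Mathlib

universe u

/-!
# Part I: the group `𝔹_G` of singular orbit data
-/

section OrbitData

variable (G : Type u) [Group G]

/-- The class of the inverses of the elements of a conjugacy class. -/
def conjInv {G : Type u} [Group G] : ConjClasses G → ConjClasses G :=
  Quotient.lift (fun g : G => ConjClasses.mk g⁻¹) (by
    intro a b h
    obtain ⟨c, hc⟩ := isConj_iff.1 h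
    exact ConjClasses.mk_eq_mk_iff_isConj.2 (isConj_iff.2 ⟨c, by rw [← hc]; group⟩))

/-- The image of a conjugacy class in `G / [G, G]` (written additively). -/
def conjToAb : ConjClasses G → Additive (Abelianization G) :=
  Quotient.lift (fun g : G => Additive.ofMul (Abelianization.of g)) (by
    intro a b h
    obtain ⟨c, hc⟩ := isConj_iff.1 h
    rw [← hc]
    simp)

/-- The map `Ψ` sending an unordered tuple of conjugacy classes of `G` to the product of (the
images of) its entries in `G / [G, G]`. -/
def Psi : Multiset (ConjClasses G) →+ Additive (Abelianization G) :=
  Multiset.sumAddMonoidHom.comp (Multiset.mapAddMonoidHom (conjToAb G))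

/-- The monoid of unordered tuples `[γ̂₁, …, γ̂_q]`, `q ≥ 0`, of conjugacy classes of `G` with
`γ₁ ⋯ γ_q ∈ [G, G]`; the addition is concatenation. (Entries `1̂` are identified with nothing
below, in `BRel`.) -/
abbrev OrbitTuples : AddSubmonoid (Multiset (ConjClasses G)) := AddMonoidHom.mker (Psi G)

/-- The relations defining `𝔹_G`: `[1̂] = 0` (trivial entries are dropped), and
`[γ̂, γ̂⁻¹] = 0` (cancelling pairs). -/
def BRel (a b : OrbitTuples G) : Prop :=
  b = 0 ∧ ((a : Multiset (ConjClasses G)) = {ConjClasses.mk (1 : G)} ∨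
    ∃ γ : G, (a : Multiset (ConjClasses G)) = {ConjClasses.mk γ, ConjClasses.mk γ⁻¹})

/-- The group `𝔹_G` of singular orbit data: the monoid of tuples modulo the congruence
generated by the relations `BRel`. -/
def BGroup : Type u := (addConGen (BRel G)).Quotient

noncomputable instance BGroup.instAddCommMonoid : AddCommMonoid (BGroup G) :=
  inferInstanceAs (AddCommMonoid (addConGen (BRel G)).Quotient)

/-- The element `[γ̂₁, …, γ̂_q]_G` of `𝔹_G`. -/
def BGroup.mk : OrbitTuples G →+ BGroup G := (addConGen (BRel G)).mk'

theorem conjToAb_conjInv (c : ConjClasses G) : conjToAb G (conjInv c) = -conjToAb G c := by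
  induction c using Quotient.inductionOn with
  | _ g =>
    change Additive.ofMul (Abelianization.of g⁻¹) = -Additive.ofMul (Abelianization.of g)
    rw [map_inv, ofMul_inv]

theorem Psi_cons (c : ConjClasses G) (m : Multiset (ConjClasses G)) :
    Psi G (c ::ₘ m) = conjToAb G c + Psi G m := by
  simp [Psi]

theorem Psi_map_conjInv (m : Multiset (ConjClasses G)) :
    Psi G (m.map conjInv) = -Psi G m := by
  induction m using Multiset.induction_on with
  | empty => simp
  | cons c m ih =>
    rw [Multiset.map_cons, Psi_cons, Psi_cons, ih, conjToAb_conjInv, neg_add]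

theorem BGroup.mk_add_inv (m : Multiset (ConjClasses G))
    (hm : m + m.map conjInv ∈ OrbitTuples G) :
    BGroup.mk G ⟨m + m.map conjInv, hm⟩ = 0 := by
  induction m using Multiset.induction_on with
  | empty => exact (BGroup.mk G).map_zero
  | cons c m ih =>
    have h1 : m + m.map conjInv ∈ OrbitTuples G := by
      rw [AddMonoidHom.mem_mker, map_add, Psi_map_conjInv, add_neg_cancel]
    have h2 : ({c, conjInv c} : Multiset (ConjClasses G)) ∈ OrbitTuples G := by
      rw [AddMonoidHom.mem_mker, Multiset.insert_eq_cons, Psi_cons, ← Multiset.cons_zero,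
        Psi_cons, conjToAb_conjInv, map_zero, add_zero, add_neg_cancel]
    have h3 : (⟨(c ::ₘ m) + (c ::ₘ m).map conjInv, hm⟩ : OrbitTuples G)
        = ⟨{c, conjInv c}, h2⟩ + ⟨m + m.map conjInv, h1⟩ := by
      apply Subtype.ext
      change (c ::ₘ m) + (c ::ₘ m).map conjInv
        = ({c, conjInv c} : Multiset (ConjClasses G)) + (m + m.map conjInv)
      rw [Multiset.map_cons, Multiset.insert_eq_cons,
        ← Multiset.singleton_add, ← Multiset.singleton_add, ← Multiset.singleton_add]
      abel
    have h4 : BGroup.mk G ⟨{c, conjInv c}, h2⟩ = 0 := by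
      refine ((addConGen (BRel G)).eq (a := ⟨{c, conjInv c}, h2⟩) (b := 0)).2
        (AddConGen.Rel.of _ _ ⟨rfl, Or.inr ?_⟩)
      induction c using Quotient.inductionOn with
      | _ g => exact ⟨g, rfl⟩
    rw [h3, map_add, ih h1, h4, add_zero]

/-- The inverse of `[γ̂₁, …, γ̂_q]` is `[γ̂₁⁻¹, …, γ̂_q⁻¹]`. -/
theorem BGroup.exists_neg (x : BGroup G) : ∃ y : BGroup G, y + x = 0 := by
  obtain ⟨⟨m, hm⟩, rfl⟩ := (addConGen (BRel G)).mk'_surjective x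
  have h1 : m.map conjInv ∈ OrbitTuples G := by
    rw [AddMonoidHom.mem_mker] at hm ⊢
    rw [Psi_map_conjInv, hm, neg_zero]
  refine ⟨BGroup.mk G ⟨m.map conjInv, h1⟩, ?_⟩
  have := BGroup.mk_add_inv G m (AddSubmonoid.add_mem _ hm h1)
  have h2 := ((BGroup.mk G).map_add ⟨m, hm⟩ ⟨m.map conjInv, h1⟩).symm.trans this
  exact (add_comm _ _).trans h2

noncomputable instance BGroup.instNeg : Neg (BGroup G) :=
  ⟨fun x => (BGroup.exists_neg G x).choose⟩

noncomputable instance BGroup.instAddCommGroup : AddCommGroup (BGroup G) :=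
  { BGroup.instAddCommMonoid G, BGroup.instNeg G with
    zsmul := zsmulRec
    neg_add_cancel := fun x => (BGroup.exists_neg G x).choose_spec }

end OrbitData

/-!
# Part II: the quotient `R_ℂ G / E_G` of the complex representation ring
-/

section RepresentationRing

variable (G : Type u) [Group G]

/-- The (additive group of the) complex representation ring `R_ℂ G`: the group of virtual
characters, generated by the characters of the finite dimensional complex representations. -/
noncomputable def RepRing : AddSubgroup (G → ℂ) :=
  AddSubgroup.closure
    {χ | ∃ (n : ℕ) (ρ : Representation ℂ G (EuclideanSpace ℂ (Fin n))), χ = ρ.character}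

/-- The class of a representation in `R_ℂ G`. -/
noncomputable def RepRing.of {G : Type u} [Group G] {n : ℕ}
    (ρ : Representation ℂ G (EuclideanSpace ℂ (Fin n))) : RepRing G :=
  ⟨ρ.character, AddSubgroup.subset_closure ⟨n, ρ, rfl⟩⟩

/-- The subgroup `E_G` of `R_ℂ G` generated by the representations `Ind_H^G ρ₀` induced from the
one dimensional trivial representation `ρ₀` of the subgroups `H ≤ G`. -/
noncomputable def EGroup : AddSubgroup (RepRing G) :=
  AddSubgroup.closure
    {χ | ∃ H : Subgroup G,
      (χ : G → ℂ) = (Representation.ind H.subtype (Representation.trivial ℂ H ℂ)).character}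

/-- The quotient `R_ℂ G / E_G`. -/
abbrev RTilde : Type u := RepRing G ⧸ EGroup G

end RepresentationRing

/-!
# Part III: actions of `G` on closed surfaces, their singular orbits and their homology

A connected closed oriented surface is described by a finite connected trivalent graph embedded
in it such that all components of the complement ("faces") are open discs, i.e. by a cell
decomposition with trivalent vertices. It is recorded by the set of darts (oriented edges):
`next d` is the dart following `d` in the counterclockwise (positive) order around the initial
vertex of `d`, and `rev d` is `d` with the opposite direction. Conversely such combinatorial data
determine the oriented surface, by gluing one disc along each boundary walk of the ribbon graph.

An effective orientation preserving smooth action of a finite group `G` on a closed connected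
surface `S` leaves such a graph invariant that avoids the points with non-trivial stabilizer: take
the preimage of a trivalent graph in `S / G` that cuts `S / G` into discs each of which contains
at most one branch point. Then `G` acts freely on the vertices and the edges of the graph, and
conversely each such action on the ribbon graph extends to an action on the surface, where an
element that maps a face to itself rotates it about its centre.
-/

section Surfaces

/-- An effective orientation preserving action of `G` on a connected closed oriented surface,
given by its action on an invariant trivalent cell decomposition whose vertices and edges are
permuted freely. -/
structure SurfaceAction (G : Type u) [Group G] where
  /-- the set of darts (oriented edges) of the embedded graph -/
  Dart : Type
  [fintypeDart : Fintype Dart]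
  [nonemptyDart : Nonempty Dart]
  /-- the next dart counterclockwise around the initial vertex -/
  next : Equiv.Perm Dart
  /-- the same edge with the opposite direction -/
  rev : Equiv.Perm Dart
  next_ne : ∀ d, next d ≠ d
  next_next_next : ∀ d, next (next (next d)) = d
  rev_ne : ∀ d, rev d ≠ d
  rev_rev : ∀ d, rev (rev d) = d
  /-- the surface is connected -/
  connected : ∀ d d' : Dart, ∃ p ∈ Subgroup.closure {next, rev}, p d = d'
  /-- the action of `G` on the darts -/
  act : G →* Equiv.Perm Dart
  act_next : ∀ g d, act g (next d) = next (act g d)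
  act_rev : ∀ g d, act g (rev d) = rev (act g d)
  /-- the action on the vertices of the graph is free -/
  free_vertex : ∀ g, g ≠ 1 → ∀ d, act g d ≠ d ∧ act g d ≠ next d ∧ act g d ≠ next (next d)
  /-- the action on the edges of the graph is free -/
  free_edge : ∀ g, g ≠ 1 → ∀ d, act g d ≠ d ∧ act g d ≠ rev d

namespace SurfaceAction

attribute [instance] SurfaceAction.fintypeDart SurfaceAction.nonemptyDart

variable {G : Type u} [Group G] (S : SurfaceAction G)

/-! ## Faces and singular orbits -/

/-- Counterclockwise rotation about the faces: the dart following `d` in the boundary walk of the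
face on the left of `d`. The faces are the orbits of this permutation. -/
def faceNext : Equiv.Perm S.Dart := S.rev.trans S.next.symm

theorem act_next_symm (g : G) (d : S.Dart) :
    S.act g (S.next.symm d) = S.next.symm (S.act g d) := by
  rw [Equiv.eq_symm_apply, ← S.act_next, Equiv.apply_symm_apply]

theorem act_faceNext (g : G) (d : S.Dart) :
    S.act g (S.faceNext d) = S.faceNext (S.act g d) := by
  simp [faceNext, S.act_next_symm, S.act_rev]

theorem act_faceNext_iterate (g : G) (k : ℕ) (d : S.Dart) :
    S.act g (S.faceNext^[k] d) = S.faceNext^[k] (S.act g d) := by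
  induction k generalizing d with
  | zero => rfl
  | succ k ih => rw [Function.iterate_succ_apply, Function.iterate_succ_apply, ih, act_faceNext]

theorem act_injective {g h : G} {d : S.Dart} (e : S.act g d = S.act h d) : g = h := by
  by_contra hne
  have h1 : h⁻¹ * g ≠ 1 := fun h2 => hne (inv_mul_eq_one.1 h2).symm
  apply (S.free_edge _ h1 d).1
  rw [map_mul, Equiv.Perm.mul_apply, e, ← Equiv.Perm.mul_apply, ← map_mul]
  simp

theorem exists_rotation (d : S.Dart) : ∃ k : ℕ, 0 < k ∧ ∃ g : G, S.act g d = S.faceNext^[k] d := by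
  refine ⟨orderOf S.faceNext, orderOf_pos _, 1, ?_⟩
  rw [Equiv.Perm.iterate_eq_pow, pow_orderOf_eq_one]
  simp

open Classical in
/-- The smallest `k > 0` such that rotating the face on the left of `d` by `k` steps is the effect
of an element of `G`. -/
noncomputable def rotationStep (d : S.Dart) : ℕ := Nat.find (S.exists_rotation d)

open Classical in
/-- The element `γ` of `G` that acts on the face on the left of `d` as the counterclockwise
rotation by the smallest positive angle among the elements of `G` mapping the face to itself. It
generates the stabilizer of the centre of the face and rotates by `2π/ν`, `ν` its order. -/
noncomputable def rotation (d : S.Dart) : G := (Nat.find_spec (S.exists_rotation d)).2.choose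

theorem act_rotation (d : S.Dart) :
    S.act (S.rotation d) d = S.faceNext^[S.rotationStep d] d := by
  classical
  exact (Nat.find_spec (S.exists_rotation d)).2.choose_spec

theorem faceNext_iterate_comm (k : ℕ) (d : S.Dart) :
    S.faceNext^[k] (S.faceNext d) = S.faceNext (S.faceNext^[k] d) := by
  rw [← Function.iterate_succ_apply, Function.iterate_succ_apply']

theorem rotation_face_iff (g : G) (k : ℕ) (d : S.Dart) :
    S.act g (S.faceNext d) = S.faceNext^[k] (S.faceNext d) ↔ S.act g d = S.faceNext^[k] d := by
  rw [S.act_faceNext, S.faceNext_iterate_comm, S.faceNext.injective.eq_iff]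

theorem rotation_act_iff (g h : G) (k : ℕ) (d : S.Dart) :
    S.act (h * g * h⁻¹) (S.act h d) = S.faceNext^[k] (S.act h d) ↔
      S.act g d = S.faceNext^[k] d := by
  have h1 : S.act (h * g * h⁻¹) (S.act h d) = S.act h (S.act g d) := by
    rw [← Equiv.Perm.mul_apply, ← Equiv.Perm.mul_apply, ← map_mul, ← map_mul]
    simp
  rw [h1, ← S.act_faceNext_iterate, (S.act h).injective.eq_iff]

theorem rotationStep_faceNext (d : S.Dart) :
    S.rotationStep (S.faceNext d) = S.rotationStep d := by
  classical
  refine Nat.find_congr' ?_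
  intro k
  simp only [S.rotation_face_iff]

theorem rotation_faceNext (d : S.Dart) : S.rotation (S.faceNext d) = S.rotation d := by
  have h := S.act_rotation (S.faceNext d)
  rw [rotationStep_faceNext, rotation_face_iff, ← act_rotation] at h
  exact S.act_injective h

theorem rotationStep_act (h : G) (d : S.Dart) :
    S.rotationStep (S.act h d) = S.rotationStep d := by
  classical
  refine Nat.find_congr' ?_
  intro k
  refine and_congr_right fun _ => ⟨?_, ?_⟩
  · rintro ⟨g, hg⟩
    refine ⟨h⁻¹ * g * h, (S.rotation_act_iff _ h k d).1 ?_⟩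
    rw [← hg]
    congr 2
    group
  · rintro ⟨g, hg⟩
    exact ⟨h * g * h⁻¹, (S.rotation_act_iff g h k d).2 hg⟩

theorem rotation_act (h : G) (d : S.Dart) :
    S.rotation (S.act h d) = h * S.rotation d * h⁻¹ := by
  have h1 := (S.rotation_act_iff _ h _ d).2 (S.act_rotation d)
  rw [← S.rotationStep_act h d, ← S.act_rotation] at h1
  exact (S.act_injective h1).symm

/-- Two darts are equivalent if the faces on their left are in the same `G`-orbit. -/
def faceOrbitSetoid : Setoid S.Dart where
  r d d' := ∃ (g : G) (k : ℕ), d' = S.act g (S.faceNext^[k] d)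
  iseqv := by
    refine ⟨fun d => ⟨1, 0, by simp⟩, ?_, ?_⟩
    · rintro d d' ⟨g, k, rfl⟩
      obtain ⟨l, hl⟩ : ∃ l : ℕ, S.faceNext^[l] (S.faceNext^[k] d) = d := by
        refine ⟨k * (orderOf S.faceNext - 1), ?_⟩
        rw [← Function.iterate_add_apply]
        have : k * (orderOf S.faceNext - 1) + k = orderOf S.faceNext * k := by
          have := orderOf_pos S.faceNext
          obtain ⟨m, hm⟩ : ∃ m, orderOf S.faceNext = m + 1 := ⟨_, (Nat.succ_pred this.ne').symm⟩
          rw [hm]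
          simp only [Nat.add_sub_cancel]
          ring
        rw [this, Equiv.Perm.iterate_eq_pow, pow_mul, pow_orderOf_eq_one]
        simp
      refine ⟨g⁻¹, l, ?_⟩
      rw [← S.act_faceNext_iterate, hl, ← Equiv.Perm.mul_apply, ← map_mul]
      simp
    · rintro d _ _ ⟨g, k, rfl⟩ ⟨h, l, rfl⟩
      refine ⟨h * g, l + k, ?_⟩
      rw [map_mul, Equiv.Perm.mul_apply, Function.iterate_add_apply,
        ← S.act_faceNext_iterate g l]

/-- The `G`-orbits of faces, i.e. of the centres of the faces. -/
def FaceOrbit : Type := Quotient S.faceOrbitSetoid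

noncomputable instance : Fintype S.FaceOrbit := by
  classical
  exact @Quotient.fintype _ _ S.faceOrbitSetoid (fun _ _ => Classical.dec _)

/-- The conjugacy class `γ̂` of the rotations `γ` at the points of an orbit of face centres. -/
noncomputable def rotationClass : S.FaceOrbit → ConjClasses G :=
  @Quotient.lift _ _ S.faceOrbitSetoid (fun d => ConjClasses.mk (S.rotation d)) (by
    rintro d _ ⟨g, k, rfl⟩
    refine ConjClasses.mk_eq_mk_iff_isConj.2 (isConj_iff.2 ⟨g, ?_⟩)
    rw [S.rotation_act]
    congr 2
    induction k generalizing d with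
    | zero => rfl
    | succ k ih => rw [Function.iterate_succ_apply, ← ih, S.rotation_faceNext])

open Classical in
/-- The singular orbit data `{γ̂₁, …, γ̂_q}` of the action: one conjugacy class for each orbit
with non-trivial stabilizers. -/
noncomputable def orbitData : Multiset (ConjClasses G) :=
  ((Finset.univ : Finset S.FaceOrbit).val.map S.rotationClass).filter
    (fun c => c ≠ ConjClasses.mk 1)

/-! ## The first homology group with its intersection pairing -/

/-- Cellular 1-cycles with real coefficients: a 1-chain `x` is a function on the darts with
`x (rev d) = - x d`, and its boundary vanishes if the values on the three darts leaving a vertex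
sum up to zero. -/
def cycles : Submodule ℝ (S.Dart → ℝ) where
  carrier := {x | (∀ d, x (S.rev d) = - x d) ∧ ∀ d, x d + x (S.next d) + x (S.next (S.next d)) = 0}
  zero_mem' := by simp
  add_mem' := by
    rintro x y ⟨hx, hx'⟩ ⟨hy, hy'⟩
    refine ⟨fun d => ?_, fun d => ?_⟩
    · simp only [Pi.add_apply, hx d, hy d]
      ring
    · have h1 := hx' d
      have h2 := hy' d
      simp only [Pi.add_apply]
      linarith
  smul_mem' := by
    rintro c x ⟨hx, hx'⟩
    refine ⟨fun d => ?_, fun d => ?_⟩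
    · simp [hx d]
    · have h1 := hx' d
      simp only [Pi.smul_apply, smul_eq_mul]
      rw [← mul_add, ← mul_add, h1, mul_zero]

/-- Cellular 1-boundaries: a 2-chain is a function `u` on the faces, i.e. a function on the darts
with `u (faceNext d) = u d`, and its boundary is `d ↦ u d - u (rev d)` (the face on the left of
`d` minus the face on the right). -/
def boundaries : Submodule ℝ S.cycles where
  carrier := {x | ∃ u : S.Dart → ℝ, (∀ d, u (S.faceNext d) = u d) ∧
    ∀ d, (x : S.Dart → ℝ) d = u d - u (S.rev d)}
  zero_mem' := ⟨0, by simp, by simp⟩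
  add_mem' := by
    rintro x y ⟨u, hu, hx⟩ ⟨v, hv, hy⟩
    refine ⟨u + v, fun d => by simp [hu d, hv d], fun d => ?_⟩
    simp only [Submodule.coe_add, Pi.add_apply, hx d, hy d]
    ring
  smul_mem' := by
    rintro c x ⟨u, hu, hx⟩
    refine ⟨c • u, fun d => by simp [hu d], fun d => ?_⟩
    simp only [Submodule.coe_smul, Pi.smul_apply, hx d, smul_eq_mul]
    ring

/-- The first homology group `H₁(S; ℝ)` of the surface. -/
abbrev H1 : Type := S.cycles ⧸ S.boundaries

/-- The intersection number of two 1-cycles, as a sum of local contributions of the vertices: if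
`x₀, x₁, x₂` and `y₀, y₁, y₂` are the values on the three darts leaving a vertex, in
counterclockwise order, then the contribution is `(x₀ y₁ - x₁ y₀) / 2`, which does not depend on
the dart one starts with; summing over all darts counts each vertex three times. -/
noncomputable def cycleIntersection : S.cycles →ₗ[ℝ] S.cycles →ₗ[ℝ] ℝ :=
  LinearMap.mk₂ ℝ
    (fun x y => (1 / 6) * ∑ d, ((x : S.Dart → ℝ) d * (y : S.Dart → ℝ) (S.next d)
      - (x : S.Dart → ℝ) (S.next d) * (y : S.Dart → ℝ) d))
    (by
      intro x x' y
      simp only [Submodule.coe_add, Pi.add_apply]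
      rw [← mul_add, ← Finset.sum_add_distrib]
      congr 1
      exact Finset.sum_congr rfl fun d _ => by ring)
    (by
      intro c x y
      simp only [Submodule.coe_smul, Pi.smul_apply, smul_eq_mul, Finset.mul_sum]
      exact Finset.sum_congr rfl fun d _ => by ring)
    (by
      intro x y y'
      simp only [Submodule.coe_add, Pi.add_apply]
      rw [← mul_add, ← Finset.sum_add_distrib]
      congr 1
      exact Finset.sum_congr rfl fun d _ => by ring)
    (by
      intro c x y
      simp only [Submodule.coe_smul, Pi.smul_apply, smul_eq_mul, Finset.mul_sum]
      exact Finset.sum_congr rfl fun d _ => by ring)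

theorem cycleIntersection_apply (x y : S.cycles) : S.cycleIntersection x y =
    (1 / 6) * ∑ d, ((x : S.Dart → ℝ) d * (y : S.Dart → ℝ) (S.next d)
      - (x : S.Dart → ℝ) (S.next d) * (y : S.Dart → ℝ) d) := rfl

theorem cycleIntersection_swap (x y : S.cycles) :
    S.cycleIntersection y x = - S.cycleIntersection x y := by
  simp only [cycleIntersection_apply]
  rw [← mul_neg, ← Finset.sum_neg_distrib]
  congr 1
  exact Finset.sum_congr rfl fun d _ => by ring

theorem cycleIntersection_boundary (x y : S.cycles) (hy : y ∈ S.boundaries) :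
    S.cycleIntersection x y = 0 := by
  obtain ⟨x, hx1, hx2⟩ := x
  obtain ⟨u, hu, hy⟩ := hy
  have hn : ∀ d, S.next.symm d = S.next (S.next d) := fun d => by
    rw [Equiv.symm_apply_eq, S.next_next_next]
  have hr : ∀ d, u (S.rev d) = u (S.next (S.next d)) := by
    intro d
    have := hu (S.rev d)
    simp only [faceNext, Equiv.trans_apply, S.rev_rev, hn] at this
    exact this.symm
  have s1 : ∀ f : S.Dart → ℝ, ∑ d, f (S.next d) = ∑ d, f d := fun f => Equiv.sum_comp S.next f
  have s2 : ∑ d, x d * u d = - ∑ d, x d * u (S.next (S.next d)) := by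
    rw [← Equiv.sum_comp S.rev, ← Finset.sum_neg_distrib]
    exact Finset.sum_congr rfl fun d _ => by rw [hx1, hr]; ring
  have s3 : ∑ d, x d * u d + ∑ d, x (S.next d) * u d + ∑ d, x (S.next (S.next d)) * u d = 0 := by
    rw [← Finset.sum_add_distrib, ← Finset.sum_add_distrib]
    exact Finset.sum_eq_zero fun d _ => by rw [← add_mul, ← add_mul, hx2, zero_mul]
  have s4 : ∑ d, x (S.next d) * u d = ∑ d, x d * u (S.next (S.next d)) := by
    rw [← s1 (fun d => x d * u (S.next (S.next d)))]
    exact Finset.sum_congr rfl fun d _ => by rw [S.next_next_next]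
  have s5 : ∑ d, x (S.next (S.next d)) * u d = ∑ d, x d * u (S.next d) := by
    rw [← s1 (fun d => x d * u (S.next d)), ← s1 (fun d => x (S.next d) * u (S.next (S.next d)))]
    exact Finset.sum_congr rfl fun d _ => by rw [S.next_next_next]
  have s6 : ∑ d, x (S.next d) * u (S.next d) = ∑ d, x d * u d := s1 (fun d => x d * u d)
  have s7 : ∑ d, x (S.next d) * u (S.next (S.next d)) = ∑ d, x d * u (S.next d) :=
    s1 (fun d => x d * u (S.next d))
  rw [cycleIntersection_apply]
  have : ∑ d, (x d * (y : S.Dart → ℝ) (S.next d) - x (S.next d) * (y : S.Dart → ℝ) d)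
      = ∑ d, x d * u (S.next d) - ∑ d, x d * u d
        - (∑ d, x (S.next d) * u d - ∑ d, x (S.next d) * u (S.next (S.next d))) := by
    rw [← Finset.sum_sub_distrib, ← Finset.sum_sub_distrib, ← Finset.sum_sub_distrib]
    exact Finset.sum_congr rfl fun d _ => by
      rw [hy, hy, hr, hr, S.next_next_next]; ring
  simp only [this]
  rw [s7, s4]
  linarith

/-- The intersection pairing on `H₁(S; ℝ)`. -/
noncomputable def intersection : S.H1 →ₗ[ℝ] S.H1 →ₗ[ℝ] ℝ :=
  S.boundaries.liftQ
    ((S.boundaries.liftQ S.cycleIntersection.flip (by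
      intro y hy
      rw [LinearMap.mem_ker]
      ext1 x
      exact S.cycleIntersection_boundary x y hy)).flip) (by
    intro x hx
    rw [LinearMap.mem_ker]
    apply LinearMap.ext
    intro y
    obtain ⟨y, rfl⟩ := Submodule.Quotient.mk_surjective _ y
    change S.cycleIntersection x y = 0
    rw [cycleIntersection_swap, S.cycleIntersection_boundary y x hx, neg_zero])

/-- The action of `G` on the 1-cycles: the chain `g x` has the value `x d` on the dart `g d`. -/
noncomputable def cycleRep : Representation ℝ G S.cycles where
  toFun g := LinearMap.restrict (LinearMap.funLeft ℝ ℝ (S.act g⁻¹)) (by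
    rintro x ⟨h1, h2⟩
    refine ⟨fun d => ?_, fun d => ?_⟩
    · simp only [LinearMap.funLeft_apply, S.act_rev, h1]
    · simp only [LinearMap.funLeft_apply, S.act_next, h2])
  map_one' := by
    ext x d
    simp
  map_mul' g h := by
    ext x d
    simp

theorem cycleRep_boundary (g : G) (x : S.cycles) (hx : x ∈ S.boundaries) :
    S.cycleRep g x ∈ S.boundaries := by
  obtain ⟨u, hu, hx⟩ := hx
  refine ⟨fun d => u (S.act g⁻¹ d), fun d => ?_, fun d => ?_⟩
  · simp only [S.act_faceNext, hu]
  · simp only [S.act_rev]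
    exact hx (S.act g⁻¹ d)

/-- The representation of `G` on `H₁(S; ℝ)`. -/
noncomputable def homologyRep : Representation ℝ G S.H1 where
  toFun g := S.boundaries.mapQ S.boundaries (S.cycleRep g) (S.cycleRep_boundary g)
  map_one' := by
    apply LinearMap.ext
    intro x
    obtain ⟨x, rfl⟩ := Submodule.Quotient.mk_surjective _ x
    rw [Submodule.mapQ_apply, map_one]
    rfl
  map_mul' g h := by
    apply LinearMap.ext
    intro x
    obtain ⟨x, rfl⟩ := Submodule.Quotient.mk_surjective _ x
    rw [Submodule.mapQ_apply, map_mul]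
    rfl

/-! ## The unitary representation -/

/-- `ρ : G → U(n)` is the unitary representation of the action: under some real linear
isomorphism of `H₁(S; ℝ)` with `ℂⁿ` the intersection pairing becomes the standard symplectic form
`Im ⟪z, w⟫` (positive on `(z, i z)`) and the action of `G` on `H₁(S; ℝ)` becomes `ρ`. In other
words, the symplectic representation on `H₁(S; ℝ)` factors, up to conjugation, as `ρ` followed by
the inclusion `U(n) ⊂ Sp_{2n}(ℝ)`. -/
def IsUnitaryRep {n : ℕ} (ρ : Representation ℂ G (EuclideanSpace ℂ (Fin n))) : Prop :=
  (∀ g z w, inner ℂ (ρ g z) (ρ g w) = inner ℂ z w) ∧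
  ∃ e : S.H1 ≃ₗ[ℝ] EuclideanSpace ℂ (Fin n),
    (∀ x y, (inner ℂ (e x) (e y)).im = S.intersection x y) ∧
    ∀ g x, e (S.homologyRep g x) = ρ g (e x)

end SurfaceAction

end Surfaces

/-!
# Part IV: the homomorphism `θ`
-/

/-- `θ : 𝔹_G → R_ℂ G / E_G` is induced by the unitary representations on the first homology of
the surfaces: for every action of `G` on a surface with singular orbit data `{γ̂₁, …, γ̂_q}` and
unitary representation `ρ`, it maps `[γ̂₁, …, γ̂_q]` to the class of `ρ`. -/
def IsInducedByHomology {G : Type u} [Group G] (θ : BGroup G →+ RTilde G) : Prop :=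
  ∀ (S : SurfaceAction G) (n : ℕ) (ρ : Representation ℂ G (EuclideanSpace ℂ (Fin n))),
    S.IsUnitaryRep ρ →
    ∀ α : OrbitTuples G, (α : Multiset (ConjClasses G)) = S.orbitData →
      θ (BGroup.mk G α) = QuotientAddGroup.mk (RepRing.of ρ)

/-!
The homomorphism `θ` is written down by a formula for the character of a unitary representation `ρ`
of an action in terms of its singular orbit data (`SurfaceAction.exists_character_eq`): up to a
multiple of the regular representation, `χ_ρ` is `1` plus the sum, over the entries `γ̂` of the
orbit data, of a class function `coneCharacter γ`, which is induced from the cyclic group generated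
by `γ`.

*The character formula.* For `g ≠ 1` it is the sum of two fixed point formulas. The Lefschetz
formula (`SurfaceAction.trace_add_conj_trace`) computes `χ_ρ(g) + conj χ_ρ(g)` by counting traces
on chains. The `g`-signature formula (`SurfaceAction.trace_sub_conj_trace`) computes `χ_ρ(g) - conj
χ_ρ(g)`; it is obtained from the Meyer cocycle, which is the signature of a twisted intersection
form on a pair of pants. Gluing two pairs of pants in two ways gives the cocycle identity
(`meyer_cocycle`), so over a finite group the cocycle is the coboundary of its average
(`exists_meyer_eq_coboundary`), and for a unitary operator of finite order this average is a sum of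
values of the sawtooth function at the arguments of the eigenvalues (`sum_meyer_pow`). On the other
hand, the intersection form of the surface, restricted to an eigenspace of `g`, is the form of the
Meyer cocycle of the two permutations `next⁻¹` and `rev` of the darts, acting on an eigenspace of
`g` in the functions on the darts (`SurfaceAction.eigenMeyer_next_rev`). Here `next⁻¹` and `rev`
have no coincidences with `g`, which acts freely on vertices and edges, and only their product, the
rotation of the faces, contributes.

*Well-definedness and uniqueness.* The functions `coneCharacter γ` and `coneCharacter γ⁻¹` add up
to a difference of two permutation characters (`coneCharacter_add_inv`), and the trivial and the
regular representation belong to `E_G` as well. Hence sums of cone characters define a homomorphism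
`bGroupToFun` from `𝔹_G` to all functions modulo permutation characters. Every element of `𝔹_G` is
represented by the orbit data of an action on a covering of a prism (`exists_surfaceAction_mk_eq`),
and every action has a unitary representation, from an invariant complex structure compatible with
the intersection pairing (`SurfaceAction.exists_isUnitaryRep`). This shows that the values of the
homomorphism are classes of virtual characters, and that it is the only one.

*Injectivity.* Permutation characters are real and `conj (coneCharacter γ) = coneCharacter γ⁻¹`, so
it suffices that a tuple with real character contains each class as often as its inverse
(`map_conjInv_eq_of_real`): then twice the tuple is trivial in `𝔹_G`, and the kernel of `θ` is
killed by `2`. Let `n` be the odd part of the multiplicities, and let `x` be an element of maximal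
order `N` with `n x ≠ 0`. At the generators of the cyclic group of `x` only generators of the same
group contribute, and there the character is the convolution of `n` with the function `kappa N` on
the units modulo `N`. The Fourier coefficient of `kappa N` at an odd Dirichlet character `χ` is a
nonzero multiple of `L(1, χ)`, which does not vanish (`sum_char_mul_kappa_ne_zero`), so `n x = 0`.
-/

/-! ### Signatures of real quadratic forms -/

section Signature

open Module QuadraticMap QuadraticForm

variable {V W : Type*} [AddCommGroup V] [Module ℝ V] [AddCommGroup W] [Module ℝ W]

/-- The signature (positive index minus negative index) of a real quadratic form. -/
noncomputable def signature (Q : QuadraticForm ℝ V) : ℤ := (sigPos Q : ℤ) - sigNeg Q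

theorem posDef_restrict_iff (Q : QuadraticForm ℝ V) (U : Submodule ℝ V) :
    (Q.restrict U).PosDef ↔ ∀ x ∈ U, x ≠ 0 → 0 < Q x := by
  constructor
  · intro h x hx hx0
    exact h ⟨x, hx⟩ (by simpa using hx0)
  · rintro h ⟨x, hx⟩ hx0
    exact h x hx (by simpa using hx0)

theorem signature_neg (Q : QuadraticForm ℝ V) : signature (-Q) = -signature Q := by
  simp [signature]

theorem signature_zero : signature (0 : QuadraticForm ℝ V) = 0 := by
  have h : -(0 : QuadraticForm ℝ V) = 0 := neg_zero
  rw [signature, ← sigPos_neg, h, sub_self]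

variable [FiniteDimensional ℝ V] [FiniteDimensional ℝ W]

theorem finrank_le_sigPos (Q : QuadraticForm ℝ V) (U : Submodule ℝ V)
    (h : ∀ x ∈ U, x ≠ 0 → 0 < Q x) : finrank ℝ U ≤ sigPos Q :=
  le_sigPos_of_posDef Q ((posDef_restrict_iff Q U).2 h)

theorem exists_finrank_eq_sigPos (Q : QuadraticForm ℝ V) :
    ∃ U : Submodule ℝ V, finrank ℝ U = sigPos Q ∧ ∀ x ∈ U, x ≠ 0 → 0 < Q x := by
  obtain ⟨U, h1, h2⟩ := exists_finrank_eq_sigPos_and_posDef Q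
  exact ⟨U, h1, (posDef_restrict_iff Q U).1 h2⟩

/-- A positive definite and a negative semidefinite subspace of complementary dimensions determine
the positive index. -/
theorem sigPos_eq_of_finrank_add (Q : QuadraticForm ℝ V) (P N : Submodule ℝ V)
    (hP : ∀ x ∈ P, x ≠ 0 → 0 < Q x) (hN : ∀ x ∈ N, Q x ≤ 0)
    (h : finrank ℝ V ≤ finrank ℝ P + finrank ℝ N) : sigPos Q = finrank ℝ P := by
  have h1 := finrank_le_sigPos Q P hP
  have h2 := sigPos_add_finrank_le_of_nonpos (Q := Q) (V := N) hN
  omega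

/-- A negative semidefinite subspace complementary to a maximal positive definite one. -/
theorem exists_nonpos_finrank (Q : QuadraticForm ℝ V) :
    ∃ N : Submodule ℝ V, (∀ x ∈ N, Q x ≤ 0) ∧ sigPos Q + finrank ℝ N = finrank ℝ V := by
  obtain ⟨N, hN, h⟩ := exists_finrank_eq_sigPos (-Q)
  refine ⟨N ⊔ Q.radical, ?_, ?_⟩
  · intro x hx
    obtain ⟨y, hy, z, hz, rfl⟩ := Submodule.mem_sup.1 hx
    rw [add_comm, (mem_radical_iff'.1 hz).2]
    rcases eq_or_ne y 0 with rfl | hy0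
    · simp
    · have := h y hy hy0
      simp only [neg_apply] at this
      linarith
  · have hd : N ⊓ Q.radical = ⊥ := by
      rw [Submodule.eq_bot_iff]
      rintro x ⟨hx1, hx2⟩
      by_contra hx0
      have := h x hx1 hx0
      simp only [neg_apply, (mem_radical_iff'.1 hx2).1] at this
      linarith
    have h1 := Submodule.finrank_sup_add_finrank_inf_eq N Q.radical
    rw [hd, finrank_bot] at h1
    have h2 := sigPos_add_sigNeg_add_radical (Q := Q)
    rw [sigPos_neg] at hN
    omega

/-- A subspace on which the pulled back form is positive definite is mapped injectively by `f`, and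
conversely such subspaces can be lifted. -/
theorem sigPos_comp_surjective (Q : QuadraticForm ℝ W) (f : V →ₗ[ℝ] W)
    (hf : Function.Surjective f) : sigPos (Q.comp f) = sigPos Q := by
  apply le_antisymm
  · obtain ⟨U, h1, h2⟩ := exists_finrank_eq_sigPos (Q.comp f)
    rw [← h1]
    have hinj : Function.Injective (f.domRestrict U) := by
      rw [← LinearMap.ker_eq_bot, LinearMap.ker_eq_bot']
      rintro ⟨x, hx⟩ hx0
      by_contra hne
      have := h2 x hx (by simpa using hne)
      simp only [LinearMap.domRestrict_apply] at hx0
      simp [hx0] at this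
    rw [← LinearMap.finrank_range_of_inj hinj]
    apply finrank_le_sigPos
    rintro _ ⟨⟨x, hx⟩, rfl⟩ hne
    exact h2 x hx (fun h => hne (by simp [h]))
  · obtain ⟨U, h1, h2⟩ := exists_finrank_eq_sigPos Q
    obtain ⟨g, hg⟩ := f.exists_rightInverse_of_surjective (LinearMap.range_eq_top.2 hf)
    have hg' : ∀ x, f (g x) = x := fun x => LinearMap.congr_fun hg x
    have hinj : Function.Injective g := Function.LeftInverse.injective hg'
    rw [← h1, ← LinearMap.finrank_range_of_inj (f := g.domRestrict U)
      (hinj.comp Subtype.val_injective)]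
    apply finrank_le_sigPos
    rintro _ ⟨⟨x, hx⟩, rfl⟩ hne
    simp only [LinearMap.domRestrict_apply, QuadraticMap.comp_apply, hg']
    refine h2 x hx (fun h => hne (by simp [h]))

theorem signature_comp_surjective (Q : QuadraticForm ℝ W) (f : V →ₗ[ℝ] W)
    (hf : Function.Surjective f) : signature (Q.comp f) = signature Q := by
  have h : -(Q.comp f) = (-Q).comp f := rfl
  rw [signature, signature, ← sigPos_neg, ← sigPos_neg, h, sigPos_comp_surjective _ _ hf,
    sigPos_comp_surjective _ _ hf]

theorem signature_eq_of_surjective (Q : QuadraticForm ℝ V) (Q' : QuadraticForm ℝ W)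
    (f : V →ₗ[ℝ] W) (hf : Function.Surjective f) (h : ∀ x, Q x = Q' (f x)) :
    signature Q = signature Q' := by
  rw [← signature_comp_surjective Q' f hf]
  congr 1
  ext x
  exact h x

theorem sigPos_pi {ι : Type*} [Fintype ι] {M : ι → Type*} [∀ i, AddCommGroup (M i)]
    [∀ i, Module ℝ (M i)] [∀ i, FiniteDimensional ℝ (M i)] (Q : ∀ i, QuadraticForm ℝ (M i)) :
    sigPos (QuadraticMap.pi Q) = ∑ i, sigPos (Q i) := by
  choose P hP1 hP2 using fun i => exists_finrank_eq_sigPos (Q i)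
  choose N hN1 hN2 using fun i => exists_nonpos_finrank (Q i)
  have hfin : ∀ U : ∀ i, Submodule ℝ (M i),
      finrank ℝ (Submodule.pi Set.univ U) = ∑ i, finrank ℝ (U i) := by
    intro U
    rw [← Module.finrank_pi_fintype]
    refine LinearEquiv.finrank_eq
      { toFun := fun x i => ⟨(x : ∀ i, M i) i, x.2 i (Set.mem_univ i)⟩
        invFun := fun x => ⟨fun i => x i, fun i _ => (x i).2⟩
        map_add' := fun _ _ => rfl
        map_smul' := fun _ _ => rfl
        left_inv := fun _ => rfl
        right_inv := fun _ => rfl }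
  rw [sigPos_eq_of_finrank_add (QuadraticMap.pi Q) (Submodule.pi Set.univ P)
    (Submodule.pi Set.univ N), hfin]
  · exact Finset.sum_congr rfl fun i _ => hP1 i
  · intro x hx hne
    obtain ⟨i, hi⟩ := Function.ne_iff.1 hne
    rw [QuadraticMap.pi_apply]
    refine Finset.sum_pos' (fun j _ => ?_) ⟨i, Finset.mem_univ i, hP2 i _ (hx i trivial) hi⟩
    rcases eq_or_ne (x j) 0 with h | h
    · simp [h]
    · exact (hP2 j _ (hx j trivial) h).le
  · intro x hx
    rw [QuadraticMap.pi_apply]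
    exact Finset.sum_nonpos fun i _ => hN1 i _ (hx i trivial)
  · rw [hfin, hfin, Module.finrank_pi_fintype, ← Finset.sum_add_distrib]
    exact Finset.sum_le_sum fun i _ => by rw [hP1, hN2]

theorem signature_pi {ι : Type*} [Fintype ι] {M : ι → Type*} [∀ i, AddCommGroup (M i)]
    [∀ i, Module ℝ (M i)] [∀ i, FiniteDimensional ℝ (M i)] (Q : ∀ i, QuadraticForm ℝ (M i)) :
    signature (QuadraticMap.pi Q) = ∑ i, signature (Q i) := by
  have h : -QuadraticMap.pi Q = QuadraticMap.pi (fun i => -Q i) := by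
    ext x
    simp [QuadraticMap.pi_apply]
  simp only [signature]
  rw [← sigPos_neg, h, sigPos_pi, sigPos_pi]
  simp

theorem sigPos_prod (Q : QuadraticForm ℝ V) (Q' : QuadraticForm ℝ W) :
    sigPos (QuadraticMap.prod Q Q') = sigPos Q + sigPos Q' := by
  obtain ⟨P, hP1, hP2⟩ := exists_finrank_eq_sigPos Q
  obtain ⟨N, hN1, hN2⟩ := exists_nonpos_finrank Q
  obtain ⟨P', hP1', hP2'⟩ := exists_finrank_eq_sigPos Q'
  obtain ⟨N', hN1', hN2'⟩ := exists_nonpos_finrank Q'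
  have hfin : ∀ (U : Submodule ℝ V) (U' : Submodule ℝ W),
      finrank ℝ (U.prod U') = finrank ℝ U + finrank ℝ U' := by
    intro U U'
    rw [← Module.finrank_prod]
    exact LinearEquiv.finrank_eq
      { toFun := fun x => (⟨(x : V × W).1, x.2.1⟩, ⟨(x : V × W).2, x.2.2⟩)
        invFun := fun x => ⟨(x.1, x.2), x.1.2, x.2.2⟩
        map_add' := fun _ _ => rfl
        map_smul' := fun _ _ => rfl
        left_inv := fun _ => rfl
        right_inv := fun _ => rfl }
  rw [sigPos_eq_of_finrank_add (QuadraticMap.prod Q Q') (P.prod P') (N.prod N'), hfin, hP1, hP1']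
  · rintro ⟨x, y⟩ ⟨hx, hy⟩ hne
    rw [QuadraticMap.prod_apply]
    rcases eq_or_ne x 0 with rfl | h
    · have hy0 : y ≠ 0 := fun h => hne (by simp [h])
      simpa using hP2' y hy hy0
    · rcases eq_or_ne y 0 with rfl | h'
      · simpa using hP2 x hx h
      · exact add_pos (hP2 x hx h) (hP2' y hy h')
  · rintro ⟨x, y⟩ ⟨hx, hy⟩
    rw [QuadraticMap.prod_apply]
    exact add_nonpos (hN1 x hx) (hN1' y hy)
  · rw [hfin, hfin, Module.finrank_prod]
    omega

theorem signature_prod (Q : QuadraticForm ℝ V) (Q' : QuadraticForm ℝ W) :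
    signature (QuadraticMap.prod Q Q') = signature Q + signature Q' := by
  have h : -QuadraticMap.prod Q Q' = QuadraticMap.prod (-Q) (-Q') := by
    ext x
    simp [QuadraticMap.prod_apply, add_comm]
  simp only [signature]
  rw [← sigPos_neg, h, sigPos_prod, sigPos_prod]
  simp only [sigPos_neg]
  push_cast
  ring

theorem signature_of_posDef (Q : QuadraticForm ℝ V) (h : ∀ x, x ≠ 0 → 0 < Q x) :
    signature Q = finrank ℝ V := by
  have h1 : sigPos Q = finrank ℝ V := by
    apply le_antisymm (sigPos_le_finrank Q)
    rw [← finrank_top ℝ V]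
    exact finrank_le_sigPos Q ⊤ fun x _ hx => h x hx
  have h2 := sigPos_add_sigNeg_add_radical (Q := Q)
  have h3 : sigNeg Q = 0 := by omega
  rw [signature, h1, h3]
  simp

/-- Restriction to a subspace decreases the positive index by at most the codimension. -/
theorem sigPos_le_sigPos_restrict (Q : QuadraticForm ℝ V) (U : Submodule ℝ V) :
    sigPos Q + finrank ℝ U ≤ sigPos (Q.restrict U) + finrank ℝ V := by
  obtain ⟨P, hP1, hP2⟩ := exists_finrank_eq_sigPos Q
  have h1 := Submodule.finrank_sup_add_finrank_inf_eq P U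
  have h2 := (P ⊔ U).finrank_le
  have h3 : finrank ℝ (P ⊓ U : Submodule ℝ V) ≤ sigPos (Q.restrict U) := by
    have h4 : finrank ℝ (P.comap U.subtype) = finrank ℝ (P ⊓ U : Submodule ℝ V) := by
      rw [inf_comm, ← Submodule.map_comap_subtype]
      exact LinearEquiv.finrank_eq
        (Submodule.equivMapOfInjective U.subtype Subtype.val_injective _)
    rw [← h4]
    apply finrank_le_sigPos
    rintro ⟨x, hxU⟩ hx hne
    exact hP2 x hx (fun h => hne (by simpa using h))
  omega

/-- **Isotropic reduction**: the signature of a quadratic form does not change on passing to the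
orthogonal complement of a totally isotropic subspace. -/
theorem signature_restrict_orthogonal (Q : QuadraticForm ℝ V) (K U : Submodule ℝ V)
    (hK : ∀ k ∈ K, Q k = 0) (hU : ∀ v, v ∈ U ↔ ∀ k ∈ K, polar Q k v = 0) :
    signature (Q.restrict U) = signature Q := by
  let A : V →ₗ[ℝ] Dual ℝ K := K.subtype.dualMap ∘ₗ polarBilin Q
  have hA : ∀ v k, A v k = polar Q v k := fun v k => rfl
  have hkerA : LinearMap.ker A = U := by
    ext v
    rw [LinearMap.mem_ker, hU]
    constructor
    · intro h k hk
      rw [polar_comm]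
      exact LinearMap.congr_fun h ⟨k, hk⟩
    · intro h
      ext ⟨k, hk⟩
      rw [hA, polar_comm]
      exact h k hk
  -- the codimension of `U` is at most the dimension of `K` modulo the radical of `Q`
  let R : Submodule ℝ K := Q.radical.comap K.subtype
  have hrange : LinearMap.range A ≤ R.dualAnnihilator := by
    rintro _ ⟨v, rfl⟩
    rw [Submodule.mem_dualAnnihilator]
    rintro k hk
    rw [hA, polar_comm]
    exact LinearMap.congr_fun hk.2 v
  have h1 := Submodule.finrank_mono hrange
  have h2 := LinearMap.finrank_range_add_finrank_ker A
  rw [hkerA] at h2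
  have h3 := Subspace.finrank_add_finrank_dualAnnihilator_eq R
  have hKU : K ≤ U := by
    intro v hv
    rw [hU]
    intro k hk
    rw [polar, hK _ (K.add_mem hk hv), hK _ hk, hK _ hv]
    simp
  have hrad : K ⊔ Q.radical ≤ (Q.restrict U).radical.map U.subtype := by
    intro x hx
    obtain ⟨k, hk, z, hz, rfl⟩ := Submodule.mem_sup.1 hx
    have hzU : z ∈ U := by
      rw [hU]
      intro k hk
      rw [polar_comm]
      exact LinearMap.congr_fun hz.2 k
    have hz' := mem_radical_iff'.1 hz
    refine ⟨⟨k + z, U.add_mem (hKU hk) hzU⟩, ?_, rfl⟩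
    refine mem_radical_iff'.2 ⟨?_, ?_⟩
    · change Q (k + z) = 0
      rw [add_comm, hz'.2, hK k hk]
    · rintro ⟨u, hu⟩
      change Q (k + z + u) = Q u
      rw [add_right_comm, add_comm, hz'.2]
      have := (hU u).1 hu k hk
      rw [polar, hK k hk] at this
      linarith
  have h4 := Submodule.finrank_mono hrad
  rw [LinearEquiv.finrank_eq (Submodule.equivMapOfInjective U.subtype Subtype.val_injective
    (Q.restrict U).radical).symm] at h4
  have h5 := Submodule.finrank_sup_add_finrank_inf_eq K Q.radical
  have h6 : finrank ℝ R = finrank ℝ (K ⊓ Q.radical : Submodule ℝ V) := by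
    rw [← Submodule.map_comap_subtype]
    exact LinearEquiv.finrank_eq (Submodule.equivMapOfInjective K.subtype Subtype.val_injective R)
  have h7 := sigPos_add_sigNeg_add_radical (Q := Q)
  have h8 := sigPos_add_sigNeg_add_radical (Q := Q.restrict U)
  have h9 := sigPos_le_sigPos_restrict Q U
  have h10 := sigPos_le_sigPos_restrict (-Q) U
  have h11 : (-Q).restrict U = -(Q.restrict U) := rfl
  rw [h11, sigPos_neg, sigPos_neg] at h10
  simp only [signature]
  omega

end Signature

/-! ### The Meyer cocycle of a symplectic vector space -/

section Meyer

open Module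

variable {V : Type*} [AddCommGroup V] [Module ℝ V]

/-- The space `{(x, y) | (a - 1) x + (b - 1) y = 0}`: the twisted cycles of a bouquet of two
loops with monodromies `a` and `b`. -/
def meyerSpace (a b : End ℝ V) : Submodule ℝ (V × V) :=
  LinearMap.ker ((a - 1) ∘ₗ LinearMap.fst ℝ V V + (b - 1) ∘ₗ LinearMap.snd ℝ V V)

theorem mem_meyerSpace {a b : End ℝ V} {p : V × V} :
    p ∈ meyerSpace a b ↔ (a p.1 - p.1) + (b p.2 - p.2) = 0 := by
  simp [meyerSpace]

/-- The quadratic form `(x, y) ↦ Ω(x, a x) + Ω(y, b y)` on `V × V`; on `meyerSpace a b` it is the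
twisted intersection form of a pair of pants. -/
noncomputable def meyerForm (Ω : LinearMap.BilinForm ℝ V) (a b : End ℝ V) :
    QuadraticForm ℝ (V × V) :=
  LinearMap.BilinMap.toQuadraticMap
    (Ω.compl₁₂ (LinearMap.fst ℝ V V) (a ∘ₗ LinearMap.fst ℝ V V)
      + Ω.compl₁₂ (LinearMap.snd ℝ V V) (b ∘ₗ LinearMap.snd ℝ V V))

theorem meyerForm_apply (Ω : LinearMap.BilinForm ℝ V) (a b : End ℝ V) (p : V × V) :
    meyerForm Ω a b p = Ω p.1 (a p.1) + Ω p.2 (b p.2) := by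
  simp [meyerForm]

/-- The Meyer cocycle: the signature of the intersection form of a pair of pants with boundary
monodromies `a`, `b` and `(a b)⁻¹`. -/
noncomputable def meyer (Ω : LinearMap.BilinForm ℝ V) (a b : End ℝ V) : ℤ :=
  signature ((meyerForm Ω a b).restrict (meyerSpace a b))

/-- The twisted cycles of a bouquet of three loops with monodromies `a`, `b` and `c`. -/
def meyerSpace₃ (a b c : End ℝ V) : Submodule ℝ (V × V × V) :=
  LinearMap.ker ((a - 1) ∘ₗ LinearMap.fst ℝ V (V × V)
    + (b - 1) ∘ₗ LinearMap.fst ℝ V V ∘ₗ LinearMap.snd ℝ V (V × V)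
    + (c - 1) ∘ₗ LinearMap.snd ℝ V V ∘ₗ LinearMap.snd ℝ V (V × V))

theorem mem_meyerSpace₃ {a b c : End ℝ V} {p : V × V × V} :
    p ∈ meyerSpace₃ a b c ↔ (a p.1 - p.1) + (b p.2.1 - p.2.1) + (c p.2.2 - p.2.2) = 0 := by
  simp [meyerSpace₃]

/-- The twisted intersection form of a sphere with four holes, in terms of the bouquet of three of
its boundary circles. -/
noncomputable def meyerForm₃ (Ω : LinearMap.BilinForm ℝ V) (a b c : End ℝ V) :
    QuadraticForm ℝ (V × V × V) :=
  LinearMap.BilinMap.toQuadraticMap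
    (Ω.compl₁₂ (LinearMap.fst ℝ V (V × V)) (a ∘ₗ LinearMap.fst ℝ V (V × V))
      + Ω.compl₁₂ (LinearMap.fst ℝ V V ∘ₗ LinearMap.snd ℝ V (V × V))
        (b ∘ₗ LinearMap.fst ℝ V V ∘ₗ LinearMap.snd ℝ V (V × V))
      + Ω.compl₁₂ (LinearMap.snd ℝ V V ∘ₗ LinearMap.snd ℝ V (V × V))
        (c ∘ₗ LinearMap.snd ℝ V V ∘ₗ LinearMap.snd ℝ V (V × V))
      + Ω.compl₁₂ ((a - 1) ∘ₗ LinearMap.fst ℝ V (V × V))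
        ((b - 1) ∘ₗ LinearMap.fst ℝ V V ∘ₗ LinearMap.snd ℝ V (V × V)))

theorem meyerForm₃_apply (Ω : LinearMap.BilinForm ℝ V) (a b c : End ℝ V) (p : V × V × V) :
    meyerForm₃ Ω a b c p = Ω p.1 (a p.1) + Ω p.2.1 (b p.2.1) + Ω p.2.2 (c p.2.2)
      + Ω (a p.1 - p.1) (b p.2.1 - p.2.1) := by
  simp [meyerForm₃]

variable {Ω : LinearMap.BilinForm ℝ V}

theorem antisymm_of_self_eq_zero (hΩ : ∀ x, Ω x x = 0) (x y : V) : Ω x y + Ω y x = 0 := by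
  have h := hΩ (x + y)
  simp only [map_add, LinearMap.add_apply, hΩ] at h
  linarith

variable [FiniteDimensional ℝ V]

/-- For a symplectic map `T`, the range of `T - 1` is the symplectic complement of its kernel. -/
theorem mem_range_sub_one (hΩn : ∀ x, (∀ y, Ω x y = 0) → x = 0) (T : End ℝ V)
    (hT : ∀ x y, Ω (T x) (T y) = Ω x y) (w : V) (hw : ∀ k, T k = k → Ω k w = 0) :
    ∃ y, T y - y = w := by
  by_contra hne
  have hmem : w ∉ LinearMap.range (T - 1) := by
    rintro ⟨y, hy⟩
    exact hne ⟨y, by simpa using hy⟩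
  obtain ⟨f, hf, hfw⟩ := Submodule.exists_le_ker_of_notMem hmem
  have hinj : Function.Injective Ω := by
    rw [← LinearMap.ker_eq_bot, LinearMap.ker_eq_bot']
    intro x hx
    exact hΩn x fun y => by rw [hx]; rfl
  have hsurj : Function.Surjective Ω :=
    (LinearMap.injective_iff_surjective_of_finrank_eq_finrank
      (Subspace.dual_finrank_eq (K := ℝ) (V := V)).symm).1 hinj
  obtain ⟨k, rfl⟩ := hsurj f
  have hTinj : Function.Injective T := by
    rw [← LinearMap.ker_eq_bot, LinearMap.ker_eq_bot']
    intro x hx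
    refine hΩn x fun y => ?_
    rw [← hT, hx, map_zero, LinearMap.zero_apply]
  have hTsurj := LinearMap.injective_iff_surjective.1 hTinj
  refine hf (hw k ?_)
  rw [← sub_eq_zero]
  refine hΩn _ fun y => ?_
  obtain ⟨x, rfl⟩ := hTsurj y
  have := hfw ⟨x, rfl⟩
  rw [LinearMap.mem_ker, LinearMap.sub_apply, Module.End.one_apply, map_sub] at this
  rw [map_sub, LinearMap.sub_apply, hT]
  linarith

/-- Novikov additivity for the decomposition of the sphere with four holes along the curve with
monodromy `a b`. -/
theorem signature_meyerForm₃_left (hΩ : ∀ x, Ω x x = 0) (hΩn : ∀ x, (∀ y, Ω x y = 0) → x = 0)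
    (a b c : End ℝ V) (ha : ∀ x y, Ω (a x) (a y) = Ω x y) (hb : ∀ x y, Ω (b x) (b y) = Ω x y) :
    signature ((meyerForm₃ Ω a b c).restrict (meyerSpace₃ a b c))
      = meyer Ω a b + meyer Ω (a * b) c := by
  have anti := antisymm_of_self_eq_zero hΩ
  -- the cycles on the separating curve itself, one for each vector `k` fixed by `a b`
  let K : Submodule ℝ (meyerSpace₃ a b c) :=
    { carrier := {p | ∃ k, a (b k) = k ∧ (p : V × V × V) = (b k, k, 0)}
      zero_mem' := ⟨0, by simp, by simp; rfl⟩
      add_mem' := by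
        rintro p q ⟨k, hk, hp⟩ ⟨l, hl, hq⟩
        exact ⟨k + l, by simp [hk, hl], by simp [hp, hq]⟩
      smul_mem' := by
        rintro r p ⟨k, hk, hp⟩
        exact ⟨r • k, by simp [hk], by simp [hp]⟩ }
  -- the cycles that can be cut along the curve, which form the orthogonal complement of `K`
  let U : Submodule ℝ (meyerSpace₃ a b c) :=
    { carrier := {p | ∃ y, a (b y) - y
        = (a (p : V × V × V).1 - (p : V × V × V).1) + (b (p : V × V × V).2.1 - (p : V × V × V).2.1)}
      zero_mem' := ⟨0, by simp⟩
      add_mem' := by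
        rintro p q ⟨k, hk⟩ ⟨l, hl⟩
        refine ⟨k + l, ?_⟩
        have := congrArg₂ (· + ·) hk hl
        simp only [Submodule.coe_add, Prod.fst_add, Prod.snd_add, map_add]
        rw [add_sub_add_comm, this]
        abel
      smul_mem' := by
        rintro r p ⟨k, hk⟩
        refine ⟨r • k, ?_⟩
        simp only [Submodule.coe_smul, Prod.smul_fst, Prod.smul_snd, map_smul]
        rw [← smul_sub, hk, smul_add, smul_sub, smul_sub] }
  rw [← signature_restrict_orthogonal _ K U, meyer, meyer, ← signature_prod]
  · symm
    -- gluing two cycles on the two pairs of pants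
    let f : (meyerSpace a b × meyerSpace (a * b) c) →ₗ[ℝ] U :=
      { toFun := fun p => ⟨⟨((p.1 : V × V).1 + b (p.2 : V × V).1,
          (p.1 : V × V).2 + (p.2 : V × V).1, (p.2 : V × V).2), by
            have h1 := mem_meyerSpace.1 p.1.2
            have h2 := mem_meyerSpace.1 p.2.2
            rw [mem_meyerSpace₃]
            simp only [map_add, Module.End.mul_apply] at h1 h2 ⊢
            rw [← add_zero (0 : V)]
            nth_rewrite 1 [← h1]
            rw [← h2]
            abel⟩, (p.2 : V × V).1, by
            have h1 := mem_meyerSpace.1 p.1.2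
            simp only [map_add]
            rw [← add_zero (a _ - _), ← h1]
            abel⟩
        map_add' := fun p q => by
          ext <;> simp <;> abel
        map_smul' := fun r p => by
          ext <;> simp }
    refine signature_eq_of_surjective _ _ f ?_ ?_
    · rintro ⟨⟨⟨x, y, z⟩, hp⟩, w, hw⟩
      rw [mem_meyerSpace₃] at hp
      simp only at hp hw
      refine ⟨(⟨(x - b w, y - w), ?_⟩, ⟨(w, z), ?_⟩), ?_⟩
      · rw [mem_meyerSpace]
        simp only [map_sub]
        rw [← sub_eq_zero] at hw
        rw [← neg_eq_zero, ← hw]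
        abel
      · rw [mem_meyerSpace]
        simp only [Module.End.mul_apply]
        rw [hw, hp]
      · ext <;> simp [f]
    · rintro ⟨⟨⟨x, y⟩, h1⟩, ⟨⟨w, z⟩, h2⟩⟩
      rw [mem_meyerSpace] at h1
      simp only [QuadraticMap.prod_apply, QuadraticMap.restrict_apply, meyerForm_apply,
        meyerForm₃_apply, f, LinearMap.coe_mk, AddHom.coe_mk, Module.End.mul_apply]
      have hax : a x = x + y - b y := by
        rw [← sub_eq_zero, ← h1]
        abel
      have e1 := ha x (b w)
      have e2 := hb y w
      rw [hax] at e1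
      simp only [map_add, map_sub, LinearMap.add_apply, LinearMap.sub_apply, hax, hΩ] at e1 ⊢
      linarith [anti x y, anti x w, anti x (b y), anti x (b w), anti x (a (b w)), anti y w,
        anti y (b y), anti y (b w), anti y (a (b w)), anti w (b y), anti w (b w),
        anti w (a (b w)), anti (b y) (b w), anti (b y) (a (b w)), anti (b w) (a (b w))]
  · rintro p ⟨k, hk, hp⟩
    simp only [QuadraticMap.restrict_apply, hp, meyerForm₃_apply, hk, map_zero, map_sub,
      LinearMap.sub_apply, hΩ]
    linarith [anti k (b k)]
  -- `U` is the orthogonal complement of `K`: the fixed vectors of an isometry `T` are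
  -- orthogonal to a vector exactly if it lies in the range of `T - 1`
  · have key : ∀ (p : meyerSpace₃ a b c) (k : V) (hk : a (b k) = k)
        (q : meyerSpace₃ a b c), (q : V × V × V) = (b k, k, 0) →
        QuadraticMap.polar ((meyerForm₃ Ω a b c).restrict (meyerSpace₃ a b c)) q p
          = 2 * Ω k ((a (p : V × V × V).1 - (p : V × V × V).1)
            + (b (p : V × V × V).2.1 - (p : V × V × V).2.1)) := by
      rintro ⟨⟨x, y, z⟩, hp⟩ k hk q hq
      simp only [QuadraticMap.polar, QuadraticMap.restrict_apply, meyerForm₃_apply, hq,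
        Submodule.coe_add, Prod.mk_add_mk, map_add, map_sub, LinearMap.add_apply,
        LinearMap.sub_apply, hk, hΩ, map_zero, zero_add]
      have e1 := ha (b k) x
      have e2 := hb k y
      rw [hk] at e1
      linarith [anti x y, anti x (b y), anti x (b k), anti x k, anti y k, anti y (b k),
        anti (a x) k, anti (a x) (b k), anti (b y) k, anti (b y) (b k), anti k (b k),
        anti (a x) (b y), anti (a x) y]
    intro p
    constructor
    · rintro ⟨y, hy⟩ q ⟨k, hk, hq⟩
      rw [key p k hk q hq, ← hy, map_sub]
      have := ha (b k) (b y)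
      rw [hk, hb] at this
      rw [this]
      ring
    · intro h
      obtain ⟨y, hy⟩ := mem_range_sub_one hΩn (a * b) (by simp [ha, hb])
        ((a (p : V × V × V).1 - (p : V × V × V).1)
            + (b (p : V × V × V).2.1 - (p : V × V × V).2.1)) (by
          intro k hk
          have hmem : ((b k, k, 0) : V × V × V) ∈ meyerSpace₃ a b c := by
            rw [mem_meyerSpace₃]
            simp only [Module.End.mul_apply] at hk
            simp [hk]
          have := h ⟨_, hmem⟩ ⟨k, hk, rfl⟩
          rw [key p k hk _ rfl] at this
          linarith)
      exact ⟨y, hy⟩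

/-- Novikov additivity for the decomposition of the sphere with four holes along the curve with
monodromy `b c`. -/
theorem signature_meyerForm₃_right (hΩ : ∀ x, Ω x x = 0) (hΩn : ∀ x, (∀ y, Ω x y = 0) → x = 0)
    (a b c : End ℝ V) (hb : ∀ x y, Ω (b x) (b y) = Ω x y) (hc : ∀ x y, Ω (c x) (c y) = Ω x y) :
    signature ((meyerForm₃ Ω a b c).restrict (meyerSpace₃ a b c))
      = meyer Ω b c + meyer Ω a (b * c) := by
  have anti := antisymm_of_self_eq_zero hΩ
  -- the cycles on the separating curve itself, one for each vector `k` fixed by `b c`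
  let K : Submodule ℝ (meyerSpace₃ a b c) :=
    { carrier := {p | ∃ k, b (c k) = k ∧ (p : V × V × V) = (0, c k, k)}
      zero_mem' := ⟨0, by simp, by simp; rfl⟩
      add_mem' := by
        rintro p q ⟨k, hk, hp⟩ ⟨l, hl, hq⟩
        exact ⟨k + l, by simp [hk, hl], by simp [hp, hq]⟩
      smul_mem' := by
        rintro r p ⟨k, hk, hp⟩
        exact ⟨r • k, by simp [hk], by simp [hp]⟩ }
  -- the cycles that can be cut along the curve, which form the orthogonal complement of `K`
  let U : Submodule ℝ (meyerSpace₃ a b c) :=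
    { carrier := {p | ∃ y, b (c y) - y = (b (p : V × V × V).2.1 - (p : V × V × V).2.1)
        + (c (p : V × V × V).2.2 - (p : V × V × V).2.2)}
      zero_mem' := ⟨0, by simp⟩
      add_mem' := by
        rintro p q ⟨k, hk⟩ ⟨l, hl⟩
        refine ⟨k + l, ?_⟩
        have := congrArg₂ (· + ·) hk hl
        simp only [Submodule.coe_add, Prod.fst_add, Prod.snd_add, map_add]
        rw [add_sub_add_comm, this]
        abel
      smul_mem' := by
        rintro r p ⟨k, hk⟩
        refine ⟨r • k, ?_⟩
        simp only [Submodule.coe_smul, Prod.smul_fst, Prod.smul_snd, map_smul]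
        rw [← smul_sub, hk, smul_add, smul_sub, smul_sub] }
  rw [← signature_restrict_orthogonal _ K U, meyer, meyer, ← signature_prod]
  · symm
    -- gluing two cycles on the two pairs of pants
    let f : (meyerSpace b c × meyerSpace a (b * c)) →ₗ[ℝ] U :=
      { toFun := fun p => ⟨⟨((p.2 : V × V).1, (p.1 : V × V).1 + c (p.2 : V × V).2,
          (p.1 : V × V).2 + (p.2 : V × V).2), by
            have h1 := mem_meyerSpace.1 p.1.2
            have h2 := mem_meyerSpace.1 p.2.2
            rw [mem_meyerSpace₃]
            simp only [map_add, Module.End.mul_apply] at h1 h2 ⊢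
            rw [← add_zero (0 : V)]
            nth_rewrite 1 [← h1]
            rw [← h2]
            abel⟩, (p.2 : V × V).2, by
            have h1 := mem_meyerSpace.1 p.1.2
            simp only [map_add]
            rw [← add_zero (b (c _) - _), ← h1]
            abel⟩
        map_add' := fun p q => by
          ext <;> simp <;> abel
        map_smul' := fun r p => by
          ext <;> simp }
    refine signature_eq_of_surjective _ _ f ?_ ?_
    · rintro ⟨⟨⟨x, y, z⟩, hp⟩, w, hw⟩
      rw [mem_meyerSpace₃] at hp
      simp only at hp hw
      refine ⟨(⟨(y - c w, z - w), ?_⟩, ⟨(x, w), ?_⟩), ?_⟩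
      · rw [mem_meyerSpace]
        simp only [map_sub]
        rw [← sub_eq_zero] at hw
        rw [← neg_eq_zero, ← hw]
        abel
      · rw [mem_meyerSpace]
        simp only [Module.End.mul_apply]
        rw [hw, ← hp, add_assoc]
      · ext <;> simp [f]
    · rintro ⟨⟨⟨y, z⟩, h1⟩, ⟨⟨x, w⟩, h2⟩⟩
      rw [mem_meyerSpace] at h1 h2
      simp only [QuadraticMap.prod_apply, QuadraticMap.restrict_apply, meyerForm_apply,
        meyerForm₃_apply, f, LinearMap.coe_mk, AddHom.coe_mk, Module.End.mul_apply] at h2 ⊢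
      have hcz : c z = z + y - b y := by
        rw [← sub_eq_zero, ← h1]
        abel
      have hax : a x = x + w - b (c w) := by
        rw [← sub_eq_zero, ← h2]
        abel
      have e1 := hc z w
      have e2 := hb y (c w)
      rw [hcz] at e1
      simp only [map_add, map_sub, LinearMap.add_apply, LinearMap.sub_apply, hax, hcz, hΩ]
        at e1 ⊢
      linarith [anti w y, anti w (b y), anti w (c w), anti w z, anti w (b (c w)), anti y (b y),
        anti y (c w), anti y z, anti y (b (c w)), anti (b y) (c w), anti (b y) z,
        anti (b y) (b (c w)), anti (c w) z, anti (c w) (b (c w)), anti z (b (c w))]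
  · rintro p ⟨k, hk, hp⟩
    simp only [QuadraticMap.restrict_apply, hp, meyerForm₃_apply, hk, map_zero, sub_self,
      LinearMap.zero_apply]
    linarith [anti k (c k)]
  -- `U` is the orthogonal complement of `K`: the fixed vectors of an isometry `T` are
  -- orthogonal to a vector exactly if it lies in the range of `T - 1`
  · have key : ∀ (p : meyerSpace₃ a b c) (k : V) (hk : b (c k) = k)
        (q : meyerSpace₃ a b c), (q : V × V × V) = (0, c k, k) →
        QuadraticMap.polar ((meyerForm₃ Ω a b c).restrict (meyerSpace₃ a b c)) q p
          = 2 * Ω k ((b (p : V × V × V).2.1 - (p : V × V × V).2.1)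
            + (c (p : V × V × V).2.2 - (p : V × V × V).2.2)) := by
      rintro ⟨⟨x, y, z⟩, hp⟩ k hk q hq
      rw [mem_meyerSpace₃] at hp
      have hax : a x = x - (b y - y) - (c z - z) := by
        rw [← sub_eq_zero, ← hp]
        abel
      simp only [QuadraticMap.polar, QuadraticMap.restrict_apply, meyerForm₃_apply, hq,
        Submodule.coe_add, Prod.mk_add_mk, map_add, map_sub, LinearMap.add_apply,
        LinearMap.sub_apply, hk, hΩ, map_zero, LinearMap.zero_apply, zero_add, hax]
      have e1 := hb (c k) y
      have e2 := hc k z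
      rw [hk] at e1
      linarith [anti k y, anti k (b y), anti k (c k), anti k z, anti k (c z), anti (c k) y,
        anti (c k) z, anti (c k) (b y), anti (c k) (c z), anti y (b y), anti y z, anti y (c z),
        anti (b y) z, anti (b y) (c z), anti z (c z)]
    intro p
    constructor
    · rintro ⟨y, hy⟩ q ⟨k, hk, hq⟩
      rw [key p k hk q hq, ← hy, map_sub]
      have := hb (c k) (c y)
      rw [hk, hc] at this
      rw [this]
      ring
    · intro h
      obtain ⟨y, hy⟩ := mem_range_sub_one hΩn (b * c) (by simp [hb, hc])
        ((b (p : V × V × V).2.1 - (p : V × V × V).2.1)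
            + (c (p : V × V × V).2.2 - (p : V × V × V).2.2)) (by
          intro k hk
          have hmem : ((0, c k, k) : V × V × V) ∈ meyerSpace₃ a b c := by
            rw [mem_meyerSpace₃]
            simp only [Module.End.mul_apply] at hk
            simp [hk]
          have := h ⟨_, hmem⟩ ⟨k, hk, rfl⟩
          rw [key p k hk _ rfl] at this
          linarith)
      exact ⟨y, hy⟩

/-- The cocycle identity for the Meyer cocycle: both sides are the signature of a sphere with four
holes, cut into two pairs of pants in two different ways. -/
theorem meyer_cocycle (hΩ : ∀ x, Ω x x = 0) (hΩn : ∀ x, (∀ y, Ω x y = 0) → x = 0)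
    (a b c : End ℝ V) (ha : ∀ x y, Ω (a x) (a y) = Ω x y) (hb : ∀ x y, Ω (b x) (b y) = Ω x y)
    (hc : ∀ x y, Ω (c x) (c y) = Ω x y) :
    meyer Ω a b + meyer Ω (a * b) c = meyer Ω b c + meyer Ω a (b * c) := by
  rw [← signature_meyerForm₃_left hΩ hΩn a b c ha hb,
    ← signature_meyerForm₃_right hΩ hΩn a b c hb hc]

/-- Over a finite group the Meyer cocycle is the coboundary of its average `s`, and the value of
`s` at an element of finite order is determined by the powers of that element. -/
theorem exists_meyer_eq_coboundary {Γ : Type*} [Group Γ] [Finite Γ]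
    (hΩ : ∀ x, Ω x x = 0) (hΩn : ∀ x, (∀ y, Ω x y = 0) → x = 0) (R : Γ →* End ℝ V)
    (hR : ∀ g x y, Ω (R g x) (R g y) = Ω x y) :
    ∃ s : Γ → ℝ, (∀ g h, (meyer Ω (R g) (R h) : ℝ) = s g + s h - s (g * h)) ∧
      ∀ (g : Γ) (n : ℕ), g ^ n = 1 →
        n * s g = ∑ j ∈ Finset.range n, (meyer Ω (R g) (R (g ^ j)) : ℝ) := by
  have : Fintype Γ := Fintype.ofFinite Γ
  have hcard : (Fintype.card Γ : ℝ) ≠ 0 := by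
    exact_mod_cast Fintype.card_ne_zero
  have main : ∃ s : Γ → ℝ, ∀ g h, (meyer Ω (R g) (R h) : ℝ) = s g + s h - s (g * h) := by
    refine ⟨fun g => (Fintype.card Γ : ℝ)⁻¹ * ∑ x, (meyer Ω (R g) (R x) : ℝ), fun g h => ?_⟩
    have h1 : ∀ x, (meyer Ω (R g) (R h) : ℝ) = meyer Ω (R h) (R x) + meyer Ω (R g) (R (h * x))
        - meyer Ω (R (g * h)) (R x) := by
      intro x
      have := meyer_cocycle hΩ hΩn (R g) (R h) (R x) (hR g) (hR h) (hR x)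
      rw [map_mul, map_mul, eq_sub_iff_add_eq]
      exact_mod_cast this
    have h2 : ∑ x, (meyer Ω (R g) (R (h * x)) : ℝ) = ∑ x, (meyer Ω (R g) (R x) : ℝ) :=
      Equiv.sum_comp (Equiv.mulLeft h) fun x => (meyer Ω (R g) (R x) : ℝ)
    have h3 : (Fintype.card Γ : ℝ) * meyer Ω (R g) (R h) = ∑ x, (meyer Ω (R h) (R x) : ℝ)
        + ∑ x, (meyer Ω (R g) (R x) : ℝ) - ∑ x, (meyer Ω (R (g * h)) (R x) : ℝ) := by
      rw [← h2, ← Finset.sum_add_distrib, ← Finset.sum_sub_distrib,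
        ← Finset.sum_congr rfl fun x _ => h1 x]
      simp
    field_simp
    linarith
  obtain ⟨s, hs⟩ := main
  refine ⟨s, hs, fun g n hn => ?_⟩
  have h4 : ∀ j ∈ Finset.range n, (meyer Ω (R g) (R (g ^ j)) : ℝ)
      = s g - (s (g ^ (j + 1)) - s (g ^ j)) := by
    intro j _
    rw [hs, ← pow_succ']
    ring
  rw [Finset.sum_congr rfl h4, Finset.sum_sub_distrib, Finset.sum_range_sub (fun j => s (g ^ j)),
    hn]
  simp

end Meyer

/-! ### The sawtooth function -/

section Sawtooth

open Real

/-- The sawtooth function: `1 - 2 x` for `0 < x < 1`, zero at the integers, with period `1`. -/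
noncomputable def saw (x : ℝ) : ℝ := if Int.fract x = 0 then 0 else 1 - 2 * Int.fract x

theorem saw_zero : saw 0 = 0 := by simp [saw]

theorem saw_of_fract_eq {x y : ℝ} (h : Int.fract x = Int.fract y) : saw x = saw y := by
  simp [saw, h]

theorem saw_of_mem {x : ℝ} (h0 : 0 < x) (h1 : x < 1) : saw x = 1 - 2 * x := by
  have h : Int.fract x = x := Int.fract_eq_self.2 ⟨h0.le, h1⟩
  simp [saw, h, h0.ne']

theorem saw_natCast (n : ℕ) : saw n = 0 := by simp [saw]

/-- The failure of additivity of the sawtooth function is the sign of a trigonometric expression,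
which occurs as the coefficient of the Meyer form on an eigenspace. -/
theorem sign_eq_saw_add_saw_sub (x y : ℝ) :
    (SignType.sign (sin (2 * π * x) * (2 - 2 * cos (2 * π * y))
      + sin (2 * π * y) * (2 - 2 * cos (2 * π * x))) : ℝ) = saw x + saw y - saw (x + y) := by
  have hper : ∀ z : ℝ, sin (2 * π * z) = sin (2 * π * Int.fract z) ∧
      cos (2 * π * z) = cos (2 * π * Int.fract z) := by
    intro z
    have h : 2 * π * z = 2 * π * Int.fract z + ⌊z⌋ * (2 * π) := by
      nth_rewrite 1 [← Int.fract_add_floor z]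
      ring
    rw [h, sin_add_int_mul_two_pi, cos_add_int_mul_two_pi]
    exact ⟨rfl, rfl⟩
  have hxy : saw (x + y) = saw (Int.fract x + Int.fract y) := by
    apply saw_of_fract_eq
    rw [Int.fract_eq_fract]
    refine ⟨⌊x⌋ + ⌊y⌋, ?_⟩
    push_cast
    linarith [Int.fract_add_floor x, Int.fract_add_floor y]
  rw [(hper x).1, (hper x).2, (hper y).1, (hper y).2, hxy,
    ← saw_of_fract_eq (Int.fract_fract x), ← saw_of_fract_eq (Int.fract_fract y)]
  have ha0 := Int.fract_nonneg x
  have ha1 := Int.fract_lt_one x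
  have hb0 := Int.fract_nonneg y
  have hb1 := Int.fract_lt_one y
  generalize Int.fract x = a at *
  generalize Int.fract y = b at *
  have key : sin (2 * π * a) * (2 - 2 * cos (2 * π * b))
        + sin (2 * π * b) * (2 - 2 * cos (2 * π * a))
      = 8 * (sin (π * a) * sin (π * b)) * sin (π * (a + b)) := by
    have e1 : ∀ t : ℝ, 2 * π * t = 2 * (π * t) := fun t => by ring
    rw [e1, e1, sin_two_mul, sin_two_mul, cos_two_mul', cos_two_mul', mul_add, sin_add]
    have h1 := sin_sq_add_cos_sq (π * a)
    have h2 := sin_sq_add_cos_sq (π * b)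
    rw [cos_sq', cos_sq']
    ring
  rw [key]
  rcases ha0.eq_or_lt with rfl | ha
  · simp [saw_zero]
  rcases hb0.eq_or_lt with rfl | hb
  · simp [saw_zero]
  have hpos : ∀ t : ℝ, 0 < t → t < 1 → 0 < sin (π * t) := by
    intro t h0 h1
    apply sin_pos_of_pos_of_lt_pi
    · positivity
    · nlinarith [pi_pos]
  have hc : 0 < 8 * (sin (π * a) * sin (π * b)) :=
    mul_pos (by norm_num) (mul_pos (hpos a ha ha1) (hpos b hb hb1))
  rw [saw_of_mem ha ha1, saw_of_mem hb hb1]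
  rcases lt_trichotomy (a + b) 1 with h | h | h
  · rw [saw_of_mem (by linarith) h, sign_pos (mul_pos hc (hpos _ (by linarith) h))]
    norm_num
    ring
  · have hs : saw (a + b) = 0 := by
      rw [h]
      simpa using saw_natCast 1
    rw [hs, h]
    simp
    linarith
  · have e : saw (a + b) = saw (a + b - 1) := by
      apply saw_of_fract_eq
      rw [Int.fract_sub_one]
    have hneg : sin (π * (a + b)) < 0 := by
      have h2 : sin (π * (a + b)) = -sin (π * (a + b - 1)) := by
        rw [← sin_add_pi]
        congr 1
        ring
      rw [h2, neg_lt_zero]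
      exact hpos _ (by linarith) (by linarith)
    rw [e, saw_of_mem (by linarith) (by linarith), sign_neg (mul_neg_of_pos_of_neg hc hneg)]
    norm_num
    ring

end Sawtooth

/-! ### The Meyer cocycle of a unitary transformation of finite order -/

section Unitary

open Module Complex

variable {E : Type*} [NormedAddCommGroup E] [InnerProductSpace ℂ E]

/-- The symplectic form `Im ⟪x, y⟫` of a complex inner product space. -/
noncomputable def imForm (E : Type*) [NormedAddCommGroup E] [InnerProductSpace ℂ E] :
    LinearMap.BilinForm ℝ E :=
  LinearMap.mk₂ ℝ (fun x y => (inner ℂ x y).im)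
    (fun x y z => by rw [inner_add_left, add_im])
    (fun c x y => by rw [← Complex.coe_smul, inner_smul_left, conj_ofReal, im_ofReal_mul,
      smul_eq_mul])
    (fun x y z => by rw [inner_add_right, add_im])
    (fun c x y => by rw [← Complex.coe_smul, inner_smul_right, im_ofReal_mul, smul_eq_mul])

theorem imForm_apply (x y : E) : imForm E x y = (inner ℂ x y).im := rfl

theorem imForm_self (x : E) : imForm E x x = 0 := by
  rw [imForm_apply, inner_self_eq_norm_sq_to_K]
  norm_cast

theorem imForm_nondegenerate (x : E) (h : ∀ y, imForm E x y = 0) : x = 0 := by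
  have h1 := h (I • x)
  rw [imForm_apply, inner_smul_right, inner_self_eq_norm_sq_to_K] at h1
  have h2 : (‖x‖ ^ 2 : ℝ) = 0 := by
    rw [← h1]
    simp [← ofReal_pow]
  simpa using h2

/-- The `k`-th root of unity `exp (2πik/N)`. -/
noncomputable def rootExp (N : ℕ) (k : ℕ) : ℂ := exp (2 * Real.pi * ((k / N : ℝ) : ℂ) * I)

theorem rootExp_eq (N k : ℕ) : rootExp N k = exp (2 * Real.pi * I / N) ^ k := by
  rw [rootExp, ← exp_nat_mul]
  congr 1
  push_cast
  ring

theorem rootExp_pow_self {N : ℕ} (hN : N ≠ 0) (k : ℕ) : rootExp N k ^ N = 1 := by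
  rw [rootExp_eq, ← pow_mul, mul_comm k, pow_mul, (isPrimitiveRoot_exp N hN).pow_eq_one, one_pow]

theorem rootExp_ne_one {N k : ℕ} (h0 : 0 < k) (h : k < N) : rootExp N k ≠ 1 := by
  rw [rootExp_eq]
  exact (isPrimitiveRoot_exp N (by omega)).pow_ne_one_of_pos_of_lt h0.ne' h

theorem rootExp_zero (N : ℕ) : rootExp N 0 = 1 := by simp [rootExp]

theorem rootExp_ne_zero (N k : ℕ) : rootExp N k ≠ 0 := exp_ne_zero _

theorem rootExp_inj {N k l : ℕ} (hk : k < N) (hl : l < N) (h : rootExp N k = rootExp N l) :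
    k = l := by
  rw [rootExp_eq, rootExp_eq] at h
  exact (isPrimitiveRoot_exp N (by omega)).pow_inj hk hl h

theorem conj_rootExp_mul_self (N k : ℕ) : (starRingEnd ℂ) (rootExp N k) * rootExp N k = 1 := by
  rw [mul_comm, mul_conj, normSq_eq_norm_sq]
  have : ‖rootExp N k‖ = 1 := by
    rw [rootExp, ← ofReal_ofNat, ← ofReal_mul, ← ofReal_mul]
    exact norm_exp_ofReal_mul_I _
  rw [this]
  norm_num

theorem im_rootExp (N k : ℕ) : (rootExp N k).im = Real.sin (2 * Real.pi * (k / N)) := by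
  rw [rootExp, ← ofReal_ofNat, ← ofReal_mul, ← ofReal_mul, exp_ofReal_mul_I_im]

theorem normSq_rootExp_sub_one (N k : ℕ) :
    ‖rootExp N k - 1‖ ^ 2 = 2 - 2 * Real.cos (2 * Real.pi * (k / N)) := by
  have h : rootExp N k = exp ((2 * Real.pi * (k / N) : ℝ) * I) := by
    rw [rootExp]
    push_cast
    rfl
  rw [← normSq_eq_norm_sq, h, normSq_apply, sub_re, sub_im, exp_ofReal_mul_I_im,
    exp_ofReal_mul_I_re, one_re, one_im]
  nlinarith [Real.sin_sq_add_cos_sq (2 * Real.pi * (k / N))]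

/-- Orthogonality of the characters of `ℤ/N`. -/
theorem sum_rootExp_pow {N : ℕ} (hN : N ≠ 0) (k : ℕ) :
    ∑ i ∈ Finset.range N, rootExp N k ^ i = if N ∣ k then (N : ℂ) else 0 := by
  split_ifs with h
  · have : rootExp N k = 1 := by
      rw [rootExp_eq]
      exact ((isPrimitiveRoot_exp N hN).pow_eq_one_iff_dvd k).2 h
    simp [this]
  · have h1 : rootExp N k ≠ 1 := by
      rw [rootExp_eq]
      exact fun h1 => h (((isPrimitiveRoot_exp N hN).pow_eq_one_iff_dvd k).1 h1)
    rw [geom_sum_eq h1, rootExp_pow_self hN, sub_self, zero_div]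

/-- The projection of a transformation `U` with `U ^ N = 1` to its `exp (2πik/N)`-eigenspace. -/
noncomputable def eigenProj {F : Type*} [AddCommGroup F] [Module ℂ F] (U : End ℂ F) (N k : ℕ) :
    End ℂ F :=
  (N : ℂ)⁻¹ • ∑ i ∈ Finset.range N, ((rootExp N k)⁻¹ ^ i) • U ^ i

section

variable {F : Type*} [AddCommGroup F] [Module ℂ F] {U : End ℂ F} {N : ℕ}

theorem mul_eigenProj (hN : N ≠ 0) (hU : U ^ N = 1) (k : ℕ) :
    U * eigenProj U N k = rootExp N k • eigenProj U N k := by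
  rw [eigenProj, mul_smul_comm, smul_comm]
  congr 1
  rw [Finset.mul_sum, Finset.smul_sum]
  have h1 : ∀ i, U * ((rootExp N k)⁻¹ ^ i) • U ^ i
      = rootExp N k • ((rootExp N k)⁻¹ ^ (i + 1)) • U ^ (i + 1) := by
    intro i
    rw [mul_smul_comm, smul_smul, ← pow_succ', pow_succ (rootExp N k)⁻¹ i,
      mul_comm _ (rootExp N k)⁻¹, ← mul_assoc, mul_inv_cancel₀ (rootExp_ne_zero N k), one_mul]
  rw [Finset.sum_congr rfl fun i _ => h1 i,
    ← sub_eq_zero, ← Finset.sum_sub_distrib,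
    Finset.sum_range_sub (fun i => rootExp N k • (rootExp N k)⁻¹ ^ i • U ^ i)]
  rw [hU, inv_pow, rootExp_pow_self hN]
  simp

theorem eigenProj_mem (hN : N ≠ 0) (hU : U ^ N = 1) (k : ℕ) (x : F) :
    U (eigenProj U N k x) = rootExp N k • eigenProj U N k x :=
  LinearMap.congr_fun (mul_eigenProj hN hU k) x

theorem eigenProj_of_mem (hN : N ≠ 0) (k : ℕ) {x : F} (hx : U x = rootExp N k • x) :
    eigenProj U N k x = x := by
  have h : ∀ i : ℕ, (U ^ i) x = rootExp N k ^ i • x := by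
    intro i
    induction i with
    | zero => simp
    | succ i ih => rw [pow_succ', Module.End.mul_apply, ih, map_smul, hx, smul_smul, pow_succ]
  simp only [eigenProj, LinearMap.smul_apply, LinearMap.sum_apply, h, smul_smul]
  rw [Finset.sum_congr rfl fun i _ => by
    rw [← mul_pow, inv_mul_cancel₀ (rootExp_ne_zero N k), one_pow, one_smul]]
  rw [Finset.sum_const, Finset.card_range, ← Nat.cast_smul_eq_nsmul ℂ, smul_smul,
    inv_mul_cancel₀ (by exact_mod_cast hN), one_smul]

theorem rootExp_pow_mul (N j k : ℕ) : rootExp N (j * k) = rootExp N k ^ j := by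
  rw [rootExp_eq, rootExp_eq, ← pow_mul, mul_comm j k]

theorem sum_eigenProj (hN : N ≠ 0) : ∑ k ∈ Finset.range N, eigenProj U N k = 1 := by
  simp only [eigenProj]
  rw [← Finset.smul_sum, Finset.sum_comm]
  have h : ∀ i ∈ Finset.range N, ∑ k ∈ Finset.range N, ((rootExp N k)⁻¹ ^ i) • U ^ i
      = if i = 0 then (N : ℂ) • (1 : End ℂ F) else 0 := by
    intro i hi
    rw [Finset.mem_range] at hi
    rw [← Finset.sum_smul]
    have h1 : ∀ k, (rootExp N k)⁻¹ ^ i = (rootExp N i)⁻¹ ^ k := by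
      intro k
      rw [rootExp_eq, rootExp_eq, inv_pow, inv_pow, ← pow_mul, ← pow_mul, mul_comm k i]
    rw [Finset.sum_congr rfl fun k _ => h1 k]
    split_ifs with h0
    · simp [h0, rootExp_zero]
    · have h2 : (rootExp N i)⁻¹ ≠ 1 := by
        rw [Ne, inv_eq_one]
        exact rootExp_ne_one (by omega) hi
      rw [geom_sum_eq h2, inv_pow, rootExp_pow_self hN]
      simp
  rw [Finset.sum_congr rfl h, Finset.sum_ite_eq', if_pos (by simpa using Nat.pos_of_ne_zero hN),
    smul_smul, inv_mul_cancel₀ (by exact_mod_cast hN), one_smul]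

theorem sum_pow_smul_eigenProj (hN : N ≠ 0) (hU : U ^ N = 1) (j : ℕ) :
    ∑ k ∈ Finset.range N, rootExp N k ^ j • eigenProj U N k = U ^ j := by
  have h : ∀ k, rootExp N k ^ j • eigenProj U N k = U ^ j * eigenProj U N k := by
    intro k
    induction j with
    | zero => simp
    | succ j ih => rw [pow_succ, mul_comm, mul_smul, ih, pow_succ', mul_assoc, ← ih,
        mul_smul_comm, mul_eigenProj hN hU, smul_comm]
  rw [Finset.sum_congr rfl fun k _ => h k, ← Finset.mul_sum, sum_eigenProj hN, mul_one]

end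

theorem inner_eq_zero_of_eigenspace {U : End ℂ E} (hU : ∀ x y, inner ℂ (U x) (U y) = inner ℂ x y)
    {N k l : ℕ} (hk : k < N) (hl : l < N) (hkl : k ≠ l) {x y : E} (hx : U x = rootExp N k • x)
    (hy : U y = rootExp N l • y) : inner ℂ x y = 0 := by
  have h := hU x y
  rw [hx, hy, inner_smul_left, inner_smul_right, ← mul_assoc] at h
  by_contra h0
  have h1 : (starRingEnd ℂ) (rootExp N k) * rootExp N l = 1 := by
    apply mul_right_cancel₀ h0
    rw [h, one_mul]
  rw [← conj_rootExp_mul_self N k] at h1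
  have h2 : (starRingEnd ℂ) (rootExp N k) ≠ 0 := by
    simpa using rootExp_ne_zero N k
  exact hkl (rootExp_inj hl hk (mul_left_cancel₀ h2 h1)).symm

/-- The quadratic form `c ‖x‖²`. -/
noncomputable def normForm (E : Type*) [NormedAddCommGroup E] [InnerProductSpace ℂ E] (c : ℝ) :
    QuadraticForm ℝ E :=
  LinearMap.BilinMap.toQuadraticMap (LinearMap.mk₂ ℝ (fun x y => c * (inner ℂ x y).re)
    (fun x y z => by rw [inner_add_left, add_re, mul_add])
    (fun r x y => by
      rw [← Complex.coe_smul, inner_smul_left, conj_ofReal, re_ofReal_mul, smul_eq_mul]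
      ring)
    (fun x y z => by rw [inner_add_right, add_re, mul_add])
    (fun r x y => by
      rw [← Complex.coe_smul, inner_smul_right, re_ofReal_mul, smul_eq_mul]
      ring))

theorem normForm_apply (c : ℝ) (x : E) : normForm E c x = c * ‖x‖ ^ 2 := by
  change c * (inner ℂ x x).re = _
  rw [inner_self_eq_norm_sq_to_K]
  norm_cast

theorem inner_sum_eigenspace {U : End ℂ E} (hU : ∀ x y, inner ℂ (U x) (U y) = inner ℂ x y)
    {N : ℕ} (a b : Fin N → E) (ha : ∀ k, U (a k) = rootExp N k • a k)
    (hb : ∀ k, U (b k) = rootExp N k • b k) :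
    inner ℂ (∑ k, a k) (∑ k, b k) = ∑ k, inner ℂ (a k) (b k) := by
  rw [sum_inner]
  refine Finset.sum_congr rfl fun k _ => ?_
  rw [inner_sum, Finset.sum_eq_single k]
  · intro l _ hl
    exact inner_eq_zero_of_eigenspace hU k.2 l.2 (fun h => hl (Fin.ext h.symm)) (ha k) (hb l)
  · simp

/-- The quadratic form `Ω(x, U^j x)` on a sum of eigenvectors. -/
theorem imForm_sum_eigenspace {U : End ℂ E} (hU : ∀ x y, inner ℂ (U x) (U y) = inner ℂ x y)
    {N : ℕ} (a : Fin N → E) (ha : ∀ k, U (a k) = rootExp N k • a k) (j : ℕ) :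
    imForm E (∑ k, a k) ((U ^ j) (∑ k, a k)) = ∑ k : Fin N, (rootExp N (j * k)).im * ‖a k‖ ^ 2 := by
  have hj : ∀ k, (U ^ j) (a k) = rootExp N (j * k) • a k := by
    intro k
    induction j with
    | zero => simp [rootExp_zero]
    | succ j ih =>
      rw [pow_succ', Module.End.mul_apply, ih, map_smul, ha, smul_smul]
      congr 1
      rw [rootExp_eq, rootExp_eq, rootExp_eq, ← pow_add]
      congr 1
      ring
  rw [imForm_apply, map_sum, inner_sum_eigenspace hU a _ ha, im_sum]
  · refine Finset.sum_congr rfl fun k _ => ?_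
    rw [hj, inner_smul_right, inner_self_eq_norm_sq_to_K]
    have : ((‖a k‖ : ℂ) ^ 2) = ((‖a k‖ ^ 2 : ℝ) : ℂ) := by push_cast; rfl
    simp only [RCLike.ofReal_eq_complex_ofReal] at *
    rw [this, im_mul_ofReal]
  · intro k
    rw [hj, map_smul, ha, smul_comm]

variable [FiniteDimensional ℂ E]

theorem signature_normForm (c : ℝ) :
    signature (normForm E c) = (SignType.sign c : ℤ) * (2 * finrank ℂ E) := by
  have hpos : ∀ c : ℝ, 0 < c → signature (normForm E c) = 2 * finrank ℂ E := by
    intro c hc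
    rw [signature_of_posDef _ fun x hx => ?_, finrank_real_of_complex]
    · push_cast
      rfl
    · rw [normForm_apply]
      have := norm_pos_iff.2 hx
      positivity
  rcases lt_trichotomy c 0 with h | h | h
  · have h1 : normForm E c = -normForm E (-c) := by
      ext x
      simp [normForm_apply]
    rw [h1, signature_neg, hpos _ (by linarith), sign_neg h]
    simp
  · have h1 : normForm E c = 0 := by
      ext x
      simp [normForm_apply, h]
    rw [h1, signature_zero, h]
    simp
  · rw [hpos c h, sign_pos h]
    simp

/-- The Meyer cocycle on the powers of a unitary transformation `U` with `U ^ N = 1`, by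
diagonalization. -/
theorem meyer_pow {U : End ℂ E} (hU : ∀ x y, inner ℂ (U x) (U y) = inner ℂ x y) {N : ℕ}
    (hN : N ≠ 0) (hUN : U ^ N = 1) (j : ℕ) :
    meyer (imForm E) (U.restrictScalars ℝ) ((U ^ j).restrictScalars ℝ)
      = ∑ k : Fin N, (SignType.sign ((rootExp N k).im * ‖rootExp N (j * k) - 1‖ ^ 2
          + (rootExp N (j * k)).im * ‖rootExp N k - 1‖ ^ 2) : ℤ)
          * (2 * finrank ℂ (End.eigenspace U (rootExp N k))) := by
  set ζ : Fin N → ℂ := fun k => rootExp N k with hζ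
  set ξ : Fin N → ℂ := fun k => rootExp N (j * k) with hξ
  -- A pair `(x, y)` in the space of the Meyer form has components with
  -- `(ζ k - 1) x + (ξ k - 1) y = 0`. The solutions are the multiples of `(ξ k - 1, 1 - ζ k)`,
  -- except for `k = 0`, where both coefficients vanish; the switch `c` adds the missing solutions.
  let c : Fin N → ℂ := fun k => if (k : ℕ) = 0 then 1 else 0
  have hζc : ∀ k, (ζ k - 1) * c k = 0 := by
    intro k
    by_cases h : (k : ℕ) = 0
    · simp [hζ, h, rootExp_zero]
    · simp [c, h]
  have hξc : ∀ k, (ξ k - 1) * c k = 0 := by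
    intro k
    by_cases h : (k : ℕ) = 0
    · simp [hξ, h, rootExp_zero]
    · simp [c, h]
  have hUj : ∀ k (x : E), U x = ζ k • x → (U ^ j) x = ξ k • x := by
    intro k x hx
    simp only [hξ, rootExp_pow_mul]
    clear hξc hξ ξ
    induction j with
    | zero => simp
    | succ j ih =>
      rw [pow_succ', Module.End.mul_apply, ih, map_smul, hx, smul_smul, pow_succ]
  let S := (∀ k : Fin N, End.eigenspace U (ζ k))
    × (End.eigenspace U (rootExp N 0) × End.eigenspace U (rootExp N 0))
  let a : S → Fin N → E := fun p k => (ξ k - 1) • (p.1 k : E) + c k • (p.2.1 : E)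
  let b : S → Fin N → E := fun p k => (1 - ζ k) • (p.1 k : E) + c k • (p.2.2 : E)
  have hc : ∀ (r : End.eigenspace U (rootExp N 0)) k, U (c k • (r : E)) = ζ k • c k • (r : E) := by
    intro r k
    have h1 : ∀ (z : ℂ) (x : E), z = 1 → z • x = x := fun z x hz => by rw [hz, one_smul]
    have hr : U r = r := (End.mem_eigenspace_iff.1 r.2).trans (h1 _ _ (rootExp_zero N))
    rw [map_smul, hr, smul_smul, ← sub_eq_zero, ← sub_smul]
    have := hζc k
    rw [show c k - ζ k * c k = -((ζ k - 1) * c k) by ring, this]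
    simp
  have ht : ∀ (p : S) k, U (p.1 k : E) = ζ k • (p.1 k : E) := fun p k =>
    End.mem_eigenspace_iff.1 (p.1 k).2
  have ha : ∀ p k, U (a p k) = ζ k • a p k := by
    intro p k
    simp only [a]
    rw [map_add, hc, map_smul, ht, smul_add, smul_comm]
  have hb : ∀ p k, U (b p k) = ζ k • b p k := by
    intro p k
    simp only [b]
    rw [map_add, hc, map_smul, ht, smul_add, smul_comm]
  have ha_add : ∀ p q k, a (p + q) k = a p k + a q k := by
    intro p q k
    change (ξ k - 1) • ((p.1 k : E) + q.1 k) + c k • ((p.2.1 : E) + q.2.1) = _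
    simp only [a]
    module
  have hb_add : ∀ p q k, b (p + q) k = b p k + b q k := by
    intro p q k
    change (1 - ζ k) • ((p.1 k : E) + q.1 k) + c k • ((p.2.2 : E) + q.2.2) = _
    simp only [b]
    module
  have ha_smul : ∀ (r : ℝ) p k, a (r • p) k = r • a p k := by
    intro r p k
    change (ξ k - 1) • (r • (p.1 k : E)) + c k • (r • (p.2.1 : E)) = _
    simp only [a, smul_add]
    rw [smul_comm r, smul_comm r]
  have hb_smul : ∀ (r : ℝ) p k, b (r • p) k = r • b p k := by
    intro r p k
    change (1 - ζ k) • (r • (p.1 k : E)) + c k • (r • (p.2.2 : E)) = _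
    simp only [b, smul_add]
    rw [smul_comm r, smul_comm r]
  let f : S →ₗ[ℝ] meyerSpace (U.restrictScalars ℝ) ((U ^ j).restrictScalars ℝ) :=
    { toFun := fun p => ⟨(∑ k, a p k, ∑ k, b p k), by
        rw [mem_meyerSpace]
        simp only [LinearMap.coe_restrictScalars, map_sum]
        rw [← Finset.sum_sub_distrib, ← Finset.sum_sub_distrib, ← Finset.sum_add_distrib]
        refine Finset.sum_eq_zero fun k _ => ?_
        rw [ha, hUj k _ (hb p k)]
        simp only [a, b]
        have e1 : ζ k • ((ξ k - 1) • (p.1 k : E) + c k • (p.2.1 : E))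
            - ((ξ k - 1) • (p.1 k : E) + c k • (p.2.1 : E))
            + (ξ k • ((1 - ζ k) • (p.1 k : E) + c k • (p.2.2 : E))
            - ((1 - ζ k) • (p.1 k : E) + c k • (p.2.2 : E)))
            = ((ζ k - 1) * c k) • (p.2.1 : E) + ((ξ k - 1) * c k) • (p.2.2 : E) := by
          module
        rw [e1, hζc, hξc, zero_smul, zero_smul, add_zero]⟩
      map_add' := fun p q => by
        ext1
        simp only [ha_add, hb_add, Submodule.coe_add, Prod.mk_add_mk, Finset.sum_add_distrib]
      map_smul' := fun r p => by
        ext1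
        simp only [ha_smul, hb_smul, Submodule.coe_smul, Prod.smul_mk, Finset.smul_sum,
          RingHom.id_apply] }
  have hf : Function.Surjective f := by
    rintro ⟨⟨x, y⟩, hxy⟩
    rw [mem_meyerSpace] at hxy
    simp only [LinearMap.coe_restrictScalars] at hxy
    have hπ : ∀ k (z : E), U (eigenProj U N k z) = rootExp N k • eigenProj U N k z :=
      fun k z => eigenProj_mem hN hUN k z
    have hcomm : ∀ k, Commute (eigenProj U N k) U := by
      intro k
      apply Commute.smul_left
      exact Commute.sum_left _ _ _ fun i _ => ((Commute.refl U).pow_left i).smul_left _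
    have hrel : ∀ k : Fin N, (ζ k - 1) • eigenProj U N k x + (ξ k - 1) • eigenProj U N k y = 0 := by
      intro k
      have h1 := congrArg (eigenProj U N k) hxy
      have h2 : eigenProj U N k (U x) = ζ k • eigenProj U N k x := by
        rw [← hπ]
        exact LinearMap.congr_fun (hcomm k).eq x
      have h3 : eigenProj U N k ((U ^ j) y) = ξ k • eigenProj U N k y := by
        rw [← hUj k _ (hπ k y)]
        exact LinearMap.congr_fun ((hcomm k).pow_right j).eq y
      simp only [map_add, map_sub, map_zero] at h1
      rw [h2, h3] at h1
      rw [sub_smul, sub_smul, one_smul, one_smul]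
      exact h1
    refine ⟨(fun k => ⟨-(ζ k - 1)⁻¹ • eigenProj U N k y, ?_⟩,
      ⟨eigenProj U N 0 x, End.mem_eigenspace_iff.2 (hπ 0 x)⟩,
      ⟨eigenProj U N 0 y, End.mem_eigenspace_iff.2 (hπ 0 y)⟩), ?_⟩
    · rw [End.mem_eigenspace_iff, map_smul, hπ, smul_comm]
    · have hsum : ∀ z : E, ∑ k : Fin N, eigenProj U N k z = z := by
        intro z
        rw [Fin.sum_univ_eq_sum_range (fun k => eigenProj U N k z) N, ← LinearMap.sum_apply,
          sum_eigenProj hN, Module.End.one_apply]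
      apply Subtype.ext
      change (∑ k, a _ k, ∑ k, b _ k) = (x, y)
      rw [← hsum x, ← hsum y]
      congr 1
      · refine Finset.sum_congr rfl fun k _ => ?_
        simp only [a, hsum]
        by_cases h : (k : ℕ) = 0
        · have h1 : ξ k - 1 = 0 := by simp [hξ, h, rootExp_zero]
          simp [c, h, h1]
        · have h1 : ζ k - 1 ≠ 0 := sub_ne_zero.2 (rootExp_ne_one (Nat.pos_of_ne_zero h) k.2)
          have h2 := hrel k
          simp only [c, h, if_false, zero_smul, add_zero]
          rw [smul_smul, mul_neg, neg_smul, mul_comm, mul_smul, eq_neg_of_add_eq_zero_right h2]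
          rw [smul_neg, neg_neg, smul_smul, inv_mul_cancel₀ h1, one_smul]
      · refine Finset.sum_congr rfl fun k _ => ?_
        simp only [b, hsum]
        by_cases h : (k : ℕ) = 0
        · have h1 : 1 - ζ k = 0 := by simp [hζ, h, rootExp_zero]
          simp [c, h, h1]
        · have h1 : ζ k - 1 ≠ 0 := sub_ne_zero.2 (rootExp_ne_one (Nat.pos_of_ne_zero h) k.2)
          simp only [c, h, if_false, zero_smul, add_zero]
          rw [smul_smul, show (1 - ζ k) * -(ζ k - 1)⁻¹ = (ζ k - 1) * (ζ k - 1)⁻¹ by ring,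
            mul_inv_cancel₀ h1, one_smul]
  rw [meyer, ← signature_eq_of_surjective
    (QuadraticMap.prod (QuadraticMap.pi fun k : Fin N => normForm (End.eigenspace U (ζ k))
      ((ζ k).im * ‖ξ k - 1‖ ^ 2 + (ξ k).im * ‖ζ k - 1‖ ^ 2)) 0) _ f hf ?_,
    signature_prod, signature_pi, signature_zero, add_zero]
  · exact Finset.sum_congr rfl fun k _ => signature_normForm _
  · intro p
    rw [QuadraticMap.prod_apply, QuadraticMap.pi_apply, QuadraticMap.restrict_apply,
      meyerForm_apply]
    change _ = imForm E (∑ k, a p k) (U (∑ k, a p k)) + imForm E (∑ k, b p k) ((U ^ j) (∑ k, b p k))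
    have h1 := imForm_sum_eigenspace hU (a p) (ha p) 1
    rw [pow_one] at h1
    rw [h1, imForm_sum_eigenspace hU (b p) (hb p) j, zero_apply, add_zero,
      ← Finset.sum_add_distrib]
    refine Finset.sum_congr rfl fun k _ => ?_
    rw [normForm_apply, one_mul, Submodule.coe_norm]
    have hnorm : ∀ (z w : ℂ) (r : E), z.im = 0 ∨ c k = 0 →
        z.im * ‖w • (p.1 k : E) + c k • r‖ ^ 2 = z.im * (‖w‖ ^ 2 * ‖(p.1 k : E)‖ ^ 2) := by
      rintro z w r (h | h)
      · simp [h]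
      · rw [h, zero_smul, add_zero, norm_smul, mul_pow]
    have him : (ζ k).im = 0 ∨ c k = 0 := by
      by_cases h : (k : ℕ) = 0
      · exact Or.inl (by simp [hζ, h, rootExp_zero])
      · exact Or.inr (by simp [c, h])
    have him' : (ξ k).im = 0 ∨ c k = 0 := by
      by_cases h : (k : ℕ) = 0
      · exact Or.inl (by simp [hξ, h, rootExp_zero])
      · exact Or.inr (by simp [c, h])
    change _ = (ζ k).im * ‖a p k‖ ^ 2 + (ξ k).im * ‖b p k‖ ^ 2
    rw [hnorm _ _ _ him, hnorm _ _ _ him', norm_sub_rev 1 (ζ k)]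
    ring

/-- The coboundary function of the Meyer cocycle at a unitary transformation `U` with `U ^ N = 1`:
the sum of the sawtooth function over the arguments of the eigenvalues of `U`. -/
theorem sum_meyer_pow {U : End ℂ E} (hU : ∀ x y, inner ℂ (U x) (U y) = inner ℂ x y) {N : ℕ}
    (hN : N ≠ 0) (hUN : U ^ N = 1) :
    ∑ j ∈ Finset.range N,
      (meyer (imForm E) (U.restrictScalars ℝ) ((U ^ j).restrictScalars ℝ) : ℝ)
      = N * (2 * ∑ k ∈ Finset.range N,
          saw (k / N) * finrank ℂ (End.eigenspace U (rootExp N k))) := by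
  have h1 : ∀ j, (meyer (imForm E) (U.restrictScalars ℝ) ((U ^ j).restrictScalars ℝ) : ℝ)
      = ∑ k ∈ Finset.range N, (saw (k / N) + saw ((j * k : ℕ) / N) - saw (((j + 1) * k : ℕ) / N))
        * (2 * finrank ℂ (End.eigenspace U (rootExp N k))) := by
    intro j
    rw [meyer_pow hU hN hUN, Finset.sum_range]
    push_cast
    refine Finset.sum_congr rfl fun k _ => ?_
    congr 1
    rw [im_rootExp, im_rootExp, normSq_rootExp_sub_one, normSq_rootExp_sub_one,
      sign_eq_saw_add_saw_sub]
    push_cast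
    congr 2
    ring
  rw [Finset.sum_congr rfl fun j _ => h1 j, Finset.sum_comm, Finset.mul_sum, Finset.mul_sum]
  refine Finset.sum_congr rfl fun k _ => ?_
  rw [← Finset.sum_mul]
  have h2 : ∑ j ∈ Finset.range N, (saw ((k : ℝ) / N) + saw ((j * k : ℕ) / N)
      - saw (((j + 1) * k : ℕ) / N)) = N * saw (k / N) := by
    have h3 := Finset.sum_range_sub (fun j => saw ((j * k : ℕ) / N)) N
    simp only [Nat.cast_mul] at h3
    rw [mul_div_cancel_left₀ _ (by exact_mod_cast hN), saw_natCast] at h3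
    simp only [Nat.cast_zero, zero_mul, zero_div, saw_zero, sub_zero] at h3
    rw [Finset.sum_congr rfl fun j _ => show _ = saw ((k : ℝ) / N)
      - (saw (((j + 1 : ℕ) : ℝ) * k / N) - saw ((j : ℝ) * k / N)) by push_cast; ring,
      Finset.sum_sub_distrib, h3]
    simp
  rw [h2]
  ring

end Unitary

/-! ### Traces and eigenspaces of permutation operators -/

section Permutation

open Module Complex

variable {D : Type*} [Fintype D]

/-- The unitary operators on `ℂ^D` induced by the permutations of `D`. -/
noncomputable def permRep (D : Type*) [Fintype D] :
    Equiv.Perm D →* End ℂ (EuclideanSpace ℂ D) where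
  toFun p :=
    { toFun := fun x => WithLp.toLp 2 fun d => x (p⁻¹ d)
      map_add' := fun _ _ => rfl
      map_smul' := fun _ _ => rfl }
  map_one' := rfl
  map_mul' _ _ := rfl

theorem permRep_apply (p : Equiv.Perm D) (x : EuclideanSpace ℂ D) (d : D) :
    permRep D p x d = x (p⁻¹ d) := rfl

theorem inner_permRep (p : Equiv.Perm D) (x y : EuclideanSpace ℂ D) :
    inner ℂ (permRep D p x) (permRep D p y) = inner ℂ x y := by
  simp only [PiLp.inner_apply, permRep_apply]
  exact Equiv.sum_comp p⁻¹ fun d => inner ℂ (x d) (y d)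

open Classical in
theorem trace_permRep (p : Equiv.Perm D) :
    LinearMap.trace ℂ _ (permRep D p) = ((Finset.univ.filter fun d => p d = d).card : ℂ) := by
  rw [LinearMap.trace_eq_matrix_trace ℂ (EuclideanSpace.basisFun D ℂ).toBasis, Matrix.trace,
    Finset.card_filter]
  push_cast
  refine Finset.sum_congr rfl fun d _ => ?_
  rw [Matrix.diag_apply, LinearMap.toMatrix_apply]
  simp only [OrthonormalBasis.coe_toBasis, OrthonormalBasis.coe_toBasis_repr_apply,
    EuclideanSpace.basisFun_repr, EuclideanSpace.basisFun_apply, permRep_apply,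
    PiLp.single_apply]
  congr 1
  rw [Equiv.Perm.inv_eq_iff_eq]
  exact propext eq_comm

variable {F : Type*} [AddCommGroup F] [Module ℂ F] [FiniteDimensional ℂ F]

/-- The dimensions of the joint eigenspaces of two commuting operators of finite order, in terms
of traces. -/
theorem sum_rootExp_mul_finrank {A B : End ℂ F} (hAB : Commute A B) {n N : ℕ} (hn : n ≠ 0)
    (hN : N ≠ 0) (hA : A ^ n = 1) (hB : B ^ N = 1) (s : ℕ → ℂ) :
    ∑ a ∈ Finset.range n, rootExp n a * ∑ k ∈ Finset.range N, s k *
        finrank ℂ (End.eigenspace A (rootExp n a) ⊓ End.eigenspace B (rootExp N k) : Submodule ℂ F)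
      = ∑ k ∈ Finset.range N, s k * LinearMap.trace ℂ F (A * eigenProj B N k) := by
  have hcomm : ∀ k, Commute A (eigenProj B N k) := by
    intro k
    apply Commute.smul_right
    exact Commute.sum_right _ _ _ fun i _ => (hAB.pow_right i).smul_right _
  have hcomm' : ∀ a k, Commute (eigenProj A n a) (eigenProj B N k) := by
    intro a k
    apply Commute.smul_left
    exact Commute.sum_left _ _ _ fun i _ => ((hcomm k).pow_left i).smul_left _
  have hproj : ∀ a k, LinearMap.IsProj
      (End.eigenspace A (rootExp n a) ⊓ End.eigenspace B (rootExp N k) : Submodule ℂ F)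
      (eigenProj A n a * eigenProj B N k) := by
    intro a k
    constructor
    · intro x
      refine ⟨End.mem_eigenspace_iff.2 (eigenProj_mem hn hA a _), ?_⟩
      rw [(hcomm' a k).eq]
      exact End.mem_eigenspace_iff.2 (eigenProj_mem hN hB k _)
    · rintro x ⟨h1, h2⟩
      rw [Module.End.mul_apply, eigenProj_of_mem hN k (End.mem_eigenspace_iff.1 h2),
        eigenProj_of_mem hn a (End.mem_eigenspace_iff.1 h1)]
  have h1 : ∀ k, ∑ a ∈ Finset.range n, rootExp n a • (eigenProj A n a * eigenProj B N k)
      = A * eigenProj B N k := by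
    intro k
    have := sum_pow_smul_eigenProj hn hA 1
    simp only [pow_one] at this
    nth_rewrite 2 [← this]
    rw [Finset.sum_mul]
    exact Finset.sum_congr rfl fun a _ => (smul_mul_assoc _ _ _).symm
  simp only [Finset.mul_sum]
  rw [Finset.sum_comm]
  refine Finset.sum_congr rfl fun k _ => ?_
  rw [← h1, map_sum, Finset.mul_sum]
  refine Finset.sum_congr rfl fun a _ => ?_
  rw [map_smul, (hproj a k).trace, smul_eq_mul]
  ring

/-- The sum over the eigenvalues of an operator of finite order. -/
theorem trace_eq_sum_rootExp_mul_finrank {A : End ℂ F} {n : ℕ} (hn : n ≠ 0) (hA : A ^ n = 1) :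
    LinearMap.trace ℂ F A
      = ∑ a ∈ Finset.range n, rootExp n a * finrank ℂ (End.eigenspace A (rootExp n a)) := by
  have h := sum_rootExp_mul_finrank (Commute.one_right A) hn one_ne_zero hA (one_pow 1)
    (fun _ => 1)
  have h1 : End.eigenspace (1 : End ℂ F) (rootExp 1 0) = ⊤ := by
    ext x
    simp [rootExp_zero]
  have h2 : eigenProj (1 : End ℂ F) 1 0 = 1 := by
    have := sum_eigenProj (F := F) (U := 1) one_ne_zero
    simpa using this
  have h3 : ∀ a, finrank ℂ (End.eigenspace A (rootExp n a) ⊓ End.eigenspace (1 : End ℂ F)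
      (rootExp 1 0) : Submodule ℂ F) = finrank ℂ (End.eigenspace A (rootExp n a)) := by
    intro a
    rw [h1, inf_top_eq]
  simp only [Finset.range_one, Finset.sum_singleton, h3, h2, one_mul, mul_one] at h
  exact h.symm

/-- The action of the centralizer of the permutation `g` on the eigenspaces of `g`. -/
noncomputable def eigenRep (g : Equiv.Perm D) (w : ℂ) :
    Subgroup.centralizer {g} →* End ℂ (End.eigenspace (permRep D g) w) where
  toFun p := (permRep D (p : Equiv.Perm D)).restrict (by
    intro x hx
    rw [End.mem_eigenspace_iff] at hx ⊢
    have h : g * p = p * g := (Subgroup.mem_centralizer_singleton_iff.1 p.2).symm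
    rw [← Module.End.mul_apply, ← map_mul, h, map_mul, Module.End.mul_apply, hx, map_smul])
  map_one' := by
    ext x
    simp
  map_mul' p q := by
    ext x
    simp

theorem coe_eigenRep_apply (g : Equiv.Perm D) (w : ℂ) (p : Subgroup.centralizer {g})
    (x : End.eigenspace (permRep D g) w) : (eigenRep g w p x : EuclideanSpace ℂ D)
      = permRep D (p : Equiv.Perm D) x := rfl

/-- The Meyer cocycle of two permutations commuting with `g`, on an eigenspace of `g`. -/
noncomputable def eigenMeyer (g : Equiv.Perm D) (w : ℂ) (p q : Subgroup.centralizer {g}) : ℤ :=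
  meyer (imForm (End.eigenspace (permRep D g) w)) ((eigenRep g w p).restrictScalars ℝ)
    ((eigenRep g w q).restrictScalars ℝ)

/-- The weighted number of coincidences of `g` with the powers of `p⁻¹`; the weights are the
discrete Fourier transform of the sawtooth function. -/
noncomputable def coincidence (g p : Equiv.Perm D) : ℂ :=
  ∑ k ∈ Finset.range (orderOf p), saw (k / orderOf p)
    * LinearMap.trace ℂ _ (permRep D g * eigenProj (permRep D p) (orderOf p) k)

/-- The Meyer cocycle of two permutations `p`, `q` on the eigenspaces of a permutation `g` with
which they commute. -/
theorem sum_rootExp_mul_meyer (g : Equiv.Perm D) {n : ℕ} (hn : n ≠ 0) (hg : g ^ n = 1)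
    (p q : Subgroup.centralizer {g}) :
    ∑ a ∈ Finset.range n, rootExp n a *
        (eigenMeyer g (rootExp n a) p q : ℂ)
      = 2 * (coincidence g p + coincidence g q - coincidence g (p * q : Equiv.Perm D)) := by
  have hfin : Finite (Subgroup.centralizer {g}) := inferInstance
  -- On each eigenspace of `g` the cocycle is the coboundary of a function `s`, which is computed by
  -- diagonalizing `p`.
  have main : ∀ w : ℂ, ∃ s : Subgroup.centralizer {g} → ℝ,
      (∀ p q, (eigenMeyer g w p q : ℝ) = s p + s q - s (p * q)) ∧
      ∀ p, s p = 2 * ∑ k ∈ Finset.range (orderOf (p : Equiv.Perm D)),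
        saw (k / orderOf (p : Equiv.Perm D)) *
        finrank ℂ (End.eigenspace (permRep D g) w ⊓ End.eigenspace (permRep D p)
          (rootExp (orderOf (p : Equiv.Perm D)) k) : Submodule ℂ (EuclideanSpace ℂ D)) := by
    intro w
    let R : Subgroup.centralizer {g} →* End ℝ (End.eigenspace (permRep D g) w) :=
      { toFun := fun p => (eigenRep g w p).restrictScalars ℝ
        map_one' := by
          rw [map_one]
          rfl
        map_mul' := fun p q => by
          rw [map_mul]
          rfl }
    have hU : ∀ p x y, inner ℂ (eigenRep g w p x) (eigenRep g w p y) = inner ℂ x y :=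
      fun p x y => inner_permRep _ _ _
    obtain ⟨s, hs1, hs2⟩ := exists_meyer_eq_coboundary
      (Ω := imForm (End.eigenspace (permRep D g) w)) imForm_self imForm_nondegenerate R
      (fun p x y => congrArg Complex.im (hU p x y))
    refine ⟨s, hs1, fun p => ?_⟩
    set N := orderOf (p : Equiv.Perm D) with hNdef
    have hN : N ≠ 0 := (orderOf_pos _).ne'
    have hpN : p ^ N = 1 := by
      apply Subtype.ext
      rw [Subgroup.coe_pow, hNdef, pow_orderOf_eq_one]
      rfl
    have h1 := hs2 p N hpN
    have hUp : (eigenRep g w p) ^ N = 1 := by rw [← map_pow, hpN, map_one]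
    have h2 := sum_meyer_pow (E := End.eigenspace (permRep D g) w) (U := eigenRep g w p)
      (hU p) hN hUp
    have h3 : ∀ j, R (p ^ j) = ((eigenRep g w p) ^ j).restrictScalars ℝ := by
      intro j
      change (eigenRep g w (p ^ j)).restrictScalars ℝ = _
      rw [map_pow]
    simp only [h3] at h1
    change _ = ∑ j ∈ Finset.range N, (meyer (imForm (End.eigenspace (permRep D g) w))
      ((eigenRep g w p).restrictScalars ℝ) ((eigenRep g w p ^ j).restrictScalars ℝ) : ℝ) at h1
    rw [h2] at h1
    have h4 := mul_left_cancel₀ (by exact_mod_cast hN) h1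
    rw [h4]
    congr 1
    refine Finset.sum_congr rfl fun k _ => ?_
    congr 2
    have h5 : (End.eigenspace (eigenRep g w p) (rootExp N k)).map
        (End.eigenspace (permRep D g) w).subtype
        = End.eigenspace (permRep D g) w ⊓ End.eigenspace (permRep D p) (rootExp N k) := by
      rw [← Submodule.map_comap_subtype]
      congr 1
      ext x
      rw [Submodule.mem_comap, End.mem_eigenspace_iff, End.mem_eigenspace_iff, Subtype.ext_iff]
      rfl
    rw [← h5]
    exact LinearEquiv.finrank_eq (Submodule.equivMapOfInjective _ Subtype.val_injective _)
  choose s hs1 hs2 using main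
  have h6 : ∀ p : Subgroup.centralizer {g},
      ∑ a ∈ Finset.range n, rootExp n a * (s (rootExp n a) p : ℂ) = 2 * coincidence g p := by
    intro p
    have hAB : Commute (permRep D g) (permRep D (p : Equiv.Perm D)) := by
      have h : g * p = p * g := (Subgroup.mem_centralizer_singleton_iff.1 p.2).symm
      rw [Commute, SemiconjBy, ← map_mul, h, map_mul]
    rw [coincidence, ← sum_rootExp_mul_finrank hAB hn (orderOf_pos _).ne'
      (by rw [← map_pow, hg, map_one]) (by rw [← map_pow, pow_orderOf_eq_one, map_one]),
      Finset.mul_sum]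
    refine Finset.sum_congr rfl fun a _ => ?_
    rw [hs2]
    push_cast
    ring
  have h7 : ∀ a, (eigenMeyer g (rootExp n a) p q : ℂ)
      = s (rootExp n a) p + s (rootExp n a) q - s (rootExp n a) (p * q) := by
    intro a
    exact_mod_cast hs1 (rootExp n a) p q
  simp only [h7, mul_sub, mul_add, Finset.sum_sub_distrib, Finset.sum_add_distrib, h6]
  rfl

end Permutation

/-! ### Coincidences of a permutation with the powers of another one -/

section Coincidence

open Module Complex Function

theorem rootExp_mul_right {N L q : ℕ} (hN : N = L * q) (hq : q ≠ 0) (b : ℕ) :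
    rootExp N (b * q) = rootExp L b := by
  rw [rootExp, rootExp, hN]
  congr 4
  push_cast
  have : (q : ℝ) ≠ 0 := by exact_mod_cast hq
  by_cases hL : (L : ℝ) = 0
  · simp [hL]
  · field_simp

theorem rootExp_add (N k l : ℕ) : rootExp N (k + l) = rootExp N k * rootExp N l := by
  simp only [rootExp_eq, pow_add]

theorem rootExp_self_sub {N k : ℕ} (hN : N ≠ 0) (hk : k ≤ N) :
    rootExp N (N - k) = (rootExp N k)⁻¹ := by
  apply eq_inv_of_mul_eq_one_left
  rw [← rootExp_add, Nat.sub_add_cancel hk, rootExp_eq, (isPrimitiveRoot_exp N hN).pow_eq_one]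

/-- The sum `∑ (a / n) exp (-2πi a m / n)` over `0 ≤ a < n`. As a function of `m` it is the
character, with rational coefficients, in which the one-dimensional representation of the cyclic
group of order `n` with exponent `-a` has multiplicity `a / n`. -/
noncomputable def kappa (n m : ℕ) : ℂ :=
  ∑ a ∈ Finset.range n, (a / n : ℂ) * (rootExp n m)⁻¹ ^ a

theorem sum_div_mul_pow {n : ℕ} {w : ℂ} (hn : n ≠ 0) (hwn : w ^ n = 1) (hw : w ≠ 1) :
    ∑ a ∈ Finset.range n, (a / n : ℂ) * w ^ a = (w - 1)⁻¹ := by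
  have hw1 : w - 1 ≠ 0 := sub_ne_zero.2 hw
  have h1 : ∀ a : ℕ, (w - 1) * ((a : ℂ) * w ^ a)
      = ((a + 1 : ℕ) * w ^ (a + 1) - a * w ^ a) - w * w ^ a := by
    intro a
    push_cast
    ring
  have h2 : (w - 1) * ∑ a ∈ Finset.range n, (a : ℂ) * w ^ a = n := by
    rw [Finset.mul_sum, Finset.sum_congr rfl fun a _ => h1 a, Finset.sum_sub_distrib,
      Finset.sum_range_sub (fun a : ℕ => (a : ℂ) * w ^ a), ← Finset.mul_sum, geom_sum_eq hw, hwn]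
    simp
  have hn' : (n : ℂ) ≠ 0 := by exact_mod_cast hn
  apply eq_inv_of_mul_eq_one_left
  have h3 : ∑ a ∈ Finset.range n, (a / n : ℂ) * w ^ a
      = (n : ℂ)⁻¹ * ∑ a ∈ Finset.range n, (a : ℂ) * w ^ a := by
    rw [Finset.mul_sum]
    exact Finset.sum_congr rfl fun a _ => by ring
  rw [h3, mul_assoc, mul_comm _ (w - 1), h2, inv_mul_cancel₀ hn']

theorem kappa_of_ne_one {n m : ℕ} (h : rootExp n m ≠ 1) :
    kappa n m = ((rootExp n m)⁻¹ - 1)⁻¹ := by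
  rcases eq_or_ne n 0 with rfl | hn
  · simp [rootExp] at h
  exact sum_div_mul_pow hn (by rw [inv_pow, rootExp_pow_self hn, inv_one]) (by rwa [Ne, inv_eq_one])

/-- The discrete Fourier transform of the sawtooth function, in terms of that of the identity. -/
theorem sum_saw_mul_rootExp {n m : ℕ} (h : rootExp n m ≠ 1) :
    ∑ b ∈ Finset.range n, (saw (b / n) : ℂ) * rootExp n m ^ b = 2 * kappa n m + 1 := by
  rcases eq_or_ne n 0 with rfl | hn
  · simp [rootExp] at h
  have h1 : ∀ b ∈ Finset.range n, (saw (b / n) : ℂ) * rootExp n m ^ b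
      = rootExp n m ^ b - 2 * ((b / n : ℂ) * rootExp n m ^ b) - if b = 0 then 1 else 0 := by
    intro b hb
    rcases eq_or_ne b 0 with rfl | hb0
    · simp [saw_zero]
    · have hn' : (0 : ℝ) < n := by positivity
      have hb' : (0 : ℝ) < b := by positivity
      rw [saw_of_mem (by positivity) ((div_lt_one hn').2 (by exact_mod_cast Finset.mem_range.1 hb)),
        if_neg hb0]
      push_cast
      ring
  have hz := rootExp_ne_zero n m
  rw [Finset.sum_congr rfl h1, Finset.sum_sub_distrib, Finset.sum_sub_distrib, ← Finset.mul_sum,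
    sum_div_mul_pow hn (rootExp_pow_self hn m) h, geom_sum_eq h, rootExp_pow_self hn,
    Finset.sum_ite_eq', if_pos (Finset.mem_range.2 (Nat.pos_of_ne_zero hn)), kappa_of_ne_one h]
  have h2 : rootExp n m - 1 ≠ 0 := sub_ne_zero.2 h
  have h3 : (rootExp n m)⁻¹ - 1 ≠ 0 := sub_ne_zero.2 (by rwa [Ne, inv_eq_one])
  have h4 : ((rootExp n m)⁻¹ - 1)⁻¹ = -1 - (rootExp n m - 1)⁻¹ := by
    apply inv_eq_of_mul_eq_one_right
    field_simp
    ring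
  rw [h4]
  ring

variable {D : Type*}

theorem pow_apply_eq_pow_apply_iff (p : Equiv.Perm D) (d : D) (i j : ℕ) (h : i ≤ j) :
    (p ^ i) d = (p ^ j) d ↔ minimalPeriod p d ∣ j - i := by
  rw [← isPeriodicPt_iff_minimalPeriod_dvd, IsPeriodicPt, IsFixedPt, Equiv.Perm.iterate_eq_pow]
  obtain ⟨k, rfl⟩ := Nat.exists_eq_add_of_le h
  rw [pow_add, Equiv.Perm.mul_apply, (p ^ i).injective.eq_iff, Nat.add_sub_cancel_left]
  exact eq_comm

theorem minimalPeriod_dvd_orderOf (p : Equiv.Perm D) (d : D) : minimalPeriod p d ∣ orderOf p := by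
  rw [← isPeriodicPt_iff_minimalPeriod_dvd, IsPeriodicPt, IsFixedPt, Equiv.Perm.iterate_eq_pow,
    pow_orderOf_eq_one]
  rfl

variable [Fintype D]

theorem minimalPeriod_pos_of_perm (p : Equiv.Perm D) (d : D) : 0 < minimalPeriod p d := by
  apply minimalPeriod_pos_of_mem_periodicPts
  refine ⟨orderOf p, orderOf_pos p, ?_⟩
  rw [IsPeriodicPt, IsFixedPt, Equiv.Perm.iterate_eq_pow, pow_orderOf_eq_one]
  rfl

open Classical in
/-- The sum over the points `d` at which `g` agrees with a power `p ^ m` of `p`, of the value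
`f L m` divided by the length `L` of the cycle of `d`. If `p` is the rotation of the boundaries of
the faces of a surface, then this is a sum over the faces mapped to themselves by `g`. -/
noncomputable def cycleSum (g p : Equiv.Perm D) (f : ℕ → ℕ → ℂ) : ℂ :=
  ∑ d, ∑ m ∈ Finset.range (minimalPeriod p d),
    if g d = (p ^ m) d then f (minimalPeriod p d) m / minimalPeriod p d else 0

/-- Permutations without coincidences: in the signature formula only the faces contribute, since
`G` permutes vertices and edges freely. -/
theorem coincidence_eq_zero (g p : Equiv.Perm D) (h : ∀ (i : ℕ) (d : D), g ((p ^ i) d) ≠ d) :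
    coincidence g p = 0 := by
  classical
  refine Finset.sum_eq_zero fun k _ => ?_
  rw [eigenProj, mul_smul_comm, map_smul, Finset.mul_sum, map_sum, Finset.sum_eq_zero, smul_zero,
    mul_zero]
  intro i _
  rw [mul_smul_comm, map_smul, ← map_pow, ← map_mul, trace_permRep, Finset.filter_false_of_mem]
  · simp
  · intro d _
    exact h i d

/-- On a cycle of `p` of length `L`, only the `L`-th roots of unity are eigenvalues of `p`, and a
point with `g d = p ^ m d` contributes the trace of a shift by `m` to each eigenspace. -/
theorem sum_trace_eigenProj_eq_cycleSum (s : ℝ → ℝ) (g p : Equiv.Perm D) (hgp : Commute g p) :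
    ∑ k ∈ Finset.range (orderOf p), s (k / orderOf p)
      * LinearMap.trace ℂ _ (permRep D g * eigenProj (permRep D p) (orderOf p) k)
      = cycleSum g p (fun n m => ∑ b ∈ Finset.range n, (s (b / n) : ℂ) * rootExp n m ^ b) := by
  classical
  set N := orderOf p with hNdef
  have hN : N ≠ 0 := (orderOf_pos p).ne'
  have h1 : ∑ k ∈ Finset.range N, s (k / N)
      * LinearMap.trace ℂ _ (permRep D g * eigenProj (permRep D p) N k)
      = ∑ d, ∑ k ∈ Finset.range N, (s (k / N) : ℂ) * ((N : ℂ)⁻¹ *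
        ∑ i ∈ Finset.range N, (rootExp N k)⁻¹ ^ i * if g ((p ^ i) d) = d then 1 else 0) := by
    rw [Finset.sum_comm]
    refine Finset.sum_congr rfl fun k _ => ?_
    rw [← Finset.mul_sum, ← Finset.mul_sum, Finset.sum_comm, eigenProj, mul_smul_comm, map_smul,
      smul_eq_mul, Finset.mul_sum, map_sum]
    congr 2
    refine Finset.sum_congr rfl fun i _ => ?_
    rw [mul_smul_comm, map_smul, ← map_pow, ← map_mul, trace_permRep, smul_eq_mul,
      ← Finset.mul_sum, Finset.card_filter]
    rw [Nat.cast_sum]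
    congr 1
    refine Finset.sum_congr rfl fun d _ => ?_
    rw [Nat.cast_ite, Nat.cast_one, Nat.cast_zero]
    rfl
  rw [h1, cycleSum]
  refine Finset.sum_congr rfl fun d _ => ?_
  set L := minimalPeriod p d with hL
  have hL0 : 0 < L := minimalPeriod_pos_of_perm p d
  have hiff : ∀ i m : ℕ, g d = (p ^ m) d → (g ((p ^ i) d) = d ↔ L ∣ i + m) := by
    intro i m hm
    have e1 : g ((p ^ i) d) = (p ^ (i + m)) d := by
      rw [pow_add, Equiv.Perm.mul_apply, ← hm, ← Equiv.Perm.mul_apply, ← Equiv.Perm.mul_apply,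
        (hgp.pow_right i).eq]
    rw [e1]
    have := pow_apply_eq_pow_apply_iff p d 0 (i + m) (Nat.zero_le _)
    rw [Nat.sub_zero] at this
    rw [← this]
    exact eq_comm
  by_cases hex : ∃ m, g d = (p ^ m) d
  · obtain ⟨m, hmL, hm⟩ : ∃ m < L, g d = (p ^ m) d := by
      obtain ⟨m, hm⟩ := hex
      refine ⟨m % L, Nat.mod_lt _ hL0, ?_⟩
      rw [hm, eq_comm, pow_apply_eq_pow_apply_iff _ _ _ _ (Nat.mod_le _ _)]
      exact Nat.dvd_sub_mod m
    refine Eq.trans ?_ (Finset.sum_eq_single m ?_ ?_).symm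
    · rw [if_pos hm]
      obtain ⟨q, hq⟩ : L ∣ N := minimalPeriod_dvd_orderOf p d
      have hq0 : q ≠ 0 := by
        rintro rfl
        exact hN (by rw [hq, mul_zero])
      have hLc : (L : ℂ) ≠ 0 := by exact_mod_cast hL0.ne'
      have hNc : (N : ℂ) ≠ 0 := by exact_mod_cast hN
      -- Fourier expansion of the indicator function of the multiples of `L`
      have h2 : ∀ i, (if g ((p ^ i) d) = d then (1 : ℂ) else 0)
          = (L : ℂ)⁻¹ * ∑ b ∈ Finset.range L, rootExp L m ^ b * rootExp N (b * q) ^ i := by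
        intro i
        have h3 := sum_rootExp_pow hL0.ne' (i + m)
        have h4 : ∀ b, rootExp L m ^ b * rootExp N (b * q) ^ i = rootExp L (i + m) ^ b := by
          intro b
          rw [rootExp_mul_right hq hq0, rootExp_add, mul_pow, mul_comm,
            ← rootExp_pow_mul L i b, ← rootExp_pow_mul L b i, mul_comm i b]
        simp only [h4, h3, hiff i m hm]
        split_ifs
        · rw [inv_mul_cancel₀ hLc]
        · rw [mul_zero]
      -- only the indices `k = b q`, whose roots of unity have order dividing `L = N / q`, survive
      have h5 : ∀ k ∈ Finset.range N, (s (k / N) : ℂ) * ((N : ℂ)⁻¹ * ∑ i ∈ Finset.range N,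
          (rootExp N k)⁻¹ ^ i * if g ((p ^ i) d) = d then 1 else 0)
          = ∑ b ∈ Finset.range L, if k = b * q then
              (L : ℂ)⁻¹ * (s (k / N) * rootExp L m ^ b) else 0 := by
        intro k hk
        rw [Finset.mem_range] at hk
        have h6 : ∑ i ∈ Finset.range N, (rootExp N k)⁻¹ ^ i *
            (if g ((p ^ i) d) = d then (1 : ℂ) else 0)
            = ∑ b ∈ Finset.range L, (L : ℂ)⁻¹ * rootExp L m ^ b *
              ∑ i ∈ Finset.range N, rootExp N (b * q + (N - k)) ^ i := by
          simp only [h2, Finset.mul_sum]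
          rw [Finset.sum_comm]
          refine Finset.sum_congr rfl fun b _ => Finset.sum_congr rfl fun i _ => ?_
          rw [rootExp_add, rootExp_self_sub hN hk.le, mul_pow]
          ring
        rw [h6, Finset.mul_sum, Finset.mul_sum]
        refine Finset.sum_congr rfl fun b hb => ?_
        rw [Finset.mem_range] at hb
        have hbN : b * q < N := by
          rw [hq]
          exact Nat.mul_lt_mul_of_pos_right hb (Nat.pos_of_ne_zero hq0)
        rw [sum_rootExp_pow hN]
        have h7 : N ∣ b * q + (N - k) ↔ k = b * q := by
          constructor
          · rintro ⟨t, ht⟩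
            have ht1 : t = 1 := by
              have : 0 < N := by omega
              have h8 : t < 2 := by
                by_contra h9
                have : N * 2 ≤ N * t := Nat.mul_le_mul_left _ (by omega)
                omega
              have h10 : t ≠ 0 := by
                rintro rfl
                omega
              omega
            rw [ht1] at ht
            omega
          · intro h8
            exact ⟨1, by omega⟩
        simp only [h7]
        split_ifs
        · field_simp
        · ring
      rw [Finset.sum_congr rfl h5, Finset.sum_comm, div_eq_inv_mul, Finset.mul_sum]
      refine Finset.sum_congr rfl fun b hb => ?_
      rw [Finset.mem_range] at hb
      have hbN : b * q < N := by
        rw [hq]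
        exact Nat.mul_lt_mul_of_pos_right hb (Nat.pos_of_ne_zero hq0)
      rw [Finset.sum_ite_eq', if_pos (Finset.mem_range.2 hbN)]
      congr 4
      rw [hq]
      push_cast
      have : (q : ℝ) ≠ 0 := by exact_mod_cast hq0
      have : (L : ℝ) ≠ 0 := by exact_mod_cast hL0.ne'
      field_simp
    · intro m' hm' hne
      rw [if_neg]
      intro h
      rw [hm, ← Equiv.Perm.iterate_eq_pow, ← Equiv.Perm.iterate_eq_pow] at h
      exact hne (iterate_injOn_Iio_minimalPeriod (Finset.mem_range.1 hm') hmL h.symm)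
    · intro h
      exact absurd (Finset.mem_range.2 hmL) h
  · push Not at hex
    rw [Finset.sum_eq_zero, Finset.sum_eq_zero]
    · intro m _
      rw [if_neg (hex m)]
    · intro k _
      rw [Finset.sum_eq_zero, mul_zero, mul_zero]
      intro i hi
      rw [if_neg, mul_zero]
      intro h
      apply hex (N - i)
      rw [Finset.mem_range] at hi
      have h2 : (p ^ i) (g d) = (p ^ i) ((p ^ (N - i)) d) := by
        rw [← Equiv.Perm.mul_apply, ← Equiv.Perm.mul_apply, ← pow_add, Nat.add_sub_cancel' hi.le,
          hNdef, pow_orderOf_eq_one, ← (hgp.pow_right i).eq, Equiv.Perm.mul_apply, h]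
        rfl
      exact (p ^ i).injective h2

theorem coincidence_eq_cycleSum (g p : Equiv.Perm D) (hgp : Commute g p) :
    coincidence g p = cycleSum g p
      (fun n m => ∑ b ∈ Finset.range n, (saw (b / n) : ℂ) * rootExp n m ^ b) :=
  sum_trace_eigenProj_eq_cycleSum saw g p hgp

theorem trace_mul_eigenProj_zero (g p : Equiv.Perm D) (hgp : Commute g p) :
    LinearMap.trace ℂ _ (permRep D g * eigenProj (permRep D p) (orderOf p) 0)
      = cycleSum g p (fun _ _ => 1) := by
  have h := sum_trace_eigenProj_eq_cycleSum (fun x => if x = 0 then 1 else 0) g p hgp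
  have hN : (orderOf p : ℝ) ≠ 0 := by exact_mod_cast (orderOf_pos p).ne'
  rw [Finset.sum_eq_single 0] at h
  · simp only [Nat.cast_zero, zero_div, if_true, Complex.ofReal_one, one_mul] at h
    rw [h, cycleSum, cycleSum]
    refine Finset.sum_congr rfl fun d _ => Finset.sum_congr rfl fun m _ => ?_
    have hL := minimalPeriod_pos_of_perm p d
    rw [Finset.sum_eq_single 0]
    · simp
    · intro b _ hb
      have : (b : ℝ) / minimalPeriod p d ≠ 0 := by positivity
      simp [this]
    · intro h0
      exact absurd (Finset.mem_range.2 hL) h0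
  · intro b _ hb
    have : (b : ℝ) / orderOf p ≠ 0 := by positivity
    simp [this]
  · intro h0
    exact absurd (Finset.mem_range.2 (orderOf_pos p)) h0

end Coincidence

/-! ### Complex cycles on a surface and the signature of their intersection form -/

section ComplexCycles

open Module Complex

namespace SurfaceAction

variable {G : Type u} [Group G] (S : SurfaceAction G)

/-- Cellular 1-cycles with complex coefficients. -/
def complexCycles : Submodule ℂ (EuclideanSpace ℂ S.Dart) where
  carrier := {z | (∀ d, z (S.rev d) = - z d) ∧ ∀ d, z d + z (S.next d) + z (S.next (S.next d)) = 0}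
  zero_mem' := by simp
  add_mem' := by
    rintro x y ⟨hx, hx'⟩ ⟨hy, hy'⟩
    refine ⟨fun d => ?_, fun d => ?_⟩
    · simp only [PiLp.add_apply, hx d, hy d]
      ring
    · simp only [PiLp.add_apply]
      linear_combination hx' d + hy' d
  smul_mem' := by
    rintro c x ⟨hx, hx'⟩
    refine ⟨fun d => ?_, fun d => ?_⟩
    · simp [hx d]
    · simp only [PiLp.smul_apply, smul_eq_mul]
      linear_combination c * hx' d

/-- The complex conjugate of a complex cycle. -/
def conjCycle (z : S.complexCycles) : S.complexCycles :=
  ⟨WithLp.toLp 2 fun d => (starRingEnd ℂ) ((z : EuclideanSpace ℂ S.Dart) d),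
    fun d => by
      simp only [z.2.1 d, map_neg],
    fun d => by
      simp only [← map_add, z.2.2 d, map_zero]⟩

/-- The real part of a complex cycle. -/
def reCycle : S.complexCycles →ₗ[ℝ] S.cycles where
  toFun z := ⟨fun d => ((z : EuclideanSpace ℂ S.Dart) d).re,
    fun d => (congrArg re (z.2.1 d)).trans (neg_re _),
    fun d => congrArg re (z.2.2 d)⟩
  map_add' _ _ := rfl
  map_smul' c z := by
    ext d
    simp

/-- The imaginary part of a complex cycle. -/
def imCycle : S.complexCycles →ₗ[ℝ] S.cycles where
  toFun z := ⟨fun d => ((z : EuclideanSpace ℂ S.Dart) d).im,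
    fun d => (congrArg im (z.2.1 d)).trans (neg_im _),
    fun d => congrArg im (z.2.2 d)⟩
  map_add' _ _ := rfl
  map_smul' c z := by
    ext d
    simp

theorem reCycle_apply (z : S.complexCycles) (d : S.Dart) :
    (S.reCycle z : S.Dart → ℝ) d = ((z : EuclideanSpace ℂ S.Dart) d).re := rfl

theorem imCycle_apply (z : S.complexCycles) (d : S.Dart) :
    (S.imCycle z : S.Dart → ℝ) d = ((z : EuclideanSpace ℂ S.Dart) d).im := rfl

theorem reCycle_I_smul (z : S.complexCycles) : S.reCycle (I • z) = - S.imCycle z := by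
  ext d
  simp [reCycle_apply, imCycle_apply]

theorem imCycle_I_smul (z : S.complexCycles) : S.imCycle (I • z) = S.reCycle z := by
  ext d
  simp [reCycle_apply, imCycle_apply]

theorem reCycle_conjCycle (z : S.complexCycles) : S.reCycle (S.conjCycle z) = S.reCycle z := by
  ext d
  simp [reCycle_apply, conjCycle]

theorem imCycle_conjCycle (z : S.complexCycles) : S.imCycle (S.conjCycle z) = - S.imCycle z := by
  ext d
  simp [imCycle_apply, conjCycle]

theorem exists_complexCycle (a b : S.cycles) :
    ∃ z : S.complexCycles, S.reCycle z = a ∧ S.imCycle z = b := by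
  refine ⟨⟨WithLp.toLp 2 fun d => ⟨(a : S.Dart → ℝ) d, (b : S.Dart → ℝ) d⟩, fun d => ?_,
    fun d => ?_⟩, ?_, ?_⟩
  · apply Complex.ext
    · exact a.2.1 d
    · exact b.2.1 d
  · apply Complex.ext
    · exact a.2.2 d
    · exact b.2.2 d
  · rfl
  · rfl

/-- The action of `G` on the complex cycles. -/
noncomputable def complexCycleRep (g : G) : End ℂ S.complexCycles :=
  (permRep S.Dart (S.act g)).restrict (by
    rintro z ⟨h1, h2⟩
    have e : (S.act g)⁻¹ = S.act g⁻¹ := (map_inv S.act g).symm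
    refine ⟨fun d => ?_, fun d => ?_⟩
    · simp only [permRep_apply, e, S.act_rev, h1]
    · simp only [permRep_apply, e, S.act_next, h2])

theorem reCycle_complexCycleRep (g : G) (z : S.complexCycles) :
    S.reCycle (S.complexCycleRep g z) = S.cycleRep g (S.reCycle z) := by
  ext d
  change (_ : ℂ).re = _
  rw [complexCycleRep, LinearMap.coe_restrict_apply, permRep_apply, ← map_inv]
  rfl

theorem imCycle_complexCycleRep (g : G) (z : S.complexCycles) :
    S.imCycle (S.complexCycleRep g z) = S.cycleRep g (S.imCycle z) := by
  ext d
  change (_ : ℂ).im = _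
  rw [complexCycleRep, LinearMap.coe_restrict_apply, permRep_apply, ← map_inv]
  rfl

theorem conjCycle_complexCycleRep (g : G) (z : S.complexCycles) :
    S.conjCycle (S.complexCycleRep g z) = S.complexCycleRep g (S.conjCycle z) := rfl

theorem conjCycle_add (z w : S.complexCycles) :
    S.conjCycle (z + w) = S.conjCycle z + S.conjCycle w := by
  ext d
  simp [conjCycle]

theorem conjCycle_smul (c : ℂ) (z : S.complexCycles) :
    S.conjCycle (c • z) = (starRingEnd ℂ) c • S.conjCycle z := by
  ext d
  simp [conjCycle]

variable {E : Type*} [NormedAddCommGroup E] [InnerProductSpace ℂ E]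

/-- The complex linear extension to the complex cycles, of a real linear map from homology to a
complex vector space. -/
noncomputable def cyclePeriod (e : S.H1 →ₗ[ℝ] E) : S.complexCycles →ₗ[ℂ] E where
  toFun z := e (S.boundaries.mkQ (S.reCycle z)) + I • e (S.boundaries.mkQ (S.imCycle z))
  map_add' z w := by
    simp only [map_add, smul_add]
    abel
  map_smul' c z := by
    have h : c • z = c.re • z + c.im • I • z := by
      rw [← Complex.coe_smul, ← Complex.coe_smul, smul_smul, ← add_smul, Complex.re_add_im]
    rw [h]
    simp only [map_add, map_smul, reCycle_I_smul, imCycle_I_smul, map_neg, RingHom.id_apply]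
    nth_rewrite 5 [← Complex.re_add_im c]
    simp only [← Complex.coe_smul, smul_add, smul_neg]
    match_scalars
    · ring
    · linear_combination (-c.im : ℂ) * I_mul_I

theorem cyclePeriod_apply (e : S.H1 →ₗ[ℝ] E) (z : S.complexCycles) : S.cyclePeriod e z
    = e (S.boundaries.mkQ (S.reCycle z)) + I • e (S.boundaries.mkQ (S.imCycle z)) := rfl

theorem cyclePeriod_conjCycle (e : S.H1 →ₗ[ℝ] E) (z : S.complexCycles) :
    S.cyclePeriod e (S.conjCycle z)
      = e (S.boundaries.mkQ (S.reCycle z)) - I • e (S.boundaries.mkQ (S.imCycle z)) := by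
  rw [cyclePeriod_apply, reCycle_conjCycle, imCycle_conjCycle, map_neg, map_neg, smul_neg,
    sub_eq_add_neg]

theorem cyclePeriod_complexCycleRep {e : S.H1 →ₗ[ℝ] E} {g : G} {r : End ℂ E}
    (he : ∀ x, e (S.homologyRep g x) = r (e x)) (z : S.complexCycles) :
    S.cyclePeriod e (S.complexCycleRep g z) = r (S.cyclePeriod e z) := by
  have h : ∀ x : S.cycles, e (S.boundaries.mkQ (S.cycleRep g x)) = r (e (S.boundaries.mkQ x)) :=
    fun x => he (S.boundaries.mkQ x)
  rw [cyclePeriod_apply, cyclePeriod_apply, reCycle_complexCycleRep, imCycle_complexCycleRep,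
    h, h, map_add, map_smul]

theorem norm_cyclePeriod {e : S.H1 →ₗ[ℝ] E}
    (he : ∀ x y, (inner ℂ (e x) (e y)).im = S.intersection x y) (z : S.complexCycles) :
    ‖S.cyclePeriod e (S.conjCycle z)‖ ^ 2 - ‖S.cyclePeriod e z‖ ^ 2
      = 4 * S.cycleIntersection (S.reCycle z) (S.imCycle z) := by
  have h := he (S.boundaries.mkQ (S.reCycle z)) (S.boundaries.mkQ (S.imCycle z))
  change _ = S.cycleIntersection (S.reCycle z) (S.imCycle z) at h
  rw [cyclePeriod_conjCycle, cyclePeriod_apply, @norm_sub_sq ℂ, @norm_add_sq ℂ, inner_smul_right]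
  rw [← h]
  simp
  ring

/-- In terms of complex cycles, the intersection form is a multiple of the form
`Im ⟪z, z ∘ next⟫`. -/
theorem im_inner_next (z : S.complexCycles) :
    (inner ℂ (z : EuclideanSpace ℂ S.Dart) (permRep S.Dart S.next⁻¹ z)).im
      = 6 * S.cycleIntersection (S.reCycle z) (S.imCycle z) := by
  rw [cycleIntersection_apply, PiLp.inner_apply, im_sum, ← mul_assoc,
    show (6 : ℝ) * (1 / 6) = 1 by norm_num, one_mul]
  refine Finset.sum_congr rfl fun d _ => ?_
  rw [permRep_apply, inv_inv]
  simp [reCycle_apply, imCycle_apply]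
  ring

theorem coe_complexCycleRep (g : G) (z : S.complexCycles) :
    (S.complexCycleRep g z : EuclideanSpace ℂ S.Dart)
      = permRep S.Dart (S.act g) (z : EuclideanSpace ℂ S.Dart) := rfl

theorem complexCycleRep_pow {g : G} {n : ℕ} (hg : g ^ n = 1) : S.complexCycleRep g ^ n = 1 := by
  have h : ∀ (m : ℕ) (z : S.complexCycles), ((S.complexCycleRep g ^ m) z : EuclideanSpace ℂ S.Dart)
      = permRep S.Dart (S.act (g ^ m)) (z : EuclideanSpace ℂ S.Dart) := by
    intro m z
    induction m with
    | zero => simp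
    | succ m ih =>
      rw [pow_succ', Module.End.mul_apply, coe_complexCycleRep, ih, pow_succ', map_mul, map_mul]
      rfl
  ext z : 2
  rw [h, hg]
  simp

theorem conjCycle_eigenProj {g : G} {n : ℕ} (a : ℕ) (z : S.complexCycles) :
    S.conjCycle (eigenProj (S.complexCycleRep g) n a z) = (n : ℂ)⁻¹ • ∑ i ∈ Finset.range n,
      ((starRingEnd ℂ) (rootExp n a))⁻¹ ^ i • (S.complexCycleRep g ^ i) (S.conjCycle z) := by
  let c : S.complexCycles →+ S.complexCycles :=
    ⟨⟨S.conjCycle, by ext; simp [conjCycle]⟩, S.conjCycle_add⟩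
  have hc : ∀ z, c z = S.conjCycle z := fun _ => rfl
  have hpow : ∀ i (z : S.complexCycles), S.conjCycle ((S.complexCycleRep g ^ i) z)
      = (S.complexCycleRep g ^ i) (S.conjCycle z) := by
    intro i z
    induction i with
    | zero => rfl
    | succ i ih => rw [pow_succ', Module.End.mul_apply, conjCycle_complexCycleRep, ih]; rfl
  rw [eigenProj, LinearMap.smul_apply, conjCycle_smul, LinearMap.sum_apply, ← hc, map_sum]
  simp only [hc, LinearMap.smul_apply, conjCycle_smul, hpow, map_inv₀, map_pow, map_natCast]

/-- On the eigenspaces of an element `g`, the period map identifies the complex cycles modulo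
boundaries with the sum of two eigenspaces of the unitary representation. -/
theorem exists_eigencycle {e : S.H1 ≃ₗ[ℝ] E} {g : G} {r : End ℂ E}
    (he : ∀ x, e (S.homologyRep g x) = r (e x)) {n : ℕ} (hn : n ≠ 0) (hg : g ^ n = 1) (a : ℕ)
    {u v : E} (hu : r u = rootExp n a • u) (hv : r v = (starRingEnd ℂ) (rootExp n a) • v) :
    ∃ z, S.complexCycleRep g z = rootExp n a • z ∧
      S.cyclePeriod (e : S.H1 →ₗ[ℝ] E) z = u ∧
      S.cyclePeriod (e : S.H1 →ₗ[ℝ] E) (S.conjCycle z) = v := by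
  -- real and imaginary part of `z` are chosen such that `e x + i e y = u` and `e x - i e y = v`;
  -- the projection of `z` to the eigenspace of `g` has the same periods
  obtain ⟨x, hx⟩ := S.boundaries.mkQ_surjective (e.symm ((2 : ℂ)⁻¹ • (u + v)))
  obtain ⟨y, hy⟩ := S.boundaries.mkQ_surjective (e.symm ((-(2 : ℂ)⁻¹ * I) • (u - v)))
  obtain ⟨z, rfl, rfl⟩ := S.exists_complexCycle x y
  have hz1 : S.cyclePeriod (e : S.H1 →ₗ[ℝ] E) z = u := by
    rw [cyclePeriod_apply, hx, hy]
    simp only [LinearEquiv.coe_coe, LinearEquiv.apply_symm_apply]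
    match_scalars
    · linear_combination (-1/2 : ℂ) * I_mul_I
    · linear_combination (1/2 : ℂ) * I_mul_I
  have hz2 : S.cyclePeriod (e : S.H1 →ₗ[ℝ] E) (S.conjCycle z) = v := by
    rw [cyclePeriod_conjCycle, hx, hy]
    simp only [LinearEquiv.coe_coe, LinearEquiv.apply_symm_apply]
    match_scalars
    · linear_combination (1/2 : ℂ) * I_mul_I
    · linear_combination (-1/2 : ℂ) * I_mul_I
  have hpow : ∀ i z, S.cyclePeriod (e : S.H1 →ₗ[ℝ] E) ((S.complexCycleRep g ^ i) z)
      = (r ^ i) (S.cyclePeriod (e : S.H1 →ₗ[ℝ] E) z) := by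
    intro i z
    induction i with
    | zero => rfl
    | succ i ih =>
      rw [pow_succ', Module.End.mul_apply, pow_succ', Module.End.mul_apply, ← ih]
      exact S.cyclePeriod_complexCycleRep (e := (e : S.H1 →ₗ[ℝ] E)) he _
  have hrp : ∀ (w : ℂ) (x : E), r x = w • x → ∀ i, (r ^ i) x = w ^ i • x := by
    intro w x hx i
    induction i with
    | zero => simp
    | succ i ih =>
      rw [pow_succ', Module.End.mul_apply, ih, map_smul, hx, smul_smul, pow_succ]
  have hsum : ∀ (w : ℂ) (x : E), w ≠ 0 → r x = w • x →
      (n : ℂ)⁻¹ • ∑ i ∈ Finset.range n, w⁻¹ ^ i • (r ^ i) x = x := by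
    intro w x hw hx
    simp only [hrp w x hx, smul_smul, ← mul_pow, inv_mul_cancel₀ hw, one_pow, one_smul]
    rw [Finset.sum_const, Finset.card_range, ← Nat.cast_smul_eq_nsmul ℂ, smul_smul,
      inv_mul_cancel₀ (by exact_mod_cast hn), one_smul]
  have hw := rootExp_ne_zero n a
  refine ⟨eigenProj (S.complexCycleRep g) n a z,
    eigenProj_mem hn (S.complexCycleRep_pow hg) a z, ?_, ?_⟩
  · rw [eigenProj, LinearMap.smul_apply, LinearMap.sum_apply, map_smul, map_sum]
    simp only [LinearMap.smul_apply, map_smul, hpow, hz1]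
    exact hsum _ u hw hu
  · rw [conjCycle_eigenProj, map_smul, map_sum]
    simp only [map_smul, hpow, hz2]
    exact hsum _ v (by simpa using hw) hv

/-- The permutation `next⁻¹`, as an element of the centralizer of an element of `G`. -/
def nextCentral (g : G) : Subgroup.centralizer {S.act g} :=
  ⟨S.next⁻¹, Subgroup.mem_centralizer_singleton_iff.2 (by
    ext d
    exact (S.act_next_symm g d).symm)⟩

/-- The permutation `rev`, as an element of the centralizer of an element of `G`. -/
def revCentral (g : G) : Subgroup.centralizer {S.act g} :=
  ⟨S.rev, Subgroup.mem_centralizer_singleton_iff.2 (by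
    ext d
    exact (S.act_rev g d).symm)⟩

theorem permRep_next_next_next (z : EuclideanSpace ℂ S.Dart) :
    permRep S.Dart S.next⁻¹ (permRep S.Dart S.next⁻¹ (permRep S.Dart S.next⁻¹ z)) = z := by
  ext d
  simp only [permRep_apply, inv_inv, S.next_next_next]

theorem rev_inv : S.rev⁻¹ = S.rev := by
  ext d
  rw [Equiv.Perm.inv_eq_iff_eq, S.rev_rev]

theorem permRep_rev_rev (z : EuclideanSpace ℂ S.Dart) :
    permRep S.Dart S.rev (permRep S.Dart S.rev z) = z := by
  ext d
  simp only [permRep_apply, rev_inv, S.rev_rev]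

theorem mem_complexCycles_iff (z : EuclideanSpace ℂ S.Dart) : z ∈ S.complexCycles ↔
    permRep S.Dart S.rev z = -z ∧
      z + permRep S.Dart S.next⁻¹ z + permRep S.Dart S.next⁻¹ (permRep S.Dart S.next⁻¹ z) = 0 := by
  have h1 : permRep S.Dart S.rev z = -z ↔ ∀ d, z (S.rev d) = - z d := by
    rw [PiLp.ext_iff]
    simp only [permRep_apply, rev_inv, PiLp.neg_apply]
  have h2 : (z + permRep S.Dart S.next⁻¹ z
        + permRep S.Dart S.next⁻¹ (permRep S.Dart S.next⁻¹ z) = 0)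
      ↔ ∀ d, z d + z (S.next d) + z (S.next (S.next d)) = 0 := by
    rw [PiLp.ext_iff]
    simp only [permRep_apply, inv_inv, PiLp.add_apply, PiLp.zero_apply]
  rw [h1, h2]
  rfl

theorem imForm_rev (y : EuclideanSpace ℂ S.Dart) :
    imForm (EuclideanSpace ℂ S.Dart) y (permRep S.Dart S.rev y) = 0 := by
  have h2 := antisymm_of_self_eq_zero (imForm_self (E := EuclideanSpace ℂ S.Dart)) y
    (permRep S.Dart S.rev y)
  have h3 : imForm (EuclideanSpace ℂ S.Dart) y (permRep S.Dart S.rev y)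
      = imForm (EuclideanSpace ℂ S.Dart) (permRep S.Dart S.rev y) y := by
    rw [imForm_apply, imForm_apply, ← inner_permRep S.rev, permRep_rev_rev]
  linarith

theorem imForm_next (x : EuclideanSpace ℂ S.Dart) :
    imForm (EuclideanSpace ℂ S.Dart) (permRep S.Dart S.next⁻¹ x - x)
      (permRep S.Dart S.next⁻¹ (permRep S.Dart S.next⁻¹ x - x))
      = 3 * imForm (EuclideanSpace ℂ S.Dart) x (permRep S.Dart S.next⁻¹ x) := by
  have h := S.permRep_next_next_next x
  have hinv : ∀ x y, imForm (EuclideanSpace ℂ S.Dart) (permRep S.Dart S.next⁻¹ x)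
      (permRep S.Dart S.next⁻¹ y) = imForm (EuclideanSpace ℂ S.Dart) x y := by
    intro x y
    rw [imForm_apply, inner_permRep]
    rfl
  set A := permRep S.Dart S.next⁻¹
  have e1 := hinv x (A (A x))
  rw [h] at e1
  have e2 := hinv x (A x)
  have e3 := imForm_self (A x)
  have e4 := antisymm_of_self_eq_zero (imForm_self (E := EuclideanSpace ℂ S.Dart)) x (A x)
  simp only [map_sub, LinearMap.sub_apply]
  linarith

variable [FiniteDimensional ℂ E]

set_option maxHeartbeats 1000000 in
/-- The Meyer cocycle of `next⁻¹` and `rev` on an eigenspace of `g` is the signature of the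
intersection form on the corresponding part of the homology. -/
theorem eigenMeyer_next_rev {e : S.H1 ≃ₗ[ℝ] E} {g : G} {r : End ℂ E}
    (hi : ∀ x y, (inner ℂ (e x) (e y)).im = S.intersection x y)
    (he : ∀ x, e (S.homologyRep g x) = r (e x)) {n : ℕ} (hn : n ≠ 0) (hg : g ^ n = 1) (a : ℕ) :
    eigenMeyer (S.act g) (rootExp n a) (S.nextCentral g) (S.revCentral g)
      = 2 * finrank ℂ (End.eigenspace r ((starRingEnd ℂ) (rootExp n a)))
        - 2 * finrank ℂ (End.eigenspace r (rootExp n a)) := by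
  set w := rootExp n a with hw
  set A := permRep S.Dart S.next⁻¹ with hA
  set B := permRep S.Dart S.rev with hB
  have hA3 : ∀ x, A (A (A x)) = x := S.permRep_next_next_next
  let W := meyerSpace ((eigenRep (S.act g) w (S.nextCentral g)).restrictScalars ℝ)
    ((eigenRep (S.act g) w (S.revCentral g)).restrictScalars ℝ)
  -- the cycle `A x - x = y - B y`
  let Φ : W →ₗ[ℝ] EuclideanSpace ℂ S.Dart :=
    { toFun := fun p => A (p.1.1 : EuclideanSpace ℂ S.Dart) - (p.1.1 : EuclideanSpace ℂ S.Dart)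
      map_add' := fun p q => by
        simp only [Submodule.coe_add, Prod.fst_add, map_add]
        abel
      map_smul' := fun c p => by
        simp only [Submodule.coe_smul, Prod.smul_fst, RingHom.id_apply, smul_sub]
        congr 1 }
  have hΦ : ∀ p : W, Φ p = A (p.1.1 : EuclideanSpace ℂ S.Dart) - p.1.1 := fun _ => rfl
  have hΦ' : ∀ p : W, Φ p = p.1.2 - B (p.1.2 : EuclideanSpace ℂ S.Dart) := by
    intro p
    have h := congrArg Subtype.val (mem_meyerSpace.1 p.2)
    change (A (p.1.1 : EuclideanSpace ℂ S.Dart) - (p.1.1 : EuclideanSpace ℂ S.Dart)) +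
      (B (p.1.2 : EuclideanSpace ℂ S.Dart) - p.1.2) = 0 at h
    rw [hΦ, eq_neg_of_add_eq_zero_left h, neg_sub]
  have hΦm : ∀ p : W, Φ p ∈ S.complexCycles := by
    intro p
    rw [mem_complexCycles_iff]
    constructor
    · rw [hΦ', map_sub, ← hB, permRep_rev_rev, neg_sub]
    · rw [← hA]
      simp only [hΦ, map_sub, hA3]
      abel
  let Ψ : W →ₗ[ℝ] S.complexCycles := Φ.codRestrict (S.complexCycles.restrictScalars ℝ) hΦm
  have hΨ : ∀ p : W, (Ψ p : EuclideanSpace ℂ S.Dart) = Φ p := fun _ => rfl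
  have hcomm : ∀ x, permRep S.Dart (S.act g) (A x) = A (permRep S.Dart (S.act g) x) := by
    intro x
    have h := (Subgroup.mem_centralizer_singleton_iff.1 (S.nextCentral g).2)
    rw [← Module.End.mul_apply, ← Module.End.mul_apply, hA, ← map_mul, ← map_mul]
    congr 2
    exact h.symm
  have hΨe : ∀ p : W, S.complexCycleRep g (Ψ p) = w • Ψ p := by
    intro p
    apply Subtype.ext
    have h1 := End.mem_eigenspace_iff.1 p.1.1.2
    rw [coe_complexCycleRep, Submodule.coe_smul, hΨ, hΦ, map_sub, hcomm, h1, map_smul, smul_sub]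
  have hu : ∀ p : W, r (S.cyclePeriod (e : S.H1 →ₗ[ℝ] E) (Ψ p))
      = w • S.cyclePeriod (e : S.H1 →ₗ[ℝ] E) (Ψ p) := by
    intro p
    rw [← S.cyclePeriod_complexCycleRep (e := (e : S.H1 →ₗ[ℝ] E)) he, hΨe, map_smul]
  have hv : ∀ p : W, r (S.cyclePeriod (e : S.H1 →ₗ[ℝ] E) (S.conjCycle (Ψ p)))
      = (starRingEnd ℂ) w • S.cyclePeriod (e : S.H1 →ₗ[ℝ] E) (S.conjCycle (Ψ p)) := by
    intro p
    rw [← S.cyclePeriod_complexCycleRep (e := (e : S.H1 →ₗ[ℝ] E)) he, ← conjCycle_complexCycleRep,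
      hΨe, conjCycle_smul, map_smul]
  obtain ⟨F, hF1, hF2⟩ : ∃ F : W →ₗ[ℝ] End.eigenspace r ((starRingEnd ℂ) w) × End.eigenspace r w,
      (∀ p, ((F p).1 : E) = S.cyclePeriod (e : S.H1 →ₗ[ℝ] E) (S.conjCycle (Ψ p))) ∧
      ∀ p, ((F p).2 : E) = S.cyclePeriod (e : S.H1 →ₗ[ℝ] E) (Ψ p) := ⟨
    { toFun := fun p => (⟨S.cyclePeriod (e : S.H1 →ₗ[ℝ] E) (S.conjCycle (Ψ p)),
          End.mem_eigenspace_iff.2 (hv p)⟩,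
        ⟨S.cyclePeriod (e : S.H1 →ₗ[ℝ] E) (Ψ p), End.mem_eigenspace_iff.2 (hu p)⟩)
      map_add' := fun p q => by
        ext
        · simp only [map_add, conjCycle_add, Prod.fst_add, Submodule.coe_add]
        · simp only [map_add, Prod.snd_add, Submodule.coe_add]
      map_smul' := fun c p => by
        ext
        · simp only [cyclePeriod_conjCycle, map_smul, RingHom.id_apply, Prod.smul_fst,
            smul_comm I c]
          rw [← smul_sub]
          rfl
        · simp only [cyclePeriod_apply, map_smul, RingHom.id_apply, Prod.smul_snd,
            smul_comm I c]
          rw [← smul_add]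
          rfl }, fun _ => rfl, fun _ => rfl⟩
  have hF : Function.Surjective F := by
    rintro ⟨⟨v, hv⟩, ⟨u, hu⟩⟩
    obtain ⟨z, hz, hzu, hzv⟩ := S.exists_eigencycle he hn hg a (End.mem_eigenspace_iff.1 hu)
      (End.mem_eigenspace_iff.1 hv)
    have hz1 : permRep S.Dart (S.act g) (z : EuclideanSpace ℂ S.Dart)
        = w • (z : EuclideanSpace ℂ S.Dart) := congrArg Subtype.val hz
    obtain ⟨hz2, hz3⟩ := (S.mem_complexCycles_iff z).1 z.2
    rw [← hA] at hz3
    rw [← hB] at hz2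
    -- a solution of `A x - x = y - B y = z`
    let x : EuclideanSpace ℂ S.Dart :=
      (-(3 : ℂ)⁻¹) • (A z + (2 : ℂ) • (z : EuclideanSpace ℂ S.Dart))
    let y : EuclideanSpace ℂ S.Dart := (2 : ℂ)⁻¹ • (z : EuclideanSpace ℂ S.Dart)
    have hx : x ∈ End.eigenspace (permRep S.Dart (S.act g)) w := by
      rw [End.mem_eigenspace_iff, map_smul, map_add, map_smul, hcomm, hz1, map_smul,
        smul_comm (2 : ℂ), ← smul_add, smul_comm w]
    have hy : y ∈ End.eigenspace (permRep S.Dart (S.act g)) w := by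
      rw [End.mem_eigenspace_iff, map_smul, hz1, smul_comm w]
    have hxz : A x - x = z := by
      have h3 : A (A z) = - z - A z := by
        rw [eq_sub_iff_add_eq, eq_neg_iff_add_eq_zero, ← hz3]
        abel
      simp only [x, map_smul, map_add, h3]
      module
    have hyz : y - B y = z := by
      simp only [y, map_smul, hz2]
      module
    have hm : ((⟨x, hx⟩, ⟨y, hy⟩) : End.eigenspace (permRep S.Dart (S.act g)) w ×
        End.eigenspace (permRep S.Dart (S.act g)) w) ∈ W := by
      rw [mem_meyerSpace]
      apply Subtype.ext
      change (A x - x) + (B y - y) = 0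
      rw [hxz, ← hyz, sub_add_sub_cancel, sub_self]
    have hΨz : Ψ ⟨_, hm⟩ = z := Subtype.ext hxz
    refine ⟨⟨_, hm⟩, ?_⟩
    ext
    · rw [hF1, hΨz, hzv]
    · rw [hF2, hΨz, hzu]
  have hform : ∀ p : W, (meyerForm (imForm (End.eigenspace (permRep S.Dart (S.act g)) w))
      ((eigenRep (S.act g) w (S.nextCentral g)).restrictScalars ℝ)
      ((eigenRep (S.act g) w (S.revCentral g)).restrictScalars ℝ)).restrict W p
      = QuadraticMap.prod (normForm (End.eigenspace r ((starRingEnd ℂ) w)) (1 / 2))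
        (normForm (End.eigenspace r w) (-1 / 2)) (F p) := by
    intro p
    have h1 := S.imForm_rev p.1.2
    have h4 := S.imForm_next p.1.1
    rw [← hA, ← hΦ] at h4
    have h5 := S.im_inner_next (Ψ p)
    have h6 := S.norm_cyclePeriod (e := (e : S.H1 →ₗ[ℝ] E)) hi (Ψ p)
    have h7 : imForm (EuclideanSpace ℂ S.Dart) (Φ p) (A (Φ p))
        = 6 * S.cycleIntersection (S.reCycle (Ψ p)) (S.imCycle (Ψ p)) := h5
    rw [QuadraticMap.restrict_apply _ W p, meyerForm_apply, QuadraticMap.prod_apply, normForm_apply,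
      normForm_apply, Submodule.coe_norm, Submodule.coe_norm, hF1, hF2]
    change imForm (EuclideanSpace ℂ S.Dart) (p.1.1 : EuclideanSpace ℂ S.Dart)
      (A (p.1.1 : EuclideanSpace ℂ S.Dart)) + imForm (EuclideanSpace ℂ S.Dart)
      (p.1.2 : EuclideanSpace ℂ S.Dart) (B (p.1.2 : EuclideanSpace ℂ S.Dart))
      = 1 / 2 * ‖S.cyclePeriod (e : S.H1 →ₗ[ℝ] E) (S.conjCycle (Ψ p))‖ ^ 2
        + -1 / 2 * ‖S.cyclePeriod (e : S.H1 →ₗ[ℝ] E) (Ψ p)‖ ^ 2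
    linarith
  rw [eigenMeyer, meyer, signature_eq_of_surjective _ _ F hF hform, signature_prod,
    signature_normForm, signature_normForm, sign_pos (by norm_num), sign_neg (by norm_num)]
  simp
  ring

theorem iterate_next_ne {g : G} (hg : g ≠ 1) (i : ℕ) (d : S.Dart) :
    S.act g (((S.next⁻¹) ^ i) d) ≠ d := by
  obtain ⟨d, rfl⟩ := (S.next ^ i).surjective d
  rw [inv_pow, show (S.next ^ i)⁻¹ ((S.next ^ i) d) = d from (S.next ^ i).symm_apply_apply d]
  have h3 : S.next ^ 3 = 1 := by
    ext d
    exact S.next_next_next d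
  have h : (S.next ^ i) d = d ∨ (S.next ^ i) d = S.next d ∨ (S.next ^ i) d = S.next (S.next d) := by
    rw [← Nat.div_add_mod i 3, pow_add, pow_mul, h3, one_pow, one_mul]
    have : i % 3 < 3 := Nat.mod_lt _ (by norm_num)
    interval_cases i % 3
    · exact Or.inl rfl
    · exact Or.inr (Or.inl rfl)
    · exact Or.inr (Or.inr rfl)
  obtain ⟨f0, f1, f2⟩ := S.free_vertex g hg d
  rcases h with h | h | h <;> rwa [h]

theorem iterate_rev_ne {g : G} (hg : g ≠ 1) (i : ℕ) (d : S.Dart) :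
    S.act g ((S.rev ^ i) d) ≠ d := by
  have h2 : S.rev ^ 2 = 1 := by
    ext d
    exact S.rev_rev d
  have h : (S.rev ^ i) d = d ∨ (S.rev ^ i) d = S.rev d := by
    rw [← Nat.div_add_mod i 2, pow_add, pow_mul, h2, one_pow, one_mul]
    have : i % 2 < 2 := Nat.mod_lt _ (by norm_num)
    interval_cases i % 2
    · exact Or.inl rfl
    · exact Or.inr rfl
  obtain ⟨f0, f1⟩ := S.free_edge g hg d
  rcases h with h | h
  · rwa [h]
  · rw [h, S.act_rev]
    intro h3
    apply f1
    rw [← S.rev_rev (S.act g d), h3]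

/-- The `g`-signature theorem: the imaginary part of the character of the unitary representation
on the homology is a sum over the faces mapped to themselves by `g`. -/
theorem trace_sub_conj_trace {e : S.H1 ≃ₗ[ℝ] E} {g : G} {r : End ℂ E}
    (hi : ∀ x y, (inner ℂ (e x) (e y)).im = S.intersection x y)
    (he : ∀ x, e (S.homologyRep g x) = r (e x)) {n : ℕ} (hn : n ≠ 0) (hg : g ^ n = 1)
    (hr : r ^ n = 1) (hg1 : g ≠ 1) :
    LinearMap.trace ℂ E r - (starRingEnd ℂ) (LinearMap.trace ℂ E r)
      = coincidence (S.act g) S.faceNext := by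
  have h := sum_rootExp_mul_meyer (S.act g) hn (by rw [← map_pow, hg, map_one])
    (S.nextCentral g) (S.revCentral g)
  have h1 : ((S.nextCentral g * S.revCentral g : Subgroup.centralizer {S.act g}) :
      Equiv.Perm S.Dart) = S.faceNext := rfl
  have h2 : coincidence (S.act g) (S.nextCentral g : Equiv.Perm S.Dart) = 0 :=
    coincidence_eq_zero _ _ (S.iterate_next_ne hg1)
  have h3 : coincidence (S.act g) (S.revCentral g : Equiv.Perm S.Dart) = 0 :=
    coincidence_eq_zero _ _ (S.iterate_rev_ne hg1)
  have h1' : (S.nextCentral g : Equiv.Perm S.Dart) * S.revCentral g = S.faceNext := rfl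
  simp only [S.eigenMeyer_next_rev hi he hn hg] at h
  rw [h2, h3, h1'] at h
  have h4 : (starRingEnd ℂ) (LinearMap.trace ℂ E r) = ∑ a ∈ Finset.range n, rootExp n a *
      finrank ℂ (End.eigenspace r ((starRingEnd ℂ) (rootExp n a))) := by
    rw [trace_eq_sum_rootExp_mul_finrank hn hr, map_sum]
    have hc : ∀ a < n, (starRingEnd ℂ) (rootExp n a) = rootExp n ((n - a) % n) := by
      intro a ha
      have e1 : (starRingEnd ℂ) (rootExp n a) = (rootExp n a)⁻¹ :=
        eq_inv_of_mul_eq_one_left (conj_rootExp_mul_self n a)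
      rw [e1, ← rootExp_self_sub hn ha.le]
      rcases Nat.eq_zero_or_pos a with rfl | h0
      · rw [Nat.sub_zero, Nat.mod_self, rootExp_zero, ← one_mul n, rootExp_pow_mul]
        simp [rootExp_eq, (isPrimitiveRoot_exp n hn).pow_eq_one]
      · rw [Nat.mod_eq_of_lt (by omega)]
    have hinv : ∀ a < n, (n - (n - a) % n) % n = a := by
      intro a ha
      rcases Nat.eq_zero_or_pos a with rfl | h0
      · simp
      · rw [Nat.mod_eq_of_lt (a := n - a) (by omega), Nat.sub_sub_self ha.le, Nat.mod_eq_of_lt ha]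
    have hlt : ∀ a, (n - a) % n < n := fun a => Nat.mod_lt _ (Nat.pos_of_ne_zero hn)
    refine Finset.sum_nbij' (fun a => (n - a) % n) (fun a => (n - a) % n)
      (fun a _ => Finset.mem_range.2 (hlt a)) (fun a _ => Finset.mem_range.2 (hlt a))
      (fun a ha => hinv a (Finset.mem_range.1 ha)) (fun a ha => hinv a (Finset.mem_range.1 ha)) ?_
    intro a ha
    rw [Finset.mem_range] at ha
    rw [map_mul, map_natCast, hc a ha, hc _ (hlt a), hinv a ha]
  have h5 := trace_eq_sum_rootExp_mul_finrank hn hr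
  have h6 : (2 : ℂ) * (starRingEnd ℂ) (LinearMap.trace ℂ E r) - 2 * LinearMap.trace ℂ E r
      = 2 * (0 + 0 - coincidence (S.act g) S.faceNext) := by
    rw [← h, h4]
    nth_rewrite 1 [h5]
    rw [Finset.mul_sum, Finset.mul_sum, ← Finset.sum_sub_distrib]
    refine Finset.sum_congr rfl fun a _ => ?_
    push_cast
    ring
  linear_combination (-1 / 2 : ℂ) * h6

end SurfaceAction

end ComplexCycles

/-! ### The Lefschetz fixed point formula -/

section Exact

open Module

variable {𝕜 K V W : Type*} [Field 𝕜] [AddCommGroup K] [Module 𝕜 K] [FiniteDimensional 𝕜 K]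
  [AddCommGroup V] [Module 𝕜 V] [FiniteDimensional 𝕜 V]
  [AddCommGroup W] [Module 𝕜 W] [FiniteDimensional 𝕜 W]

/-- The trace is additive in short exact sequences. -/
theorem trace_eq_add_of_exact (i : K →ₗ[𝕜] V) (q : V →ₗ[𝕜] W) (hi : Function.Injective i)
    (hq : Function.Surjective q) (hiq : ∀ x, q x = 0 ↔ ∃ k, i k = x) {a : End 𝕜 K} {b : End 𝕜 V}
    {c : End 𝕜 W} (hab : ∀ k, b (i k) = i (a k)) (hbc : ∀ x, q (b x) = c (q x)) :
    LinearMap.trace 𝕜 V b = LinearMap.trace 𝕜 K a + LinearMap.trace 𝕜 W c := by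
  obtain ⟨π, hπ⟩ := i.exists_leftInverse_of_injective (LinearMap.ker_eq_bot.2 hi)
  obtain ⟨s, hs⟩ := q.exists_rightInverse_of_surjective (LinearMap.range_eq_top.2 hq)
  have hπ' : ∀ k, π (i k) = k := fun k => LinearMap.congr_fun hπ k
  have hs' : ∀ w, q (s w) = w := fun w => LinearMap.congr_fun hs w
  let t : V →ₗ[𝕜] K := π ∘ₗ (LinearMap.id - s ∘ₗ q)
  have ht : ∀ x, t x = π (x - s (q x)) := fun _ => rfl
  have h1 : b = (b ∘ₗ i) ∘ₗ t + (b ∘ₗ s) ∘ₗ q := by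
    ext x
    obtain ⟨k, hk⟩ := (hiq (x - s (q x))).1 (by rw [map_sub, hs', sub_self])
    change b x = b (i (t x)) + b (s (q x))
    rw [ht, ← hk, hπ', hk, ← map_add, sub_add_cancel]
  have h2 : t ∘ₗ (b ∘ₗ i) = a := by
    ext k
    change t (b (i k)) = a k
    rw [hab, ht, (hiq _).2 ⟨_, rfl⟩, map_zero, sub_zero, hπ']
  have h3 : q ∘ₗ (b ∘ₗ s) = c := by
    ext w
    change q (b (s w)) = c w
    rw [hbc, hs']
  rw [h1, map_add, LinearMap.trace_comp_comm', LinearMap.trace_comp_comm' q (b ∘ₗ s), h2, h3]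

/-- The trace on a subspace is the trace of the composition with a projection to it. -/
theorem trace_eq_trace_mul_of_isProj {L : Submodule 𝕜 V} {P : End 𝕜 V} (hP : LinearMap.IsProj L P)
    {a : End 𝕜 L} {b : End 𝕜 V} (hab : ∀ k : L, b k = a k) :
    LinearMap.trace 𝕜 L a = LinearMap.trace 𝕜 V (b * P) := by
  let π : V →ₗ[𝕜] L := P.codRestrict L hP.map_mem
  have h1 : b * P = (b ∘ₗ L.subtype) ∘ₗ π := rfl
  have h2 : π ∘ₗ (b ∘ₗ L.subtype) = a := by
    ext k
    change P (b k) = a k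
    rw [hab, hP.map_id _ (a k).2]
  rw [h1, LinearMap.trace_comp_comm', h2]

end Exact

section FixedVectors

open Module

variable {E : Type*} [NormedAddCommGroup E] [InnerProductSpace ℂ E]

theorem inner_pow_pow {U : End ℂ E} (hU : ∀ x y, inner ℂ (U x) (U y) = inner ℂ x y) (i : ℕ)
    (x y : E) : inner ℂ ((U ^ i) x) ((U ^ i) y) = inner ℂ x y := by
  induction i with
  | zero => rfl
  | succ i ih => rw [pow_succ', Module.End.mul_apply, Module.End.mul_apply, hU, ih]

theorem pow_apply_of_fixed {U : End ℂ E} {x : E} (hx : U x = x) (i : ℕ) : (U ^ i) x = x := by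
  induction i with
  | zero => rfl
  | succ i ih => rw [pow_succ', Module.End.mul_apply, ih, hx]

/-- The orthogonal complement of the fixed vectors of a unitary operator of finite order. -/
theorem mem_orthogonal_eigenspace_one {U : End ℂ E}
    (hU : ∀ x y, inner ℂ (U x) (U y) = inner ℂ x y) {n : ℕ} (hn : n ≠ 0) (hUn : U ^ n = 1) (x : E) :
    x ∈ (End.eigenspace U 1)ᗮ ↔ ∑ i ∈ Finset.range n, (U ^ i) x = 0 := by
  have key : ∀ a, U a = a → inner ℂ a (∑ i ∈ Finset.range n, (U ^ i) x) = n * inner ℂ a x := by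
    intro a ha
    rw [inner_sum, Finset.sum_congr rfl (g := fun _ => inner ℂ a x), Finset.sum_const,
      Finset.card_range, nsmul_eq_mul]
    intro i _
    rw [← inner_pow_pow hU i a x, pow_apply_of_fixed ha]
  have hn' : (n : ℂ) ≠ 0 := by exact_mod_cast hn
  have hfix : U (∑ i ∈ Finset.range n, (U ^ i) x) = ∑ i ∈ Finset.range n, (U ^ i) x := by
    rw [map_sum]
    have h := Finset.sum_range_succ' (fun i => (U ^ i) x) n
    rw [Finset.sum_range_succ, hUn, pow_zero] at h
    simp only [pow_succ' U _, Module.End.mul_apply] at h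
    exact (add_right_cancel h).symm
  rw [Submodule.mem_orthogonal]
  constructor
  · intro h
    rw [← inner_self_eq_zero (𝕜 := ℂ), key _ hfix, h _ (End.mem_eigenspace_iff.2
      (by rw [hfix, one_smul])), mul_zero]
  · intro h a ha
    rw [End.mem_eigenspace_iff, one_smul] at ha
    have := key a ha
    rw [h, inner_zero_right] at this
    exact (mul_eq_zero.1 this.symm).resolve_left hn'

variable {D : Type*} [Fintype D]

/-- The trace of a permutation on the functions invariant under another one, commuting with it. -/
theorem trace_eigenRep_one (p : Equiv.Perm D) (q : Subgroup.centralizer {p}) :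
    LinearMap.trace ℂ _ (eigenRep p 1 q)
      = LinearMap.trace ℂ _ (permRep D (q : Equiv.Perm D) *
        eigenProj (permRep D p) (orderOf p) 0) := by
  have hN := (orderOf_pos p).ne'
  have hp : permRep D p ^ orderOf p = 1 := by rw [← map_pow, pow_orderOf_eq_one, map_one]
  have hP : LinearMap.IsProj (End.eigenspace (permRep D p) 1)
      (eigenProj (permRep D p) (orderOf p) 0) := by
    constructor
    · intro x
      rw [End.mem_eigenspace_iff, ← rootExp_zero (orderOf p)]
      exact eigenProj_mem hN hp 0 x
    · intro x hx
      apply eigenProj_of_mem hN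
      rw [rootExp_zero]
      exact End.mem_eigenspace_iff.1 hx
  exact trace_eq_trace_mul_of_isProj hP fun k => (coe_eigenRep_apply p 1 q k).symm

theorem trace_eigenRep_one_eq_zero (p : Equiv.Perm D) (q : Subgroup.centralizer {p})
    (h : ∀ (i : ℕ) (d : D), (q : Equiv.Perm D) ((p ^ i) d) ≠ d) :
    LinearMap.trace ℂ _ (eigenRep p 1 q) = 0 := by
  classical
  rw [trace_eigenRep_one, eigenProj, mul_smul_comm, map_smul, Finset.mul_sum, map_sum,
    Finset.sum_eq_zero, smul_zero]
  intro i _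
  rw [mul_smul_comm, map_smul, ← map_pow, ← map_mul, trace_permRep, Finset.filter_false_of_mem]
  · simp
  · intro d _
    exact h i d

end FixedVectors

section Lefschetz

open Module Complex

namespace SurfaceAction

variable {G : Type u} [Group G] (S : SurfaceAction G)

/-- An element of `G`, as an element of the centralizer of a permutation commuting with `G`. -/
def actCentral {p : Equiv.Perm S.Dart} (hp : ∀ g d, S.act g (p d) = p (S.act g d)) (g : G) :
    Subgroup.centralizer {p} :=
  ⟨S.act g, Subgroup.mem_centralizer_singleton_iff.2 (by
    ext d
    exact hp g d)⟩

/-- Functions invariant under `next` and `rev` are constant: the surface is connected. -/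
theorem apply_eq_of_invariant {X : Type*} (x : S.Dart → X) (h1 : ∀ d, x (S.next d) = x d)
    (h2 : ∀ d, x (S.rev d) = x d) (d d' : S.Dart) : x d = x d' := by
  obtain ⟨p, hp, rfl⟩ := S.connected d d'
  induction hp using Subgroup.closure_induction generalizing d with
  | mem p hp =>
    rcases hp with rfl | rfl
    · exact (h1 d).symm
    · exact (h2 d).symm
  | one => rfl
  | mul p q _ _ hp hq => rw [Equiv.Perm.mul_apply, ← hp, ← hq]
  | inv p _ hp =>
    rw [hp (p⁻¹ d)]
    congr 1
    exact (p.apply_symm_apply d).symm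

theorem mem_eigenspace_permRep_one (p : Equiv.Perm S.Dart) (x : EuclideanSpace ℂ S.Dart) :
    x ∈ End.eigenspace (permRep S.Dart p) 1 ↔ ∀ d, x (p d) = x d := by
  rw [End.mem_eigenspace_iff, one_smul, PiLp.ext_iff]
  constructor
  · intro h d
    rw [← h (p d), permRep_apply]
    exact congrArg _ (p.symm_apply_apply d)
  · intro h d
    rw [permRep_apply, ← h (p⁻¹ d)]
    exact congrArg _ (p.apply_symm_apply d)

/-- The cycles are the orthogonal complement of the functions which are sums of a function on the
vertices and a function on the (unoriented) edges. -/
theorem orthogonal_complexCycles :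
    (End.eigenspace (permRep S.Dart S.rev) 1 ⊔ End.eigenspace (permRep S.Dart S.next) 1)ᗮ
      = S.complexCycles := by
  rw [← Submodule.inf_orthogonal]
  ext x
  have h3 : S.next ^ 3 = 1 := by
    ext d
    exact S.next_next_next d
  have h2 : S.rev ^ 2 = 1 := by
    ext d
    exact S.rev_rev d
  rw [Submodule.mem_inf, mem_orthogonal_eigenspace_one (inner_permRep _) two_ne_zero
    (by rw [← map_pow, h2, map_one]), mem_orthogonal_eigenspace_one (inner_permRep _) three_ne_zero
    (by rw [← map_pow, h3, map_one])]
  have hn : ∀ d, S.next⁻¹ d = S.next (S.next d) := fun d => by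
    rw [Equiv.Perm.inv_eq_iff_eq, S.next_next_next]
  apply and_congr
  · rw [PiLp.ext_iff]
    apply forall_congr'
    intro d
    simp only [Finset.sum_range_succ, Finset.sum_range_zero, zero_add, pow_zero, pow_one,
      PiLp.add_apply, permRep_apply, rev_inv, PiLp.zero_apply, Module.End.one_apply]
    rw [eq_neg_iff_add_eq_zero, add_comm]
  · rw [PiLp.ext_iff]
    apply forall_congr'
    intro d
    simp only [Finset.sum_range_succ, Finset.sum_range_zero, zero_add, pow_zero, pow_one,
      PiLp.add_apply, permRep_apply, hn, PiLp.zero_apply, Module.End.one_apply, pow_two,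
      Module.End.mul_apply, S.next_next_next]
    rw [add_right_comm]

/-- The trace of `g ≠ 1` on the space of complex cycles. -/
theorem trace_complexCycleRep {g : G} (hg : g ≠ 1) :
    LinearMap.trace ℂ _ (S.complexCycleRep g) = 1 := by
  set R := permRep S.Dart (S.act g) with hR
  have hRfix : ∀ {p : Equiv.Perm S.Dart}, (∀ g d, S.act g (p d) = p (S.act g d)) →
      ∀ x ∈ End.eigenspace (permRep S.Dart p) 1, R x ∈ End.eigenspace (permRep S.Dart p) 1 :=
    fun hp x hx => (eigenRep _ 1 (S.actCentral hp g) ⟨x, hx⟩).2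
  have hrev := hRfix S.act_rev
  have hnext := hRfix S.act_next
  set L := End.eigenspace (permRep S.Dart S.rev) 1 with hL
  set M := End.eigenspace (permRep S.Dart S.next) 1 with hM
  have hT : ∀ x ∈ L ⊔ M, R x ∈ L ⊔ M := by
    intro x hx
    obtain ⟨a, ha, b, hb, rfl⟩ := Submodule.mem_sup.1 hx
    rw [map_add]
    exact Submodule.add_mem_sup (hrev a ha) (hnext b hb)
  have hL0 : LinearMap.trace ℂ L (R.restrict hrev) = 0 := by
    refine trace_eigenRep_one_eq_zero S.rev (S.actCentral S.act_rev g) ?_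
    exact S.iterate_rev_ne hg
  have hM0 : LinearMap.trace ℂ M (R.restrict hnext) = 0 := by
    refine trace_eigenRep_one_eq_zero S.next (S.actCentral S.act_next g) ?_
    intro i d
    have h2 : S.next⁻¹ ^ 2 = S.next := by
      ext d
      rw [inv_pow, Equiv.Perm.inv_eq_iff_eq]
      exact (S.next_next_next d).symm
    have := S.iterate_next_ne hg (2 * i) d
    rwa [pow_mul, h2] at this
  have hC0 : LinearMap.trace ℂ _ R = 0 := by
    classical
    rw [trace_permRep, Finset.filter_false_of_mem]
    · simp
    · exact fun d _ => (S.free_edge g hg d).1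
  -- functions on the vertices and functions on the edges have only the constants in common
  have hconst : ∀ (c : ℂ) (p : Equiv.Perm S.Dart),
      WithLp.toLp 2 (fun _ : S.Dart => c) ∈ End.eigenspace (permRep S.Dart p) 1 :=
    fun c p => (S.mem_eigenspace_permRep_one p _).2 fun _ => rfl
  let i : ℂ →ₗ[ℂ] L × M :=
    { toFun := fun c => (⟨WithLp.toLp 2 fun _ => c, hconst c _⟩,
        ⟨WithLp.toLp 2 fun _ => c, hconst c _⟩)
      map_add' := fun _ _ => rfl
      map_smul' := fun _ _ => rfl }
  let q : L × M →ₗ[ℂ] (L ⊔ M : Submodule ℂ (EuclideanSpace ℂ S.Dart)) :=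
    { toFun := fun x => ⟨(x.1 : EuclideanSpace ℂ S.Dart) - x.2,
        Submodule.sub_mem _ (Submodule.mem_sup_left x.1.2) (Submodule.mem_sup_right x.2.2)⟩
      map_add' := fun x y => by
        ext : 1
        simp only [Prod.fst_add, Prod.snd_add, Submodule.coe_add]
        abel
      map_smul' := fun c x => by
        ext : 1
        simp only [Prod.smul_fst, Prod.smul_snd, Submodule.coe_smul, RingHom.id_apply, smul_sub] }
  obtain ⟨d₀⟩ := S.nonemptyDart
  have h1 : LinearMap.trace ℂ _ (LinearMap.prodMap (R.restrict hrev) (R.restrict hnext))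
      = LinearMap.trace ℂ ℂ LinearMap.id + LinearMap.trace ℂ _ (R.restrict hT) := by
    apply trace_eq_add_of_exact i q
    · intro c c' h
      exact congrArg (fun x : L × M => (x.1 : EuclideanSpace ℂ S.Dart) d₀) h
    · rintro ⟨x, hx⟩
      obtain ⟨a, ha, b, hb, rfl⟩ := Submodule.mem_sup.1 hx
      refine ⟨(⟨a, ha⟩, -⟨b, hb⟩), ?_⟩
      ext : 1
      simp [q]
    · rintro ⟨⟨a, ha⟩, ⟨b, hb⟩⟩
      constructor
      · intro h
        have hab : a = b := sub_eq_zero.1 (congrArg Subtype.val h)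
        subst hab
        have hc := S.apply_eq_of_invariant (fun d => a d)
          ((S.mem_eigenspace_permRep_one _ _).1 hb) ((S.mem_eigenspace_permRep_one _ _).1 ha)
        refine ⟨a d₀, ?_⟩
        have : WithLp.toLp 2 (fun _ => a d₀) = a := by
          ext d
          exact hc d₀ d
        exact Prod.ext (Subtype.ext this) (Subtype.ext this)
      · rintro ⟨c, hc⟩
        rw [← hc]
        ext : 1
        exact sub_self _
    · intro c
      rfl
    · intro x
      ext : 1
      exact map_sub R _ _
  have hcompl := Submodule.isCompl_orthogonal
    (K := (L ⊔ M : Submodule ℂ (EuclideanSpace ℂ S.Dart)))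
  have horth := S.orthogonal_complexCycles
  rw [← hL, ← hM] at horth
  rw [horth] at hcompl
  have h2 : LinearMap.trace ℂ _ R
      = LinearMap.trace ℂ _ (R.restrict hT) + LinearMap.trace ℂ _ (S.complexCycleRep g) := by
    have h3 := LinearMap.trace_prodMap' (R.restrict hT) (S.complexCycleRep g)
    rw [← h3, ← LinearMap.trace_conj' _ (Submodule.prodEquivOfIsCompl _ _ hcompl)]
    congr 1
    apply LinearMap.ext
    intro x
    obtain ⟨⟨y, z⟩, rfl⟩ := (Submodule.prodEquivOfIsCompl _ _ hcompl).surjective x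
    rw [LinearEquiv.conj_apply_apply, LinearEquiv.symm_apply_apply]
    simp only [Submodule.coe_prodEquivOfIsCompl', map_add]
    rfl
  rw [LinearMap.trace_prodMap', hL0, hM0] at h1
  rw [hC0] at h2
  have h4 : LinearMap.trace ℂ ℂ LinearMap.id = 1 := by
    rw [LinearMap.trace_id]
    simp
  rw [h4] at h1
  linear_combination -h2 + h1

/-- The boundary map from the 2-chains to the complex cycles. -/
noncomputable def complexBoundary :
    End.eigenspace (permRep S.Dart S.faceNext) 1 →ₗ[ℂ] S.complexCycles :=
  (((LinearMap.id - permRep S.Dart S.rev) ∘ₗ Submodule.subtype _)).codRestrict _ (by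
    rintro ⟨u, hu⟩
    have hu' := (S.mem_eigenspace_permRep_one _ _).1 hu
    have hr : ∀ d, u (S.rev d) = u (S.next (S.next d)) := by
      intro d
      have h1 : S.next (S.next d) = S.faceNext (S.rev d) := by
        rw [faceNext, Equiv.trans_apply, S.rev_rev, Equiv.eq_symm_apply, S.next_next_next]
      rw [h1, hu']
    constructor
    · intro d
      change u (S.rev d) - u (S.rev⁻¹ (S.rev d)) = -(u d - u (S.rev⁻¹ d))
      rw [rev_inv, S.rev_rev]
      ring
    · intro d
      change (u d - u (S.rev⁻¹ d)) + (u (S.next d) - u (S.rev⁻¹ (S.next d)))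
        + (u (S.next (S.next d)) - u (S.rev⁻¹ (S.next (S.next d)))) = 0
      simp only [rev_inv, hr, S.next_next_next]
      ring)

theorem complexBoundary_apply (u : End.eigenspace (permRep S.Dart S.faceNext) 1) (d : S.Dart) :
    (S.complexBoundary u : EuclideanSpace ℂ S.Dart) d
      = (u : EuclideanSpace ℂ S.Dart) d - (u : EuclideanSpace ℂ S.Dart) (S.rev d) := by
  change _ - (u : EuclideanSpace ℂ S.Dart) (S.rev⁻¹ d) = _
  rw [rev_inv]
  rfl

theorem mem_range_complexBoundary (z : S.complexCycles) :
    z ∈ LinearMap.range S.complexBoundary ↔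
      S.reCycle z ∈ S.boundaries ∧ S.imCycle z ∈ S.boundaries := by
  constructor
  · rintro ⟨u, rfl⟩
    have hu := (S.mem_eigenspace_permRep_one _ _).1 u.2
    constructor
    · refine ⟨fun d => ((u : EuclideanSpace ℂ S.Dart) d).re, fun d => congrArg re (hu d),
        fun d => ?_⟩
      rw [reCycle_apply, complexBoundary_apply, sub_re]
    · refine ⟨fun d => ((u : EuclideanSpace ℂ S.Dart) d).im, fun d => congrArg im (hu d),
        fun d => ?_⟩
      rw [imCycle_apply, complexBoundary_apply, sub_im]
  · rintro ⟨⟨u, hu, hz⟩, ⟨v, hv, hz'⟩⟩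
    refine ⟨⟨WithLp.toLp 2 fun d => ⟨u d, v d⟩,
      (S.mem_eigenspace_permRep_one _ _).2 fun d => ?_⟩, ?_⟩
    · change (⟨u _, v _⟩ : ℂ) = ⟨u d, v d⟩
      rw [hu, hv]
    · ext d
      rw [complexBoundary_apply]
      exact Complex.ext (hz d).symm (hz' d).symm

theorem complexCycleRep_complexBoundary (g : G)
    (u : End.eigenspace (permRep S.Dart S.faceNext) 1) :
    S.complexCycleRep g (S.complexBoundary u)
      = S.complexBoundary (eigenRep S.faceNext 1 (S.actCentral S.act_faceNext g) u) := by
  ext d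
  rw [complexBoundary_apply, coe_complexCycleRep, permRep_apply, complexBoundary_apply]
  change _ = (u : EuclideanSpace ℂ S.Dart) ((S.act g)⁻¹ d)
    - (u : EuclideanSpace ℂ S.Dart) ((S.act g)⁻¹ (S.rev d))
  rw [← map_inv, S.act_rev]

/-- The trace of `g` on the complex boundaries. -/
theorem trace_range_complexBoundary (g : G) (h : ∀ x ∈ LinearMap.range S.complexBoundary,
      S.complexCycleRep g x ∈ LinearMap.range S.complexBoundary) :
    LinearMap.trace ℂ _ ((S.complexCycleRep g).restrict h)
      = cycleSum (S.act g) S.faceNext (fun _ _ => 1) - 1 := by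
  let i : ℂ →ₗ[ℂ] End.eigenspace (permRep S.Dart S.faceNext) 1 :=
    { toFun := fun c => ⟨WithLp.toLp 2 fun _ => c,
        (S.mem_eigenspace_permRep_one _ _).2 fun _ => rfl⟩
      map_add' := fun _ _ => rfl
      map_smul' := fun _ _ => rfl }
  obtain ⟨d₀⟩ := S.nonemptyDart
  have h1 : LinearMap.trace ℂ _ (eigenRep S.faceNext 1 (S.actCentral S.act_faceNext g))
      = LinearMap.trace ℂ ℂ LinearMap.id
        + LinearMap.trace ℂ _ ((S.complexCycleRep g).restrict h) := by
    apply trace_eq_add_of_exact i S.complexBoundary.rangeRestrict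
    · intro c c' h
      exact congrArg (fun x : End.eigenspace (permRep S.Dart S.faceNext) 1 =>
        (x : EuclideanSpace ℂ S.Dart) d₀) h
    · exact S.complexBoundary.surjective_rangeRestrict
    · intro u
      have hu := (S.mem_eigenspace_permRep_one _ _).1 u.2
      constructor
      · intro h0
        have h2 : ∀ d, (u : EuclideanSpace ℂ S.Dart) (S.rev d)
            = (u : EuclideanSpace ℂ S.Dart) d := by
          intro d
          have h3 : S.complexBoundary u = 0 := congrArg Subtype.val h0
          have := S.complexBoundary_apply u d
          rw [h3] at this
          exact (sub_eq_zero.1 this.symm).symm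
        have h4 : ∀ d, (u : EuclideanSpace ℂ S.Dart) (S.next d)
            = (u : EuclideanSpace ℂ S.Dart) d := by
          intro d
          have h5 : S.faceNext (S.rev (S.next d)) = d := by
            rw [faceNext, Equiv.trans_apply, S.rev_rev, Equiv.symm_apply_apply]
          rw [← h2 (S.next d), ← hu (S.rev (S.next d)), h5]
        refine ⟨(u : EuclideanSpace ℂ S.Dart) d₀, ?_⟩
        ext d
        exact S.apply_eq_of_invariant (fun d => (u : EuclideanSpace ℂ S.Dart) d) h4 h2 d₀ d
      · rintro ⟨c, rfl⟩
        ext d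
        exact (S.complexBoundary_apply (i c) d).trans (sub_self c)
    · intro c
      rfl
    · intro u
      exact Subtype.ext (S.complexCycleRep_complexBoundary g u).symm
  have h2 : LinearMap.trace ℂ ℂ LinearMap.id = 1 := by
    rw [LinearMap.trace_id]
    simp
  rw [trace_eigenRep_one, trace_mul_eigenProj_zero, h2] at h1
  · rw [eq_sub_iff_add_eq, add_comm]
    exact h1.symm
  · exact Equiv.ext fun d => S.act_faceNext g d

variable {n : ℕ}

/-- Complex conjugation of the coordinates. -/
def conjVec (v : EuclideanSpace ℂ (Fin n)) : EuclideanSpace ℂ (Fin n) :=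
  WithLp.toLp 2 fun k => (starRingEnd ℂ) (v k)

theorem conjVec_conjVec (v : EuclideanSpace ℂ (Fin n)) : conjVec (conjVec v) = v := by
  ext k
  simp [conjVec]

theorem conjVec_add (v w : EuclideanSpace ℂ (Fin n)) :
    conjVec (v + w) = conjVec v + conjVec w := by
  ext k
  simp [conjVec]

theorem conjVec_smul (c : ℂ) (v : EuclideanSpace ℂ (Fin n)) :
    conjVec (c • v) = (starRingEnd ℂ) c • conjVec v := by
  ext k
  simp [conjVec]

/-- The complex conjugate of a linear operator. -/
def conjEnd (r : End ℂ (EuclideanSpace ℂ (Fin n))) : End ℂ (EuclideanSpace ℂ (Fin n)) where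
  toFun v := conjVec (r (conjVec v))
  map_add' v w := by rw [conjVec_add, map_add, conjVec_add]
  map_smul' c v := by rw [conjVec_smul, map_smul, conjVec_smul, Complex.conj_conj]; rfl

theorem trace_conjEnd (r : End ℂ (EuclideanSpace ℂ (Fin n))) :
    LinearMap.trace ℂ _ (conjEnd r) = (starRingEnd ℂ) (LinearMap.trace ℂ _ r) := by
  rw [LinearMap.trace_eq_matrix_trace ℂ (EuclideanSpace.basisFun (Fin n) ℂ).toBasis,
    LinearMap.trace_eq_matrix_trace ℂ (EuclideanSpace.basisFun (Fin n) ℂ).toBasis, Matrix.trace,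
    Matrix.trace, map_sum]
  refine Finset.sum_congr rfl fun k _ => ?_
  rw [Matrix.diag_apply, LinearMap.toMatrix_apply, Matrix.diag_apply, LinearMap.toMatrix_apply]
  simp only [OrthonormalBasis.coe_toBasis, OrthonormalBasis.coe_toBasis_repr_apply,
    EuclideanSpace.basisFun_repr, EuclideanSpace.basisFun_apply]
  have h : conjVec (EuclideanSpace.single k (1 : ℂ)) = EuclideanSpace.single k 1 := by
    ext l
    by_cases hl : l = k
    · subst hl
      simp [conjVec]
    · simp [conjVec, hl]
  change (starRingEnd ℂ) (r (conjVec _) k) = _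
  rw [h]

/-- The Lefschetz fixed point formula: the real part of the character of the unitary
representation on the homology is given by the number of faces mapped to themselves. -/
theorem trace_add_conj_trace {e : S.H1 ≃ₗ[ℝ] EuclideanSpace ℂ (Fin n)} {g : G}
    {r : End ℂ (EuclideanSpace ℂ (Fin n))}
    (he : ∀ x, e (S.homologyRep g x) = r (e x)) (hg : g ≠ 1) :
    LinearMap.trace ℂ _ r + (starRingEnd ℂ) (LinearMap.trace ℂ _ r)
      = 2 - cycleSum (S.act g) S.faceNext (fun _ _ => 1) := by
  have hB : ∀ x ∈ LinearMap.range S.complexBoundary,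
      S.complexCycleRep g x ∈ LinearMap.range S.complexBoundary := by
    rintro _ ⟨u, rfl⟩
    rw [complexCycleRep_complexBoundary]
    exact ⟨_, rfl⟩
  let P := S.cyclePeriod (e : S.H1 →ₗ[ℝ] EuclideanSpace ℂ (Fin n))
  have hP : ∀ z, P z
      = e (S.boundaries.mkQ (S.reCycle z)) + I • e (S.boundaries.mkQ (S.imCycle z)) :=
    fun z => S.cyclePeriod_apply _ z
  have hPc : ∀ z, P (S.conjCycle z)
      = e (S.boundaries.mkQ (S.reCycle z)) - I • e (S.boundaries.mkQ (S.imCycle z)) :=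
    fun z => S.cyclePeriod_conjCycle _ z
  have hPg : ∀ z, P (S.complexCycleRep g z) = r (P z) :=
    fun z => S.cyclePeriod_complexCycleRep (e := (e : S.H1 →ₗ[ℝ] EuclideanSpace ℂ (Fin n))) he z
  let q : S.complexCycles →ₗ[ℂ] EuclideanSpace ℂ (Fin n) × EuclideanSpace ℂ (Fin n) :=
    { toFun := fun z => (P z, conjVec (P (S.conjCycle z)))
      map_add' := fun z w => by rw [map_add, conjCycle_add, map_add, conjVec_add]; rfl
      map_smul' := fun c z => by
        rw [map_smul, conjCycle_smul, map_smul, conjVec_smul, Complex.conj_conj]; rfl }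
  have h1 : LinearMap.trace ℂ _ (S.complexCycleRep g)
      = LinearMap.trace ℂ _ ((S.complexCycleRep g).restrict hB)
        + LinearMap.trace ℂ _ (LinearMap.prodMap r (conjEnd r)) := by
    apply trace_eq_add_of_exact (Submodule.subtype _) q
    · exact Subtype.val_injective
    · rintro ⟨u, v⟩
      obtain ⟨z, -, hz1, hz2⟩ := S.exists_eigencycle (e := e) (g := 1) (r := 1)
        (fun x => by simp) one_ne_zero (one_pow 1) 0 (u := u) (v := conjVec v)
        (by simp [rootExp_zero]) (by simp [rootExp_zero])
      exact ⟨z, Prod.ext hz1 ((congrArg conjVec hz2).trans (conjVec_conjVec v))⟩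
    · intro z
      have h2 : q z = 0 ↔ P z = 0 ∧ P (S.conjCycle z) = 0 := by
        rw [Prod.ext_iff]
        refine and_congr Iff.rfl ⟨fun h => ?_, fun h => ?_⟩
        · rw [← conjVec_conjVec (P (S.conjCycle z))]
          change conjVec (q z).2 = 0
          rw [h]
          ext k
          simp [conjVec]
        · change conjVec (P (S.conjCycle z)) = 0
          rw [h]
          ext k
          simp [conjVec]
      have h3 : (∃ k : LinearMap.range S.complexBoundary, (Submodule.subtype _) k = z)
          ↔ z ∈ LinearMap.range S.complexBoundary := by
        constructor
        · rintro ⟨k, rfl⟩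
          exact k.2
        · intro h
          exact ⟨⟨z, h⟩, rfl⟩
      have h4 : ∀ x : S.cycles, e (S.boundaries.mkQ x) = 0 ↔ x ∈ S.boundaries := by
        intro x
        rw [LinearEquiv.map_eq_zero_iff, Submodule.mkQ_apply, Submodule.Quotient.mk_eq_zero]
      rw [h2, h3, mem_range_complexBoundary, hP, hPc, ← h4, ← h4]
      constructor
      · rintro ⟨ha, hb⟩
        have h5 := sub_eq_zero.1 hb
        rw [← h5] at ha
        have h6 : e (S.boundaries.mkQ (S.reCycle z)) = 0 := by
          rw [← two_smul ℂ] at ha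
          exact (smul_eq_zero.1 ha).resolve_left two_ne_zero
        rw [h6] at h5
        exact ⟨h6, (smul_eq_zero.1 h5.symm).resolve_left I_ne_zero⟩
      · rintro ⟨ha, hb⟩
        rw [ha, hb, smul_zero, add_zero, sub_zero]
        exact ⟨rfl, rfl⟩
    · intro k
      rfl
    · intro z
      refine Prod.ext (hPg z) ?_
      change conjVec (P (S.conjCycle _)) = conjVec (r (conjVec (conjVec _)))
      rw [conjVec_conjVec, conjCycle_complexCycleRep, hPg]
  rw [S.trace_complexCycleRep hg, trace_range_complexBoundary, LinearMap.trace_prodMap',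
    trace_conjEnd] at h1
  linear_combination -h1

/-- The holomorphic Lefschetz formula for the unitary representation on the homology. -/
theorem trace_eq_one_add_cycleSum {e : S.H1 ≃ₗ[ℝ] EuclideanSpace ℂ (Fin n)} {g : G}
    {r : End ℂ (EuclideanSpace ℂ (Fin n))}
    (hi : ∀ x y, (inner ℂ (e x) (e y)).im = S.intersection x y)
    (he : ∀ x, e (S.homologyRep g x) = r (e x)) {N : ℕ} (hN : N ≠ 0) (hgN : g ^ N = 1)
    (hr : r ^ N = 1) (hg : g ≠ 1) :
    LinearMap.trace ℂ _ r = 1 + cycleSum (S.act g) S.faceNext kappa := by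
  classical
  have hcomm : Commute (S.act g) S.faceNext := Equiv.ext fun d => S.act_faceNext g d
  have h1 := S.trace_sub_conj_trace hi he hN hgN hr hg
  have h2 := S.trace_add_conj_trace he hg
  rw [coincidence_eq_cycleSum _ _ hcomm] at h1
  have h3 : cycleSum (S.act g) S.faceNext
      (fun n m => ∑ b ∈ Finset.range n, (saw (b / n) : ℂ) * rootExp n m ^ b)
      = 2 * cycleSum (S.act g) S.faceNext kappa + cycleSum (S.act g) S.faceNext (fun _ _ => 1) := by
    simp only [cycleSum, Finset.mul_sum, ← Finset.sum_add_distrib]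
    refine Finset.sum_congr rfl fun d _ => Finset.sum_congr rfl fun m hm => ?_
    split_ifs with h
    · rw [sum_saw_mul_rootExp]
      · ring
      · apply rootExp_ne_one _ (Finset.mem_range.1 hm)
        apply Nat.pos_of_ne_zero
        rintro rfl
        exact (S.free_edge g hg d).1 h
    · ring
  rw [h3] at h1
  linear_combination (1 / 2 : ℂ) * h1 + (1 / 2 : ℂ) * h2

end SurfaceAction

end Lefschetz

/-! ### The contributions of the singular orbits -/

section ConeCharacter

variable {G : Type u} [Group G] [Fintype G]

open Classical in
/-- The contribution of a singular orbit with rotation `γ` to the character of the unitary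
representation: the class function induced from the function `γ ^ k ↦ kappa ν k` on the cyclic
group generated by `γ`, where `ν` is the order of `γ`. -/
noncomputable def coneCharacter (γ g : G) : ℂ :=
  (orderOf γ : ℂ)⁻¹ * ∑ h : G, ∑ k ∈ Finset.range (orderOf γ),
    if h⁻¹ * g * h = γ ^ k then kappa (orderOf γ) k else 0

theorem coneCharacter_conj (γ c : G) : coneCharacter (c * γ * c⁻¹) = coneCharacter γ := by
  classical
  ext g
  have ho : orderOf (c * γ * c⁻¹) = orderOf γ := by
    rw [← MulAut.conj_apply]
    exact MulEquiv.orderOf_eq (MulAut.conj c) γ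
  rw [coneCharacter, coneCharacter, ho]
  congr 1
  rw [← Equiv.sum_comp (Equiv.mulRight c⁻¹)]
  refine Finset.sum_congr rfl fun h _ => Finset.sum_congr rfl fun k _ => ?_
  congr 1
  rw [conj_pow, Equiv.coe_mulRight, eq_iff_iff, mul_inv_rev, inv_inv]
  constructor
  · intro e
    have : c⁻¹ * (c * h⁻¹ * g * (h * c⁻¹)) * c = c⁻¹ * (c * γ ^ k * c⁻¹) * c := by rw [e]
    simpa [mul_assoc] using this
  · intro e
    rw [← e]
    group

/-- The contribution of a singular orbit, in terms of the conjugacy class of the rotations. -/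
noncomputable def classCharacter : ConjClasses G → G → ℂ :=
  Quotient.lift coneCharacter (by
    intro a b h
    obtain ⟨c, hc⟩ := isConj_iff.1 h
    rw [← hc, coneCharacter_conj])

theorem classCharacter_mk (γ : G) : classCharacter (ConjClasses.mk γ) = coneCharacter γ := rfl

theorem coneCharacter_one : coneCharacter (1 : G) = 0 := by
  ext g
  simp [coneCharacter, kappa]

theorem sum_kappa {n : ℕ} (hn : n ≠ 0) : ∑ k ∈ Finset.range n, kappa n k = 0 := by
  simp only [kappa]
  rw [Finset.sum_comm]
  refine Finset.sum_eq_zero fun a ha => ?_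
  rw [← Finset.mul_sum]
  rcases Nat.eq_zero_or_pos a with rfl | h0
  · simp
  · have h1 : ∀ k ∈ Finset.range n, (rootExp n k)⁻¹ ^ a = rootExp n (n - a) ^ k := by
      intro k _
      rw [rootExp_self_sub hn (Finset.mem_range.1 ha).le, inv_pow, inv_pow, ← rootExp_pow_mul,
        ← rootExp_pow_mul, mul_comm]
    rw [Finset.sum_congr rfl h1, sum_rootExp_pow hn, if_neg, mul_zero]
    intro h
    have := Nat.le_of_dvd (by have := Finset.mem_range.1 ha; omega) h
    omega

theorem sum_coneCharacter (γ : G) : ∑ g, coneCharacter γ g = 0 := by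
  classical
  simp only [coneCharacter]
  rw [← Finset.mul_sum, Finset.sum_comm, Finset.sum_eq_zero, mul_zero]
  intro h _
  rw [Finset.sum_comm]
  refine Eq.trans ?_ (sum_kappa (orderOf_pos γ).ne')
  refine Finset.sum_congr rfl fun k _ => ?_
  rw [← Equiv.sum_comp (MulAut.conj h).toEquiv]
  have : ∀ g, h⁻¹ * ((MulAut.conj h).toEquiv g) * h = g := by
    intro g
    change h⁻¹ * (h * g * h⁻¹) * h = g
    group
  simp only [this]
  rw [Finset.sum_ite_eq' , if_pos (Finset.mem_univ _)]

end ConeCharacter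

namespace SurfaceAction

variable {G : Type u} [Group G] (S : SurfaceAction G)

theorem rotationStep_pos (d : S.Dart) : 0 < S.rotationStep d := by
  classical
  exact (Nat.find_spec (S.exists_rotation d)).1

theorem rotationStep_le {d : S.Dart} {k : ℕ} (hk : 0 < k) {g : G}
    (h : S.act g d = S.faceNext^[k] d) : S.rotationStep d ≤ k := by
  classical
  exact Nat.find_min' _ ⟨hk, g, h⟩

theorem act_rotation_pow (d : S.Dart) (k : ℕ) :
    S.act (S.rotation d ^ k) d = S.faceNext^[S.rotationStep d * k] d := by
  induction k with
  | zero => simp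
  | succ k ih =>
    rw [pow_succ, map_mul, Equiv.Perm.mul_apply, S.act_rotation, S.act_faceNext_iterate, ih,
      ← Function.iterate_add_apply, mul_add, mul_one, add_comm]

/-- The elements of `G` that map a face to itself are the powers of the rotation. -/
theorem eq_rotation_pow {d : S.Dart} {g : G} {m : ℕ} (h : S.act g d = S.faceNext^[m] d) :
    S.rotationStep d ∣ m ∧ g = S.rotation d ^ (m / S.rotationStep d) := by
  set s := S.rotationStep d with hs
  have h1 : S.act ((S.rotation d ^ (m / s))⁻¹ * g) d = S.faceNext^[m % s] d := by
    rw [map_mul, Equiv.Perm.mul_apply, h, ← Nat.mod_add_div m s, Function.iterate_add_apply,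
      ← S.act_rotation_pow, S.act_faceNext_iterate, Nat.mod_add_div, ← Equiv.Perm.mul_apply,
      ← map_mul, inv_mul_cancel, map_one]
    rfl
  have h2 : m % s = 0 := by
    by_contra h0
    have h3 := S.rotationStep_le (Nat.pos_of_ne_zero h0) h1
    exact absurd (Nat.mod_lt m (S.rotationStep_pos d)) (not_lt.2 h3)
  refine ⟨Nat.dvd_of_mod_eq_zero h2, ?_⟩
  rw [h2] at h1
  have h4 : S.act ((S.rotation d ^ (m / s))⁻¹ * g) d = S.act 1 d := by
    rw [h1, map_one]
    rfl
  exact (inv_mul_eq_one.1 (S.act_injective h4)).symm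

theorem minimalPeriod_faceNext [Finite G] (d : S.Dart) : Function.minimalPeriod S.faceNext d
    = S.rotationStep d * orderOf (S.rotation d) := by
  apply Nat.dvd_antisymm
  · rw [← Function.isPeriodicPt_iff_minimalPeriod_dvd, Function.IsPeriodicPt,
      Function.IsFixedPt, ← S.act_rotation_pow, pow_orderOf_eq_one, map_one]
    rfl
  · have h1 : S.act 1 d = S.faceNext^[Function.minimalPeriod S.faceNext d] d := by
      rw [Function.iterate_minimalPeriod, map_one]
      rfl
    obtain ⟨h2, h3⟩ := S.eq_rotation_pow h1
    calc _ ∣ S.rotationStep d * (Function.minimalPeriod S.faceNext d / S.rotationStep d) :=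
          mul_dvd_mul_left _ (orderOf_dvd_of_pow_eq_one h3.symm)
      _ = _ := Nat.mul_div_cancel' h2

open Classical in
/-- The contribution of a dart to the Lefschetz formula. -/
theorem sum_faceNext_kappa [Finite G] {g : G} (hg : g ≠ 1) (d : S.Dart) :
    (∑ m ∈ Finset.range (Function.minimalPeriod S.faceNext d),
      if S.act g d = (S.faceNext ^ m) d then kappa (Function.minimalPeriod S.faceNext d) m
        / Function.minimalPeriod S.faceNext d else 0)
      = (S.rotationStep d : ℂ)⁻¹ * ((orderOf (S.rotation d) : ℂ)⁻¹ *
        ∑ k ∈ Finset.range (orderOf (S.rotation d)),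
          if g = S.rotation d ^ k then kappa (orderOf (S.rotation d)) k else 0) := by
  set s := S.rotationStep d with hs
  set ν := orderOf (S.rotation d) with hν
  have hs0 : 0 < s := S.rotationStep_pos d
  have hν0 : 0 < ν := orderOf_pos _
  rw [S.minimalPeriod_faceNext, ← hs, ← hν, Finset.mul_sum, Finset.mul_sum]
  symm
  refine Finset.sum_of_injOn (fun k => s * k) ?_ ?_ ?_ ?_
  · intro a _ b _ h
    exact Nat.eq_of_mul_eq_mul_left hs0 h
  · intro k hk
    simp only [Finset.coe_range, Set.mem_Iio] at hk ⊢
    exact Nat.mul_lt_mul_of_pos_left hk hs0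
  · intro m hm hm'
    rw [if_neg]
    intro h
    rw [← Equiv.Perm.iterate_eq_pow] at h
    obtain ⟨⟨k, rfl⟩, -⟩ := S.eq_rotation_pow h
    apply hm'
    refine ⟨k, ?_, rfl⟩
    simp only [Finset.coe_range, Set.mem_Iio]
    exact Nat.lt_of_mul_lt_mul_left (Finset.mem_range.1 hm)
  · intro k hk
    have h1 : S.act g d = (S.faceNext ^ (s * k)) d ↔ g = S.rotation d ^ k := by
      rw [← Equiv.Perm.iterate_eq_pow, hs, ← S.act_rotation_pow]
      exact ⟨fun h => S.act_injective h, fun h => by rw [h]⟩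
    simp only [h1]
    split_ifs with h
    · have hk0 : 0 < k := by
        apply Nat.pos_of_ne_zero
        rintro rfl
        exact hg (by rw [h, pow_zero])
      have h2 : rootExp (s * ν) (s * k) = rootExp ν k := by
        rw [mul_comm s k]
        exact rootExp_mul_right (mul_comm s ν) hs0.ne' k
      have h3 := rootExp_ne_one hk0 (Finset.mem_range.1 hk)
      rw [kappa_of_ne_one h3, kappa_of_ne_one (by rwa [h2]), h2, Nat.cast_mul]
      rw [div_eq_mul_inv, mul_inv]
      ring
    · simp

open Classical in
/-- A `G`-orbit of faces is parametrized by `G` and the steps of the rotation. -/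
theorem sum_faceOrbit {M : Type*} [AddCommMonoid M] [Fintype G] (f : S.Dart → M) (d₀ : S.Dart) :
    ∑ d with S.faceOrbitSetoid d₀ d, f d
      = ∑ h : G, ∑ j ∈ Finset.range (S.rotationStep d₀), f (S.act h (S.faceNext^[j] d₀)) := by
  rw [← Finset.sum_product' (f := fun h j => f (S.act h (S.faceNext^[j] d₀)))]
  symm
  set s := S.rotationStep d₀ with hs
  refine Finset.sum_nbij (fun x => S.act x.1 (S.faceNext^[x.2] d₀)) ?_ ?_ ?_ ?_
  · rintro ⟨h, j⟩ _
    exact Finset.mem_filter.2 ⟨Finset.mem_univ _, h, j, rfl⟩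
  · have key : ∀ (h h' : G) (i j : ℕ), i ≤ j → j < s →
        S.act h (S.faceNext^[i] d₀) = S.act h' (S.faceNext^[j] d₀) → h = h' ∧ i = j := by
      intro h h' i j hij hj e
      obtain ⟨k, rfl⟩ := Nat.exists_eq_add_of_le hij
      have e1 : S.faceNext^[i] (S.act (h'⁻¹ * h) d₀) = S.faceNext^[i] (S.faceNext^[k] d₀) := by
        rw [← S.act_faceNext_iterate, map_mul, Equiv.Perm.mul_apply, e, ← Equiv.Perm.mul_apply,
          ← map_mul, inv_mul_cancel, map_one, Function.iterate_add_apply]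
        rfl
      have e2 := (S.faceNext.injective.iterate i) e1
      have hk : k = 0 := by
        by_contra hk
        have := S.rotationStep_le (Nat.pos_of_ne_zero hk) e2
        omega
      subst hk
      have e3 : S.act (h'⁻¹ * h) d₀ = S.act 1 d₀ := by
        rw [e2, map_one]
        rfl
      exact ⟨(inv_mul_eq_one.1 (S.act_injective e3)).symm, rfl⟩
    rintro ⟨h, i⟩ hi ⟨h', j⟩ hj e
    simp only [Finset.coe_product, Finset.coe_univ, Finset.coe_range, Set.mem_prod, Set.mem_univ,
      Set.mem_Iio, true_and] at hi hj
    rcases le_total i j with hij | hij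
    · obtain ⟨rfl, rfl⟩ := key h h' i j hij hj e
      rfl
    · obtain ⟨rfl, rfl⟩ := key h' h j i hij hi e.symm
      rfl
  · intro d hd
    obtain ⟨-, h, m, rfl⟩ := Finset.mem_filter.1 hd
    refine ⟨(h * S.rotation d₀ ^ (m / s), m % s), ?_, ?_⟩
    · simp only [Finset.coe_product, Finset.coe_univ, Finset.coe_range, Set.mem_prod, Set.mem_univ,
        Set.mem_Iio, true_and]
      exact Nat.mod_lt _ (S.rotationStep_pos d₀)
    · change S.act _ (S.faceNext^[m % s] d₀) = _
      rw [map_mul, Equiv.Perm.mul_apply, S.act_faceNext_iterate, S.act_rotation_pow,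
        ← Function.iterate_add_apply, Nat.mod_add_div]
  · intro x _
    rfl

/-- The sum over the faces mapped to themselves by `g`, ordered by orbits: each orbit contributes
its `coneCharacter`. -/
theorem cycleSum_kappa [Fintype G] {g : G} (hg : g ≠ 1) :
    cycleSum (S.act g) S.faceNext kappa
      = ∑ o : S.FaceOrbit, classCharacter (S.rotationClass o) g := by
  classical
  simp only [cycleSum, S.sum_faceNext_kappa hg]
  rw [← Finset.sum_fiberwise (s := Finset.univ)
    (g := fun d => (Quotient.mk S.faceOrbitSetoid d : S.FaceOrbit))]
  refine Finset.sum_congr rfl fun o _ => ?_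
  induction o using Quotient.inductionOn with
  | _ d₀ =>
    have h1 : ∀ d, (Quotient.mk S.faceOrbitSetoid d : S.FaceOrbit)
        = Quotient.mk S.faceOrbitSetoid d₀ ↔ S.faceOrbitSetoid d₀ d :=
      fun d => eq_comm.trans Quotient.eq
    have h2 := S.sum_faceOrbit (fun d => (S.rotationStep d : ℂ)⁻¹ *
      ((orderOf (S.rotation d) : ℂ)⁻¹ * ∑ k ∈ Finset.range (orderOf (S.rotation d)),
          if g = S.rotation d ^ k then kappa (orderOf (S.rotation d)) k else 0)) d₀
    have hface : ∀ j, S.rotationStep (S.faceNext^[j] d₀) = S.rotationStep d₀ ∧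
        S.rotation (S.faceNext^[j] d₀) = S.rotation d₀ := by
      intro j
      induction j with
      | zero => exact ⟨rfl, rfl⟩
      | succ j ih =>
        rw [Function.iterate_succ_apply', S.rotationStep_faceNext, S.rotation_faceNext]
        exact ih
    have ho : ∀ c : G, orderOf (c * S.rotation d₀ * c⁻¹) = orderOf (S.rotation d₀) := fun c => by
      rw [← MulAut.conj_apply]
      exact MulEquiv.orderOf_eq (MulAut.conj c) _
    have hcj : ∀ (h : G) (k : ℕ), g = h * S.rotation d₀ ^ k * h⁻¹
        ↔ h⁻¹ * g * h = S.rotation d₀ ^ k := by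
      intro h k
      constructor
      · intro e
        rw [e]
        group
      · intro e
        rw [← e]
        group
    simp only [S.rotationStep_act, S.rotation_act, hface, ho, conj_pow, hcj, Finset.sum_const,
      Finset.card_range, nsmul_eq_mul] at h2
    have hs : (S.rotationStep d₀ : ℂ) ≠ 0 := by exact_mod_cast (S.rotationStep_pos d₀).ne'
    simp only [mul_inv_cancel_left₀ hs] at h2
    simp only [h1]
    refine h2.trans ?_
    rw [← Finset.mul_sum]
    rfl

theorem sum_orbitData {M : Type*} [AddCommMonoid M] (f : ConjClasses G → M)
    (h : f (ConjClasses.mk 1) = 0) :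
    (S.orbitData.map f).sum = ∑ o : S.FaceOrbit, f (S.rotationClass o) := by
  classical
  have h1 : ∀ m : Multiset (ConjClasses G),
      ((m.filter (fun c => c ≠ ConjClasses.mk 1)).map f).sum = (m.map f).sum := by
    intro m
    induction m using Multiset.induction_on with
    | empty => rfl
    | cons c m ih =>
      by_cases hc : c = ConjClasses.mk 1
      · rw [Multiset.filter_cons_of_neg (p := fun c => c ≠ ConjClasses.mk 1) _ (not_not.2 hc), ih,
          Multiset.map_cons, Multiset.sum_cons, hc, h, zero_add]
      · rw [Multiset.filter_cons_of_pos (p := fun c => c ≠ ConjClasses.mk 1) _ hc,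
          Multiset.map_cons, Multiset.sum_cons, ih, Multiset.map_cons, Multiset.sum_cons]
  rw [orbitData, h1, Multiset.map_map]
  rfl

open Classical in
/-- The Chevalley–Weil formula: the character of the unitary representation of an action is
determined by the singular orbit data up to multiples of the regular representation. -/
theorem exists_character_eq [Fintype G] {n : ℕ}
    {ρ : Representation ℂ G (EuclideanSpace ℂ (Fin n))} (hρ : S.IsUnitaryRep ρ) :
    ∃ t : ℤ, ∀ g, ρ.character g = 1 + t * (if g = 1 then (Fintype.card G : ℂ) else 0)
      + (S.orbitData.map fun c => classCharacter c g).sum := by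
  obtain ⟨-, e, hi, he⟩ := hρ
  have hW : ∀ g : G, classCharacter (ConjClasses.mk 1) g = 0 := fun g => by
    rw [classCharacter_mk, coneCharacter_one]
    rfl
  have h1 : ∀ g, g ≠ 1 → ρ.character g
      = 1 + (S.orbitData.map fun c => classCharacter c g).sum := by
    intro g hg
    rw [S.sum_orbitData _ (hW g), ← S.cycleSum_kappa hg]
    refine S.trace_eq_one_add_cycleSum hi (he g) (orderOf_pos g).ne' (pow_orderOf_eq_one g) ?_ hg
    rw [← map_pow, pow_orderOf_eq_one, map_one]
  have hcard : (Fintype.card G : ℂ) ≠ 0 := by exact_mod_cast Fintype.card_ne_zero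
  have havg : ∃ m : ℕ, ∑ g, ρ.character g = m * Fintype.card G := by
    have : Invertible (Nat.card G : ℂ) := invertibleOfNonzero (by
      rw [Nat.card_eq_fintype_card]
      exact hcard)
    refine ⟨Module.finrank ℂ (Representation.invariants ρ), ?_⟩
    rw [← Representation.card_inv_mul_sum_char_eq_finrank, Nat.card_eq_fintype_card]
    field_simp
  obtain ⟨m, hm⟩ := havg
  have h2 : ∑ g, (S.orbitData.map fun c => classCharacter c g).sum = 0 := by
    rw [Finset.sum_congr rfl fun g _ => S.sum_orbitData (fun c => classCharacter c g) (hW g)]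
    rw [Finset.sum_comm]
    refine Finset.sum_eq_zero fun o _ => ?_
    obtain ⟨γ, hγ⟩ := ConjClasses.mk_surjective (S.rotationClass o)
    rw [← hγ]
    exact sum_coneCharacter γ
  refine ⟨m - 1, fun g => ?_⟩
  by_cases hg : g = 1
  · subst hg
    rw [if_pos rfl]
    have h3 : ∑ g, ρ.character g - ∑ g, (1 + (S.orbitData.map fun c => classCharacter c g).sum)
        = ρ.character 1 - (1 + (S.orbitData.map fun c => classCharacter c 1).sum) := by
      rw [← Finset.sum_sub_distrib]
      refine Finset.sum_eq_single 1 ?_ ?_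
      · intro g _ hg
        rw [h1 g hg, sub_self]
      · intro h
        exact absurd (Finset.mem_univ _) h
    rw [Finset.sum_add_distrib, h2, hm, Finset.sum_const, Finset.card_univ, nsmul_eq_mul] at h3
    push_cast
    linear_combination -h3
  · rw [if_neg hg, h1 g hg]
    ring

end SurfaceAction

/-! ### Compatible complex structures -/

section ComplexStructure

open Module

theorem commute_aeval {V : Type*} [AddCommGroup V] [Module ℝ V] {A T : End ℝ V}
    (h : Commute A T) (P : Polynomial ℝ) : Commute A (Polynomial.aeval T P) := by
  rw [Polynomial.aeval_eq_sum_range]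
  exact Commute.sum_right _ _ _ fun i _ => (h.pow_right i).smul_right _

section Inner

variable {V : Type*} [NormedAddCommGroup V] [InnerProductSpace ℝ V]

theorem isSymmetric_aeval {T : End ℝ V} (hT : T.IsSymmetric) (P : Polynomial ℝ) :
    (Polynomial.aeval T P).IsSymmetric := by
  have hpow : ∀ i x y, inner ℝ ((T ^ i) x) y = inner ℝ x ((T ^ i) y) := by
    intro i
    induction i with
    | zero => exact fun _ _ => rfl
    | succ i ih =>
      intro x y
      rw [pow_succ', Module.End.mul_apply, hT, ih, ← Module.End.mul_apply, ← pow_succ, pow_succ']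
  intro x y
  rw [Polynomial.aeval_eq_sum_range, LinearMap.sum_apply, LinearMap.sum_apply, sum_inner, inner_sum]
  refine Finset.sum_congr rfl fun i _ => ?_
  rw [LinearMap.smul_apply, LinearMap.smul_apply, inner_smul_left, inner_smul_right, hpow]
  rfl

variable [FiniteDimensional ℝ V]

/-- A positive definite operator has an inverse fourth root, which is a polynomial in it. -/
theorem exists_aeval_pow_four {T : End ℝ V} (hT : T.IsSymmetric)
    (hpos : ∀ x, x ≠ 0 → 0 < inner ℝ x (T x)) :
    ∃ P : Polynomial ℝ, T * Polynomial.aeval T P ^ 4 = 1 := by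
  classical
  let b := hT.eigenvectorBasis rfl
  let v := hT.eigenvalues rfl
  have hb : ∀ i, T (b i) = v i • b i := fun i => hT.apply_eigenvectorBasis rfl i
  have hb0 : ∀ i, b i ≠ 0 := fun i h => by
    have := b.orthonormal.1 i
    rw [h, norm_zero] at this
    exact zero_ne_one this
  have hv : ∀ i, 0 < v i := by
    intro i
    have h1 := hpos _ (hb0 i)
    rw [hb, inner_smul_right, real_inner_self_eq_norm_sq, b.orthonormal.1 i] at h1
    simpa using h1
  let P := Lagrange.interpolate (Finset.univ.image v) id (fun x => (√(√x))⁻¹)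
  have hP : ∀ i, P.eval (v i) = (√(√(v i)))⁻¹ := fun i =>
    Lagrange.eval_interpolate_at_node _ (Function.injective_id.injOn)
      (Finset.mem_image_of_mem v (Finset.mem_univ i))
  refine ⟨P, b.toBasis.ext fun i => ?_⟩
  have h1 : Polynomial.aeval T P (b i) = (√(√(v i)))⁻¹ • b i := by
    rw [← hP]
    exact Module.End.aeval_apply_of_hasEigenvector ⟨End.mem_eigenspace_iff.2 (hb i), hb0 i⟩
  have h2 : √(√(v i)) ^ 4 = v i := by
    rw [show (4 : ℕ) = 2 * 2 from rfl, pow_mul, Real.sq_sqrt (Real.sqrt_nonneg _),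
      Real.sq_sqrt (hv i).le]
  have h3 : (Polynomial.aeval T P ^ 4) (b i) = ((√(√(v i)))⁻¹ ^ 4) • b i := by
    simp only [pow_succ, pow_zero, one_mul, Module.End.mul_apply, h1, map_smul, smul_smul,
      mul_assoc]
  rw [OrthonormalBasis.coe_toBasis, Module.End.mul_apply, h3, map_smul, hb, smul_smul, inv_pow, h2,
    inv_mul_cancel₀ (hv i).ne', one_smul]
  rfl

/-- A symplectic form on a Euclidean space has a compatible complex structure, which commutes with
all isometries preserving the form. -/
theorem exists_complexStructure_of_inner (Ω : LinearMap.BilinForm ℝ V) (hΩ : ∀ x, Ω x x = 0)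
    (hΩn : ∀ x, (∀ y, Ω x y = 0) → x = 0) :
    ∃ J : End ℝ V, (∀ x, J (J x) = -x) ∧ (∀ x y, Ω (J x) (J y) = Ω x y) ∧
      (∀ x, x ≠ 0 → 0 < Ω x (J x)) ∧
      ∀ R : End ℝ V, Function.Surjective R → (∀ x y, inner ℝ (R x) (R y) = inner ℝ x y) →
        (∀ x y, Ω (R x) (R y) = Ω x y) → ∀ x, J (R x) = R (J x) := by
  let b := stdOrthonormalBasis ℝ V
  -- The operator `A` with `Ω x y = ⟪x, A y⟫` is skew, and `J` is its polar part up to sign: `-A`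
  -- times the inverse square root of `-A²`. As a polynomial in `A` it commutes with every isometry
  -- preserving `Ω`.
  let A : End ℝ V := ∑ i, (Ω (b i)).smulRight (b i)
  have hA : ∀ x y, inner ℝ x (A y) = Ω x y := by
    intro x y
    have h1 : A y = ∑ i, Ω (b i) y • b i := by
      simp [A]
    nth_rewrite 2 [← b.sum_repr' x]
    rw [h1, inner_sum, map_sum, LinearMap.sum_apply]
    refine Finset.sum_congr rfl fun i _ => ?_
    rw [inner_smul_right, map_smul, LinearMap.smul_apply, smul_eq_mul, real_inner_comm, mul_comm]
  have hskew : ∀ x y, inner ℝ (A x) y = - inner ℝ x (A y) := by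
    intro x y
    have := antisymm_of_self_eq_zero hΩ x y
    rw [hA, real_inner_comm, hA]
    linarith
  have hAinj : ∀ x, A x = 0 → x = 0 := by
    intro x hx
    apply hΩn
    intro y
    have := hskew x y
    rw [hx, inner_zero_left, hA] at this
    linarith
  have hT' : ∀ x y, inner ℝ x ((-(A * A)) y) = inner ℝ (A x) (A y) := by
    intro x y
    rw [LinearMap.neg_apply, Module.End.mul_apply, inner_neg_right, hskew]
  have hT : (-(A * A)).IsSymmetric := by
    intro x y
    rw [hT', real_inner_comm, hT', real_inner_comm]
  obtain ⟨P, hP⟩ := exists_aeval_pow_four hT (by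
    intro x hx
    rw [hT']
    exact real_inner_self_pos.2 fun h => hx (hAinj x h))
  set C := Polynomial.aeval (-(A * A)) P with hC
  have hCs : ∀ x y, inner ℝ (C x) y = inner ℝ x (C y) := isSymmetric_aeval hT P
  have hcomm : ∀ {R : End ℝ V}, Commute R A → Commute R C := fun h =>
    commute_aeval ((h.mul_right h).neg_right) P
  have hAC : ∀ x, A (C x) = C (A x) := fun x => LinearMap.congr_fun (hcomm (Commute.refl A)).eq x
  have hP' : ∀ x, A (A (C (C (C (C x))))) = -x := by
    intro x
    have h := LinearMap.congr_fun hP x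
    simp only [pow_succ, pow_zero, one_mul, Module.End.mul_apply, LinearMap.neg_apply,
      Module.End.one_apply] at h
    rw [← neg_neg (A _), h]
  have hCinj : ∀ x, C x = 0 → x = 0 := by
    intro x hx
    have := hP' x
    rw [hx] at this
    simpa using this.symm
  refine ⟨-(A * C * C), fun x => ?_, fun x y => ?_, fun x hx => ?_, fun R hR hRi hRΩ x => ?_⟩
  · simp only [LinearMap.neg_apply, Module.End.mul_apply, map_neg, neg_neg, ← hAC]
    exact hP' x
  · simp only [LinearMap.neg_apply, Module.End.mul_apply, map_neg, neg_neg]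
    rw [← hA, hskew, hCs, hCs, ← hA]
    simp only [← hAC, hP', map_neg, inner_neg_right, neg_neg]
  · rw [LinearMap.neg_apply, Module.End.mul_apply, Module.End.mul_apply, map_neg, ← hA, ← hskew,
      hAC, ← hCs, ← hAC]
    exact real_inner_self_pos.2 fun h => hx (hCinj x (hAinj _ h))
  · have hRA : Commute R A := by
      ext y
      refine ext_inner_left ℝ fun v => ?_
      obtain ⟨v, rfl⟩ := hR v
      rw [Module.End.mul_apply, Module.End.mul_apply, hRi, hA, hA, hRΩ]
    have h1 := LinearMap.congr_fun
      (((hRA.mul_right (hcomm hRA)).mul_right (hcomm hRA)).neg_right).eq x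
    exact h1.symm

end Inner

variable {V : Type*} [AddCommGroup V] [Module ℝ V] [FiniteDimensional ℝ V]

/-- A symplectic representation of a finite group has an invariant compatible complex structure. -/
theorem exists_complexStructure {G : Type*} [Group G] [Finite G] (R : Representation ℝ G V)
    (Ω : LinearMap.BilinForm ℝ V) (hΩ : ∀ x, Ω x x = 0) (hΩn : ∀ x, (∀ y, Ω x y = 0) → x = 0)
    (hR : ∀ g x y, Ω (R g x) (R g y) = Ω x y) :
    ∃ J : End ℝ V, (∀ x, J (J x) = -x) ∧ (∀ x y, Ω (J x) (J y) = Ω x y) ∧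
      (∀ x, x ≠ 0 → 0 < Ω x (J x)) ∧ ∀ g x, J (R g x) = R g (J x) := by
  cases nonempty_fintype G
  -- embed `V` into a Euclidean space on which `G` permutes the coordinates
  let b := Module.finBasis ℝ V
  let F : V →ₗ[ℝ] EuclideanSpace ℝ (G × Fin (finrank ℝ V)) :=
    { toFun := fun x => WithLp.toLp 2 fun p => b.repr (R p.1 x) p.2
      map_add' := fun x y => by
        ext p
        simp
      map_smul' := fun c x => by
        ext p
        simp }
  have hFapp : ∀ x p, F x p = b.repr (R p.1 x) p.2 := fun _ _ => rfl
  have hFinj : Function.Injective F := by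
    intro x y h
    apply b.repr.injective
    ext i
    have h1 : F x (1, i) = F y (1, i) := by rw [h]
    simpa [hFapp] using h1
  have hFi : ∀ g x y, inner ℝ (F (R g x)) (F (R g y)) = inner ℝ (F x) (F y) := by
    intro g x y
    simp only [PiLp.inner_apply]
    rw [← Equiv.sum_comp ((Equiv.mulRight g).prodCongr (Equiv.refl (Fin (finrank ℝ V))))
      (fun p => inner ℝ (F x p) (F y p))]
    refine Finset.sum_congr rfl fun p _ => ?_
    simp only [hFapp, Equiv.prodCongr_apply, Prod.map_fst, Prod.map_snd, Equiv.coe_mulRight,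
      Equiv.refl_apply, map_mul, Module.End.mul_apply]
  let f := LinearEquiv.ofInjective F hFinj
  have hf : ∀ x, (f x : EuclideanSpace ℝ (G × Fin (finrank ℝ V))) = F x := fun _ => rfl
  obtain ⟨J, h1, h2, h3, h4⟩ := exists_complexStructure_of_inner
    (Ω.compl₁₂ (f.symm : LinearMap.range F →ₗ[ℝ] V) (f.symm : LinearMap.range F →ₗ[ℝ] V))
    (fun x => hΩ _) (fun x hx => by
      refine f.symm.map_eq_zero_iff.1 (hΩn _ fun y => ?_)
      have h := hx (f y)
      rwa [LinearMap.compl₁₂_apply, LinearEquiv.coe_coe, LinearEquiv.symm_apply_apply] at h)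
  simp only [LinearMap.compl₁₂_apply, LinearEquiv.coe_coe] at h2 h3 h4
  refine ⟨(f.symm : LinearMap.range F →ₗ[ℝ] V) ∘ₗ J ∘ₗ (f : V →ₗ[ℝ] LinearMap.range F),
    fun x => ?_, fun x y => ?_, fun x hx => ?_, fun g x => ?_⟩
  · change f.symm (J (f (f.symm (J (f x))))) = -x
    rw [f.apply_symm_apply, h1]
    exact (f.symm.map_neg (f x)).trans (congrArg Neg.neg (f.symm_apply_apply x))
  · have h := h2 (f x) (f y)
    rwa [f.symm_apply_apply, f.symm_apply_apply] at h
  · have h := h3 (f x) (fun h => hx (f.map_eq_zero_iff.1 h))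
    rwa [LinearEquiv.symm_apply_apply] at h
  · have hs : Function.Surjective ((f : V →ₗ[ℝ] LinearMap.range F) ∘ₗ R g
        ∘ₗ (f.symm : LinearMap.range F →ₗ[ℝ] V)) := by
      intro y
      refine ⟨f (R g⁻¹ (f.symm y)), ?_⟩
      simp
    have h5 := h4 _ hs (fun x y => by
      obtain ⟨x, rfl⟩ := f.surjective x
      obtain ⟨y, rfl⟩ := f.surjective y
      simpa [hf] using hFi g x y) (fun x y => by simpa using hR g _ _) (f x)
    simp only [LinearMap.comp_apply, LinearEquiv.coe_coe, LinearEquiv.symm_apply_apply] at h5 ⊢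
    rw [h5, LinearEquiv.symm_apply_apply]

/-- Unitary coordinates for a compatible complex structure. -/
theorem exists_unitary_coordinates (Ω : LinearMap.BilinForm ℝ V) (hΩ : ∀ x, Ω x x = 0)
    (J : End ℝ V) (hJ : ∀ x, J (J x) = -x) (hJΩ : ∀ x y, Ω (J x) (J y) = Ω x y)
    (hpos : ∀ x, x ≠ 0 → 0 < Ω x (J x)) :
    ∃ (n : ℕ) (e : V ≃ₗ[ℝ] EuclideanSpace ℂ (Fin n)), (∀ x, e (J x) = Complex.I • e x) ∧
      ∀ x y, inner ℂ (e x) (e y) = ⟨Ω x (J y), Ω x y⟩ := by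
  have hanti := antisymm_of_self_eq_zero hΩ
  let _ : SMul ℂ V := ⟨fun c x => c.re • x + c.im • J x⟩
  have hs : ∀ (c : ℂ) (x : V), c • x = c.re • x + c.im • J x := fun _ _ => rfl
  let _ : Module ℂ V := Module.ofMinimalAxioms
    (fun c x y => by
      simp only [hs, map_add, smul_add]
      abel)
    (fun c d x => by
      simp only [hs, Complex.add_re, Complex.add_im, add_smul]
      abel)
    (fun c d x => by
      simp only [hs, Complex.mul_re, Complex.mul_im, map_add, map_smul, hJ]
      module)
    (fun x => by simp [hs])
  have : IsScalarTower ℝ ℂ V := ⟨fun r c x => by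
    simp only [hs, Complex.real_smul, Complex.re_ofReal_mul, Complex.im_ofReal_mul, smul_add,
      mul_smul]⟩
  have hself : ∀ x, Ω (J x) x = - Ω x (J x) := fun x => by linarith [hanti (J x) x]
  have hJr : ∀ x y, Ω (J x) y = - Ω x (J y) := by
    intro x y
    have := hJΩ x (J y)
    rw [hJ, map_neg] at this
    linarith
  let core : InnerProductSpace.Core ℂ V :=
    { inner := fun x y => ⟨Ω x (J y), Ω x y⟩
      conj_inner_symm := fun x y => by
        apply Complex.ext
        · change Ω y (J x) = Ω x (J y)
          linarith [hJr x y, hanti (J x) y]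
        · change - Ω y x = Ω x y
          linarith [hanti x y]
      re_inner_nonneg := fun x => by
        change 0 ≤ Ω x (J x)
        rcases eq_or_ne x 0 with rfl | hx
        · simp
        · exact (hpos x hx).le
      add_left := fun x y z => by
        apply Complex.ext
        · change Ω (x + y) (J z) = Ω x (J z) + Ω y (J z)
          rw [map_add, LinearMap.add_apply]
        · change Ω (x + y) z = Ω x z + Ω y z
          rw [map_add, LinearMap.add_apply]
      smul_left := fun x y c => by
        apply Complex.ext
        · change Ω (c • x) (J y) = ((starRingEnd ℂ) c * ⟨Ω x (J y), Ω x y⟩).re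
          rw [hs, Complex.mul_re]
          simp [hJΩ]
        · change Ω (c • x) y = ((starRingEnd ℂ) c * ⟨Ω x (J y), Ω x y⟩).im
          rw [hs, Complex.mul_im]
          simp [hJr]
      definite := fun x hx => by
        by_contra h
        have h1 : Ω x (J x) = 0 := congrArg Complex.re hx
        exact (hpos x h).ne' h1 }
  let _ : NormedAddCommGroup V := core.toNormedAddCommGroup
  let _ : InnerProductSpace ℂ V := InnerProductSpace.ofCore core.toCore
  have : FiniteDimensional ℂ V := FiniteDimensional.right ℝ ℂ V
  let φ := (stdOrthonormalBasis ℂ V).repr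
  refine ⟨finrank ℂ V, φ.toLinearEquiv.restrictScalars ℝ, fun x => ?_, fun x y => ?_⟩
  · have h1 : J x = Complex.I • x := by simp [hs]
    rw [h1]
    exact φ.map_smul Complex.I x
  · exact φ.inner_map_map x y

end ComplexStructure

section Existence

open Module Complex

namespace SurfaceAction

variable {G : Type u} [Group G] (S : SurfaceAction G)

/-- A function on the darts orthogonal to all cycles is the sum of a function on the edges and a
function on the vertices. -/
theorem exists_add_of_orthogonal (w : S.Dart → ℝ)
    (hw : ∀ x : S.cycles, ∑ d, (x : S.Dart → ℝ) d * w d = 0) :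
    ∃ a b : S.Dart → ℝ, (∀ d, w d = a d + b d) ∧ (∀ d, a (S.rev d) = a d) ∧
      ∀ d, b (S.next d) = b d := by
  have h1 : WithLp.toLp 2 (fun d => (w d : ℂ)) ∈
      End.eigenspace (permRep S.Dart S.rev) 1 ⊔ End.eigenspace (permRep S.Dart S.next) 1 := by
    rw [← Submodule.orthogonal_orthogonal (End.eigenspace (permRep S.Dart S.rev) 1 ⊔ _),
      S.orthogonal_complexCycles, Submodule.mem_orthogonal]
    intro z hz
    rw [PiLp.inner_apply]
    apply Complex.ext
    · rw [re_sum, zero_re, ← hw (S.reCycle ⟨z, hz⟩)]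
      refine Finset.sum_congr rfl fun d _ => ?_
      simp [reCycle_apply, mul_comm]
    · rw [im_sum, zero_im, ← neg_eq_zero, ← hw (S.imCycle ⟨z, hz⟩), ← Finset.sum_neg_distrib]
      refine Finset.sum_congr rfl fun d _ => ?_
      simp [imCycle_apply, mul_comm]
  obtain ⟨a, ha, b, hb, hab⟩ := Submodule.mem_sup.1 h1
  refine ⟨fun d => (a d).re, fun d => (b d).re, fun d => ?_,
    fun d => congrArg re ((S.mem_eigenspace_permRep_one _ _).1 ha d),
    fun d => congrArg re ((S.mem_eigenspace_permRep_one _ _).1 hb d)⟩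
  have h2 : (a + b) d = w d := by rw [hab]
  rw [← add_re, ← PiLp.add_apply, h2, ofReal_re]

/-- Poincaré duality: the intersection pairing is nondegenerate. -/
theorem mem_boundaries_of_cycleIntersection (y : S.cycles)
    (hy : ∀ x, S.cycleIntersection x y = 0) : y ∈ S.boundaries := by
  set y' : S.Dart → ℝ := (y : S.Dart → ℝ) with hy'
  obtain ⟨a, b, hab, ha, hb⟩ := S.exists_add_of_orthogonal
    (fun d => y' (S.next d) - y' (S.next (S.next d))) (by
      intro x
      have h1 := hy x
      rw [cycleIntersection_apply, Finset.sum_sub_distrib] at h1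
      have h2 : ∑ d, (x : S.Dart → ℝ) (S.next d) * y' d
          = ∑ d, (x : S.Dart → ℝ) d * y' (S.next (S.next d)) := by
        rw [← Equiv.sum_comp S.next (fun d => (x : S.Dart → ℝ) d * y' (S.next (S.next d)))]
        exact Finset.sum_congr rfl fun d _ => by rw [S.next_next_next]
      rw [← hy', h2, ← Finset.sum_sub_distrib] at h1
      simp only [mul_sub]
      linarith)
  -- the value of the cycle `y` in terms of the function `a` on the edges
  have hya : ∀ d, 3 * y' d = a (S.next (S.next d)) - a (S.next d) := by
    intro d
    have h1 := hab (S.next d)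
    have h2 := hab (S.next (S.next d))
    have h3 := y.2.2 d
    have h4 := hb d
    have h5 := hb (S.next d)
    simp only [S.next_next_next] at h1 h2
    rw [← hy'] at h3
    linarith
  refine ⟨fun d => (a (S.next (S.next d)) - a d - a (S.next d)) / 6, fun d => ?_, fun d => ?_⟩
  · obtain ⟨d, rfl⟩ := S.rev.surjective d
    obtain ⟨d, rfl⟩ := S.next.surjective d
    have h0 : S.faceNext (S.rev (S.next d)) = d := by
      rw [faceNext, Equiv.trans_apply, S.rev_rev, Equiv.symm_apply_apply]
    have h1 := hya (S.next d)
    have h2 := hya (S.rev (S.next d))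
    have h3 := y.2.1 (S.next d)
    have h4 := ha (S.next d)
    rw [← hy'] at h3
    simp only [h0, S.next_next_next] at h1 ⊢
    linarith
  · have h1 := hya d
    have h2 := hya (S.rev d)
    have h3 := y.2.1 d
    have h4 := ha d
    rw [← hy'] at h3
    rw [← hy']
    dsimp only
    linarith

theorem intersection_self (x : S.H1) : S.intersection x x = 0 := by
  obtain ⟨x, rfl⟩ := S.boundaries.mkQ_surjective x
  have h := S.cycleIntersection_swap x x
  change S.cycleIntersection x x = 0
  linarith

theorem intersection_nondegenerate (x : S.H1) (h : ∀ y, S.intersection x y = 0) : x = 0 := by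
  obtain ⟨x, rfl⟩ := S.boundaries.mkQ_surjective x
  rw [Submodule.mkQ_apply, Submodule.Quotient.mk_eq_zero]
  apply S.mem_boundaries_of_cycleIntersection
  intro y
  rw [cycleIntersection_swap, neg_eq_zero]
  exact h (S.boundaries.mkQ y)

theorem intersection_homologyRep (g : G) (x y : S.H1) :
    S.intersection (S.homologyRep g x) (S.homologyRep g y) = S.intersection x y := by
  obtain ⟨x, rfl⟩ := S.boundaries.mkQ_surjective x
  obtain ⟨y, rfl⟩ := S.boundaries.mkQ_surjective y
  change S.cycleIntersection (S.cycleRep g x) (S.cycleRep g y) = S.cycleIntersection x y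
  rw [cycleIntersection_apply, cycleIntersection_apply]
  congr 1
  rw [← Equiv.sum_comp (S.act g⁻¹) (fun d => (x : S.Dart → ℝ) d * (y : S.Dart → ℝ) (S.next d)
      - (x : S.Dart → ℝ) (S.next d) * (y : S.Dart → ℝ) d)]
  simp only [← S.act_next]
  rfl

/-- Every action of a finite group has a unitary representation. -/
theorem exists_isUnitaryRep [Finite G] :
    ∃ (n : ℕ) (ρ : Representation ℂ G (EuclideanSpace ℂ (Fin n))), S.IsUnitaryRep ρ := by
  obtain ⟨J, h1, h2, h3, h4⟩ := exists_complexStructure S.homologyRep S.intersection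
    S.intersection_self S.intersection_nondegenerate S.intersection_homologyRep
  obtain ⟨n, e, h5, h6⟩ := exists_unitary_coordinates S.intersection S.intersection_self J h1 h2 h3
  let ρ : Representation ℂ G (EuclideanSpace ℂ (Fin n)) :=
    { toFun := fun g =>
        { toFun := fun z => e (S.homologyRep g (e.symm z))
          map_add' := fun z w => by simp only [map_add]
          map_smul' := fun c z => by
            obtain ⟨x, rfl⟩ := e.surjective z
            have hc : ∀ x : S.H1, c • e x = e (c.re • x + c.im • J x) := by
              intro x
              rw [map_add, map_smul, map_smul, h5]
              nth_rewrite 1 [← Complex.re_add_im c]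
              rw [add_smul, mul_smul, Complex.coe_smul, Complex.coe_smul]
            rw [RingHom.id_apply, hc, hc, e.symm_apply_apply, e.symm_apply_apply, map_add, map_smul,
              map_smul, ← h4] }
      map_one' := by
        ext1 z
        simp
      map_mul' := fun g h => by
        ext1 z
        simp }
  have hρ : ∀ g z, ρ g z = e (S.homologyRep g (e.symm z)) := fun _ _ => rfl
  refine ⟨n, ρ, fun g z w => ?_, e, fun x y => ?_, fun g x => ?_⟩
  · obtain ⟨x, rfl⟩ := e.surjective z
    obtain ⟨y, rfl⟩ := e.surjective w
    rw [hρ, hρ, h6, h6, e.symm_apply_apply, e.symm_apply_apply, h4, S.intersection_homologyRep,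
      S.intersection_homologyRep]
  · rw [h6]
  · rw [hρ, e.symm_apply_apply]

end SurfaceAction

end Existence

/-! ### Actions on coverings of a prism -/

section Prism

variable {I H : Type} [Group H]

/-- The successor of a dart in the counterclockwise order around its initial vertex, for a covering
of the prism. The vertices of the prism are the pairs of an index `i` and a Boolean, which tells the
upper polygon from the lower one; the dart number `0` is the rung, the darts `1` and `2` belong to
the polygon. The last entry is the sheet of the covering. -/
def prismNext : Equiv.Perm (I × Bool × Fin 3 × H) where
  toFun d := (d.1, d.2.1, d.2.2.1 + 1, d.2.2.2)
  invFun d := (d.1, d.2.1, d.2.2.1 + 2, d.2.2.2)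
  left_inv := by
    rintro ⟨i, b, k, x⟩
    refine Prod.ext rfl (Prod.ext rfl (Prod.ext ?_ rfl))
    change k + 1 + 2 = k
    fin_cases k <;> rfl
  right_inv := by
    rintro ⟨i, b, k, x⟩
    refine Prod.ext rfl (Prod.ext rfl (Prod.ext ?_ rfl))
    change k + 2 + 1 = k
    fin_cases k <;> rfl

/-- The inverse darts of a covering of the prism with voltages `h i` on the rungs. -/
def prismRevFun (s : Equiv.Perm I) (h : I → H) : I × Bool × Fin 3 × H → I × Bool × Fin 3 × H
  | (i, true, 0, x) => (i, false, 0, x * h i)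
  | (i, false, 0, x) => (i, true, 0, x * (h i)⁻¹)
  | (i, true, 1, x) => (s i, true, 2, x)
  | (i, true, 2, x) => (s.symm i, true, 1, x)
  | (i, false, 1, x) => (s.symm i, false, 2, x)
  | (i, false, 2, x) => (s i, false, 1, x)

theorem prismRevFun_prismRevFun (s : Equiv.Perm I) (h : I → H) (d : I × Bool × Fin 3 × H) :
    prismRevFun s h (prismRevFun s h d) = d := by
  obtain ⟨i, b, k, x⟩ := d
  fin_cases k <;> cases b <;> simp [prismRevFun]

/-- The involution `prismRevFun` as a permutation. -/
def prismRev (s : Equiv.Perm I) (h : I → H) : Equiv.Perm (I × Bool × Fin 3 × H) :=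
  ⟨prismRevFun s h, prismRevFun s h, prismRevFun_prismRevFun s h, prismRevFun_prismRevFun s h⟩

/-- Sheets are connected through the rungs: going up one rung and down another one realizes any
change of the sheet, as `h` is surjective. -/
theorem prism_connected [Nonempty I] (s : Equiv.Perm I) (hs : ∀ i j, ∃ m : ℕ, (s ^ m) i = j)
    (h : I → H) (hh : Function.Surjective h) (d d' : I × Bool × Fin 3 × H) :
    ∃ p ∈ Subgroup.closure {prismNext, prismRev s h}, p d = d' := by
  let C := Subgroup.closure {prismNext, prismRev s h}
  let R : I × Bool × Fin 3 × H → I × Bool × Fin 3 × H → Prop := fun d d' => ∃ p ∈ C, p d = d'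
  have hsymm : ∀ {d d'}, R d d' → R d' d := by
    rintro d _ ⟨p, hp, rfl⟩
    exact ⟨p⁻¹, C.inv_mem hp, p.symm_apply_apply d⟩
  have htrans : ∀ {d d' d''}, R d d' → R d' d'' → R d d'' := by
    rintro d _ _ ⟨p, hp, rfl⟩ ⟨q, hq, rfl⟩
    exact ⟨q * p, C.mul_mem hq hp, rfl⟩
  have hnext : ∀ d, R d (prismNext d) := fun d =>
    ⟨_, Subgroup.subset_closure (Set.mem_insert _ _), rfl⟩
  have hrev : ∀ d, R d (prismRev s h d) := fun d =>
    ⟨_, Subgroup.subset_closure (Set.mem_insert_of_mem _ rfl), rfl⟩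
  have h1 : ∀ i b (k : Fin 3) x, R (i, b, 0, x) (i, b, k, x) := by
    intro i b k x
    fin_cases k
    · exact ⟨1, C.one_mem, rfl⟩
    · exact hnext _
    · exact htrans (hnext _) (hnext _)
  have h2 : ∀ i x, R (i, false, 0, x) (s i, false, 0, x) := fun i x =>
    htrans (h1 i false 2 x) (htrans (hrev _) (hsymm (h1 (s i) false 1 x)))
  have h3 : ∀ i j x, R (i, false, 0, x) (j, false, 0, x) := by
    intro i j x
    obtain ⟨m, rfl⟩ := hs i j
    induction m with
    | zero => exact ⟨1, C.one_mem, rfl⟩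
    | succ m ih =>
      rw [pow_succ', Equiv.Perm.mul_apply]
      exact htrans ih (h2 _ x)
  have h2' : ∀ i x, R (i, true, 0, x) (s i, true, 0, x) := fun i x =>
    htrans (h1 i true 1 x) (htrans (hrev _) (hsymm (h1 (s i) true 2 x)))
  have h3' : ∀ i j x, R (i, true, 0, x) (j, true, 0, x) := by
    intro i j x
    obtain ⟨m, rfl⟩ := hs i j
    induction m with
    | zero => exact ⟨1, C.one_mem, rfl⟩
    | succ m ih =>
      rw [pow_succ', Equiv.Perm.mul_apply]
      exact htrans ih (h2' _ x)
  have h4 : ∀ i x, R (i, true, 0, x) (i, false, 0, x * h i) := fun i x => hrev _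
  obtain ⟨i₀⟩ := ‹Nonempty I›
  have h5 : ∀ x, R (i₀, false, 0, x) (i₀, false, 0, 1) := by
    intro x
    obtain ⟨j, hj⟩ := hh (h i₀ * x)
    have h7 : x * (h j)⁻¹ * h i₀ = 1 := by
      rw [hj]
      group
    have h8 := h4 i₀ (x * (h j)⁻¹)
    rw [h7] at h8
    exact htrans (h3 i₀ j x) (htrans (hrev _) (htrans (h3' j i₀ _) h8))
  have h6 : ∀ d, R d (i₀, false, 0, 1) := by
    rintro ⟨i, b, k, x⟩
    refine htrans (hsymm (h1 i b k x)) ?_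
    cases b
    · exact htrans (h3 i i₀ x) (h5 x)
    · exact htrans (h4 i x) (htrans (h3 i i₀ _) (h5 _))
  exact htrans (h6 d) (hsymm (h6 d'))

variable {G : Type u} [Group G]

/-- The action of a group on the covering of the prism with voltages `h i` on the rungs. -/
abbrev prismAction [Fintype I] [Nonempty I] [Fintype H] (s : Equiv.Perm I)
    (hs : ∀ i j, ∃ m : ℕ, (s ^ m) i = j) (h : I → H) (hh : Function.Surjective h) (f : G ≃* H) :
    SurfaceAction G where
  Dart := I × Bool × Fin 3 × H
  next := prismNext
  rev := prismRev s h
  next_ne := by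
    rintro ⟨i, b, k, x⟩ e
    have : k + 1 = k := congrArg (fun d => d.2.2.1) e
    fin_cases k <;> simp at this
  next_next_next := by
    rintro ⟨i, b, k, x⟩
    refine Prod.ext rfl (Prod.ext rfl (Prod.ext ?_ rfl))
    change k + 1 + 1 + 1 = k
    fin_cases k <;> rfl
  rev_ne := by
    rintro ⟨i, b, k, x⟩
    fin_cases k <;> cases b <;> simp [prismRev, prismRevFun]
  rev_rev := prismRevFun_prismRevFun s h
  connected := prism_connected s hs h hh
  act :=
    { toFun := fun g =>
        { toFun := fun d => (d.1, d.2.1, d.2.2.1, f g * d.2.2.2)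
          invFun := fun d => (d.1, d.2.1, d.2.2.1, (f g)⁻¹ * d.2.2.2)
          left_inv := fun d => by simp
          right_inv := fun d => by simp }
      map_one' := by
        ext1 d
        simp
      map_mul' := fun g g' => by
        ext1 d
        simp [mul_assoc] }
  act_next _ _ := rfl
  act_rev g := by
    rintro ⟨i, b, k, x⟩
    fin_cases k <;> cases b <;> simp [prismRev, prismRevFun, mul_assoc]
  free_vertex g hg := by
    rintro ⟨i, b, k, x⟩
    fin_cases k <;> simp [prismNext, hg]
  free_edge g hg := by
    rintro ⟨i, b, k, x⟩
    fin_cases k <;> cases b <;> simp [prismRev, prismRevFun, hg]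


section

variable [Fintype I] [Nonempty I] [Fintype H] {s : Equiv.Perm I}
  {hs : ∀ i j, ∃ m : ℕ, (s ^ m) i = j} {h : I → H} {hh : Function.Surjective h} {f : G ≃* H}

theorem prism_faceNext_false_zero (i : I) (x : H) :
    (prismAction s hs h hh f).faceNext (i, false, 0, x) = (i, true, 2, x * (h i)⁻¹) := rfl

theorem prism_faceNext_true_one (i : I) (x : H) :
    (prismAction s hs h hh f).faceNext (i, true, 1, x) = (s i, true, 1, x) :=
  Prod.ext rfl (Prod.ext rfl (Prod.ext (by decide : (2 + 2 : Fin 3) = 1) rfl))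

theorem prism_faceNext_false_one (i : I) (x : H) :
    (prismAction s hs h hh f).faceNext (i, false, 1, x) = (s.symm i, false, 1, x) :=
  Prod.ext rfl (Prod.ext rfl (Prod.ext (by decide : (2 + 2 : Fin 3) = 1) rfl))

theorem prism_faceNext_true_two (i : I) (x : H) :
    (prismAction s hs h hh f).faceNext (i, true, 2, x) = (s.symm i, true, 0, x) :=
  Prod.ext rfl (Prod.ext rfl (Prod.ext (by decide : (1 + 2 : Fin 3) = 0) rfl))

theorem prism_faceNext_false_two (i : I) (x : H) :
    (prismAction s hs h hh f).faceNext (i, false, 2, x) = (s i, false, 0, x) :=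
  Prod.ext rfl (Prod.ext rfl (Prod.ext (by decide : (1 + 2 : Fin 3) = 0) rfl))

/-- The square face at a rung. -/
theorem prism_rotation_square (i : I) (x : H) :
    (prismAction s hs h hh f).rotation (i, true, 0, x)
      = f.symm (x * (h i * (h (s i))⁻¹) * x⁻¹) := by
  set S := prismAction s hs h hh f
  set g := f.symm (x * (h i * (h (s i))⁻¹) * x⁻¹) with hg
  have h1 : S.faceNext (i, true, 0, x) = (i, false, 2, x * h i) := rfl
  have h2 : S.faceNext (i, false, 2, x * h i) = (s i, false, 0, x * h i) :=
    prism_faceNext_false_two i _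
  have h3 : S.faceNext (s i, false, 0, x * h i) = (s i, true, 2, x * h i * (h (s i))⁻¹) := rfl
  have h4 : S.faceNext (s i, true, 2, x * h i * (h (s i))⁻¹)
      = (s.symm (s i), true, 0, x * h i * (h (s i))⁻¹) := prism_faceNext_true_two _ _
  rw [s.symm_apply_apply] at h4
  have hact : ∀ g d, S.act g d = (d.1, d.2.1, d.2.2.1, f g * d.2.2.2) := fun _ _ => rfl
  have hg4 : S.act g (i, true, 0, x) = S.faceNext^[4] (i, true, 0, x) := by
    simp only [Function.iterate_succ_apply, Function.iterate_zero_apply, h1, h2, h3, h4, hact, hg,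
      f.apply_symm_apply]
    simp [mul_assoc]
  have hle := S.rotationStep_le (by norm_num) hg4
  have hpos := S.rotationStep_pos (i, true, 0, x)
  have hrot := S.act_rotation (i, true, 0, x)
  generalize S.rotationStep (i, true, 0, x) = k at hle hpos hrot
  interval_cases k
  · rw [Function.iterate_one, h1, hact] at hrot
    exact absurd (congrArg (fun d => d.2.1) hrot) (by simp)
  · simp only [Function.iterate_succ_apply, Function.iterate_zero_apply, h1, h2, hact] at hrot
    exact absurd (congrArg (fun d => d.2.1) hrot) (by simp)
  · simp only [Function.iterate_succ_apply, Function.iterate_zero_apply, h1, h2, h3, hact] at hrot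
    exact absurd (congrArg (fun d => d.2.2.1) hrot) (by simp)
  · rw [← hg4] at hrot
    exact S.act_injective hrot

/-- The faces above and below the prism have trivial stabilizers. -/
theorem prism_rotation_polygon (i : I) (b : Bool) (x : H) :
    (prismAction s hs h hh f).rotation (i, b, 1, x) = 1 := by
  set S := prismAction s hs h hh f
  have h1 : ∀ k i, ∃ j, S.faceNext^[k] (i, b, 1, x) = (j, b, 1, x) := by
    intro k
    induction k with
    | zero => exact fun i => ⟨i, rfl⟩
    | succ k ih =>
      intro i
      rw [Function.iterate_succ_apply]
      cases b
      · rw [prism_faceNext_false_one]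
        exact ih (s.symm i)
      · rw [prism_faceNext_true_one]
        exact ih (s i)
  have hrot := S.act_rotation (i, b, 1, x)
  obtain ⟨j, hj⟩ := h1 (S.rotationStep (i, b, 1, x)) i
  rw [hj] at hrot
  have h2 : f (S.rotation (i, b, 1, x)) * x = x := congrArg (fun d => d.2.2.2) hrot
  rwa [mul_eq_right, map_eq_one_iff f f.injective] at h2

/-- The face on the left of a dart of the prism. -/
def prismFace (s : Equiv.Perm I) : I × Bool × Fin 3 × H → I ⊕ Bool
  | (i, true, 0, _) => Sum.inl i
  | (i, false, 0, _) => Sum.inl (s.symm i)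
  | (_, true, 1, _) => Sum.inr true
  | (i, true, 2, _) => Sum.inl (s.symm i)
  | (_, false, 1, _) => Sum.inr false
  | (i, false, 2, _) => Sum.inl i

theorem prismFace_eq_of_rel {d d' : I × Bool × Fin 3 × H}
    (hd : (prismAction s hs h hh f).faceOrbitSetoid d d') : prismFace s d = prismFace s d' := by
  set S := prismAction s hs h hh f
  have h1 : ∀ g d, prismFace s (S.act g d) = prismFace s d := by
    rintro g ⟨i, b, k, x⟩
    fin_cases k <;> cases b <;> rfl
  have h2 : ∀ d, prismFace s (S.faceNext d) = prismFace s d := by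
    rintro ⟨i, b, k, x⟩
    fin_cases k <;> cases b
    · rfl
    · rfl
    · rfl
    · rfl
    · exact congrArg Sum.inl (s.symm_apply_apply i)
    · rfl
  obtain ⟨g, k, rfl⟩ := hd
  rw [h1]
  clear h1
  induction k with
  | zero => rfl
  | succ k ih =>
    rw [ih, Function.iterate_succ_apply']
    exact (h2 _).symm

/-- A dart on the boundary of a given face of the prism. -/
def prismDart (i₀ : I) : I ⊕ Bool → I × Bool × Fin 3 × H
  | Sum.inl i => (i, true, 0, 1)
  | Sum.inr b => (i₀, b, 1, 1)

theorem prism_rel_prismDart (i₀ : I) (d : I × Bool × Fin 3 × H) :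
    (prismAction s hs h hh f).faceOrbitSetoid d (prismDart i₀ (prismFace s d)) := by
  set S := prismAction s hs h hh f
  have hact : ∀ d : I × Bool × Fin 3 × H, S.faceOrbitSetoid d (d.1, d.2.1, d.2.2.1, 1) := by
    intro d
    refine ⟨f.symm d.2.2.2⁻¹, 0, ?_⟩
    change _ = (d.1, d.2.1, d.2.2.1, f (f.symm d.2.2.2⁻¹) * d.2.2.2)
    rw [f.apply_symm_apply, inv_mul_cancel]
  have hnext : ∀ d, S.faceOrbitSetoid d (S.faceNext d) := fun d => ⟨1, 1, by simp⟩
  have htop : ∀ i (b : Bool), S.faceOrbitSetoid (i, b, 1, (1 : H)) (i₀, b, 1, 1) := by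
    intro i b
    cases b
    · apply S.faceOrbitSetoid.symm
      obtain ⟨m, rfl⟩ := hs i i₀
      induction m with
      | zero => exact S.faceOrbitSetoid.refl _
      | succ m ih =>
        refine S.faceOrbitSetoid.trans ?_ ih
        refine S.faceOrbitSetoid.trans (hnext _) ?_
        rw [prism_faceNext_false_one, pow_succ', Equiv.Perm.mul_apply, s.symm_apply_apply]
    · obtain ⟨m, rfl⟩ := hs i i₀
      induction m with
      | zero => exact S.faceOrbitSetoid.refl _
      | succ m ih =>
        refine S.faceOrbitSetoid.trans ih ?_
        refine S.faceOrbitSetoid.trans (hnext _) ?_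
        rw [prism_faceNext_true_one, pow_succ', Equiv.Perm.mul_apply]
  have h2 : ∀ i x, S.faceOrbitSetoid (i, true, 2, x) (s.symm i, true, 0, 1) := by
    intro i x
    refine S.faceOrbitSetoid.trans (hnext _) ?_
    rw [prism_faceNext_true_two]
    exact hact _
  have h0 : ∀ i x, S.faceOrbitSetoid (i, false, 0, x) (s.symm i, true, 0, 1) := by
    intro i x
    refine S.faceOrbitSetoid.trans (hnext _) ?_
    rw [prism_faceNext_false_zero]
    exact S.faceOrbitSetoid.trans (hact _) (h2 _ _)
  obtain ⟨i, b, k, x⟩ := d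
  fin_cases k <;> cases b
  · exact h0 i x
  · exact hact _
  · exact S.faceOrbitSetoid.trans (hact _) (htop i false)
  · exact S.faceOrbitSetoid.trans (hact _) (htop i true)
  · refine S.faceOrbitSetoid.trans (hnext _) ?_
    have := h0 (s i) x
    rw [s.symm_apply_apply] at this
    exact (congrArg (fun d => S.faceOrbitSetoid d _) (prism_faceNext_false_two i x)).mpr this
  · exact h2 i x

open Classical in
/-- The faces modulo the group are the squares, one for each rung, and the two polygons; the
rotation of a square is the quotient of the voltages on its two rungs. -/
theorem prism_orbitData : (prismAction s hs h hh f).orbitData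
    = ((Finset.univ : Finset I).val.map fun i =>
      ConjClasses.mk (f.symm (h i * (h (s i))⁻¹))).filter (fun c => c ≠ ConjClasses.mk 1) := by
  set S := prismAction s hs h hh f
  obtain ⟨i₀⟩ := ‹Nonempty I›
  let F : I ⊕ Bool → S.FaceOrbit := fun l => Quotient.mk S.faceOrbitSetoid (prismDart i₀ l)
  have hface : ∀ l, prismFace s (prismDart i₀ l : I × Bool × Fin 3 × H) = l := by
    rintro (i | b)
    · rfl
    · cases b <;> rfl
  have hF : Function.Bijective F := by
    constructor
    · intro l l' hl
      have := prismFace_eq_of_rel (Quotient.exact hl)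
      rwa [hface, hface] at this
    · intro o
      induction o using Quotient.inductionOn with
      | _ d =>
        exact ⟨prismFace s d, Quotient.sound (S.faceOrbitSetoid.symm (prism_rel_prismDart i₀ d))⟩
  let e : I ⊕ Bool ≃ S.FaceOrbit := Equiv.ofBijective F hF
  have h1 : (Finset.univ : Finset S.FaceOrbit).val.map S.rotationClass
      = (Finset.univ : Finset (I ⊕ Bool)).val.map fun l => S.rotationClass (F l) := by
    rw [← Finset.map_univ_equiv e, Finset.map_val, Multiset.map_map]
    rfl
  have h2 : (Finset.univ : Finset (I ⊕ Bool)).val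
      = (Finset.univ : Finset I).val.map Sum.inl
        + (Finset.univ : Finset Bool).val.map Sum.inr := rfl
  have h3 : ∀ i, S.rotationClass (F (Sum.inl i)) = ConjClasses.mk (f.symm (h i * (h (s i))⁻¹)) := by
    intro i
    change ConjClasses.mk (S.rotation (i, true, 0, 1)) = _
    refine congrArg ConjClasses.mk ((prism_rotation_square i 1).trans ?_)
    rw [one_mul, inv_one, mul_one]
  have h4 : ∀ b, S.rotationClass (F (Sum.inr b)) = ConjClasses.mk 1 := by
    intro b
    change ConjClasses.mk (S.rotation (i₀, b, 1, 1)) = _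
    exact congrArg ConjClasses.mk (prism_rotation_polygon i₀ b 1)
  rw [SurfaceAction.orbitData, h1, h2, Multiset.map_add, Multiset.map_map, Multiset.map_map,
    Multiset.filter_add]
  simp only [Function.comp_def, h3, h4]
  rw [add_eq_left, Multiset.filter_eq_nil]
  intro c hc
  obtain ⟨b, -, rfl⟩ := Multiset.mem_map.1 hc
  exact not_not.2 rfl

end

end Prism

/-! ### Realization of orbit data -/


section Realization

variable {G : Type u} [Group G]

/-- A list of elements with product `1` is, up to trivial entries, the singular orbit data of an
action as soon as its partial products exhaust the group: these products are the voltages on the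
rungs of a prism, and the squares of the prism have the entries of the list as monodromies. -/
theorem exists_surfaceAction_of_list [Finite G] (l : List G) (hl : l.prod = 1)
    (hcover : ∀ g : G, ∃ i < l.length, (l.take i).prod = g) :
    ∃ S : SurfaceAction G, ∃ n : ℕ, S.orbitData + n • {ConjClasses.mk 1}
      = (l.map ConjClasses.mk : Multiset (ConjClasses G)) := by
  classical
  obtain ⟨m, hm⟩ : ∃ m, l.length = m + 1 := by
    obtain ⟨i, hi, -⟩ := hcover 1
    exact ⟨l.length - 1, by lia⟩
  -- the darts of an action live in the lowest universe
  let f : G ≃* Shrink.{0} G := Shrink.mulEquiv.symm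
  have := Fintype.ofFinite (Shrink.{0} G)
  have hs : ∀ i j : Fin (m + 1), ∃ k : ℕ, ((finRotate (m + 1)) ^ k) i = j := by
    intro i j
    have h1 : ∀ k : ℕ, ((finRotate (m + 1)) ^ k) i = i + Fin.ofNat (m + 1) k := by
      intro k
      induction k with
      | zero => simp
      | succ k ih =>
        rw [pow_succ', Equiv.Perm.mul_apply, ih, finRotate_apply, add_assoc]
        congr 1
        ext
        simp [Fin.val_add]
    refine ⟨(j - i).val, ?_⟩
    rw [h1]
    simp
  let h : Fin (m + 1) → Shrink.{0} G := fun i => f ((l.take i).prod)⁻¹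
  have hh : Function.Surjective h := by
    intro x
    obtain ⟨i, hi, hx⟩ := hcover (f.symm x)⁻¹
    exact ⟨⟨i, by lia⟩, by simp [h, hx]⟩
  -- the last square closes up because the product of the whole list is `1`
  have hmono : ∀ i : Fin (m + 1), f.symm (h i * (h (finRotate (m + 1) i))⁻¹) = l[i] := by
    intro i
    have h1 : (l.take i).prod * l[i] = (l.take (finRotate (m + 1) i)).prod := by
      rw [coe_finRotate]
      have h2 := List.prod_take_succ l i (by lia)
      split_ifs with hi
      · subst hi
        rw [List.take_zero, List.prod_nil, ← hl]
        refine h2.symm.trans ?_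
        rw [List.take_of_length_le (by simp [hm])]
      · exact h2.symm
    simp only [h]
    rw [← h1, ← map_inv f, ← map_mul f, f.symm_apply_apply]
    group
  refine ⟨prismAction (finRotate (m + 1)) hs h hh f,
    ((l.map ConjClasses.mk : Multiset (ConjClasses G)).filter
      (fun c => ¬ c ≠ ConjClasses.mk 1)).card, ?_⟩
  have hmap : ((Finset.univ : Finset (Fin (m + 1))).val.map fun i =>
      ConjClasses.mk (f.symm (h i * (h (finRotate (m + 1) i))⁻¹)))
      = (l.map ConjClasses.mk : Multiset (ConjClasses G)) := by
    simp only [hmono, Fin.univ_val_map]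
    congr 1
    apply List.ext_getElem
    · simp [hm]
    · intro i h₁ h₂
      rw [List.getElem_ofFn, List.getElem_map]
      rfl
  rw [prism_orbitData, hmap, Multiset.nsmul_singleton]
  conv_rhs => rw [← Multiset.filter_add_not (fun c => c ≠ ConjClasses.mk 1)
    (l.map ConjClasses.mk : Multiset (ConjClasses G))]
  congr 1
  refine (Multiset.eq_replicate_card.2 fun c hc => ?_).symm
  exact not_not.1 (Multiset.mem_filter.1 hc).2

variable (G) in
/-- The tuples that represent `0` in the group of singular orbit data. -/
noncomputable def nullTuples : AddSubmonoid (Multiset (ConjClasses G)) :=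
  (AddMonoidHom.mker (BGroup.mk G)).map (OrbitTuples G).subtype

theorem mem_nullTuples {m : Multiset (ConjClasses G)} :
    m ∈ nullTuples G ↔ ∃ h : m ∈ OrbitTuples G, BGroup.mk G ⟨m, h⟩ = 0 := by
  constructor
  · rintro ⟨⟨m, h⟩, h0, rfl⟩
    exact ⟨h, h0⟩
  · rintro ⟨h, h0⟩
    exact ⟨⟨m, h⟩, h0, rfl⟩

theorem singleton_one_mem_nullTuples : {ConjClasses.mk 1} ∈ nullTuples G := by
  have h : {ConjClasses.mk (1 : G)} ∈ OrbitTuples G := by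
    rw [AddMonoidHom.mem_mker, ← Multiset.cons_zero, Psi_cons, map_zero, add_zero]
    exact map_one Abelianization.of
  exact mem_nullTuples.2 ⟨h, ((addConGen (BRel G)).eq (a := ⟨_, h⟩) (b := 0)).2
    (AddConGen.Rel.of _ _ ⟨rfl, Or.inl rfl⟩)⟩

theorem add_conjInv_mem_nullTuples (m : Multiset (ConjClasses G)) :
    m + m.map conjInv ∈ nullTuples G := by
  have h : m + m.map conjInv ∈ OrbitTuples G := by
    rw [AddMonoidHom.mem_mker, map_add, Psi_map_conjInv, add_neg_cancel]
  exact mem_nullTuples.2 ⟨h, BGroup.mk_add_inv G m h⟩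

/-- Tuples that differ by tuples representing `0` represent the same element. -/
theorem mk_eq_mk_of_add_eq_add {a b p q : Multiset (ConjClasses G)} (ha : a ∈ OrbitTuples G)
    (hp : p ∈ nullTuples G) (hq : q ∈ nullTuples G) (h : a + p = b + q) :
    ∃ hb : b ∈ OrbitTuples G, BGroup.mk G ⟨a, ha⟩ = BGroup.mk G ⟨b, hb⟩ := by
  obtain ⟨hp, hp0⟩ := mem_nullTuples.1 hp
  obtain ⟨hq, hq0⟩ := mem_nullTuples.1 hq
  have hb : b ∈ OrbitTuples G := by
    have h1 := congrArg (Psi G) h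
    rw [map_add, map_add, AddMonoidHom.mem_mker.1 ha, AddMonoidHom.mem_mker.1 hp,
      AddMonoidHom.mem_mker.1 hq, add_zero, add_zero] at h1
    exact AddMonoidHom.mem_mker.2 h1.symm
  refine ⟨hb, ?_⟩
  have h1 : (⟨a, ha⟩ : OrbitTuples G) + ⟨p, hp⟩ = ⟨b, hb⟩ + ⟨q, hq⟩ := Subtype.ext h
  have h2 := congrArg (BGroup.mk G) h1
  rwa [map_add, map_add, hp0, hq0, add_zero, add_zero] at h2

theorem map_conjInv_mem_nullTuples {m : Multiset (ConjClasses G)} (hm : m ∈ nullTuples G) :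
    m.map conjInv ∈ nullTuples G := by
  obtain ⟨h, h'⟩ := mk_eq_mk_of_add_eq_add (a := 0) (AddSubmonoid.zero_mem _)
    (add_conjInv_mem_nullTuples m) hm ((zero_add _).trans (add_comm _ _))
  exact mem_nullTuples.2 ⟨h, h'.symm.trans (map_zero _)⟩

/-- An element of the commutator subgroup is a product whose factors form a null tuple: the factors
`a, b, a⁻¹, b⁻¹` of a commutator cancel in pairs. -/
theorem exists_list_of_mem_commutator {q : G} (hq : q ∈ commutator G) :
    ∃ l : List G, l.prod = q
      ∧ (l.map ConjClasses.mk : Multiset (ConjClasses G)) ∈ nullTuples G := by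
  rw [commutator_eq_closure] at hq
  induction hq using Subgroup.closure_induction with
  | mem x hx =>
    obtain ⟨a, b, rfl⟩ := hx
    refine ⟨[a, b, a⁻¹, b⁻¹], by simp [commutatorElement_def, mul_assoc], ?_⟩
    exact add_conjInv_mem_nullTuples ([a, b].map ConjClasses.mk : Multiset (ConjClasses G))
  | one => exact ⟨[], rfl, AddSubmonoid.zero_mem _⟩
  | mul x y _ _ hx hy =>
    obtain ⟨l, rfl, hl⟩ := hx
    obtain ⟨l', rfl, hl'⟩ := hy
    refine ⟨l ++ l', List.prod_append, ?_⟩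
    rw [List.map_append, ← Multiset.coe_add]
    exact AddSubmonoid.add_mem _ hl hl'
  | inv x _ hx =>
    obtain ⟨l, rfl, hl⟩ := hx
    refine ⟨(l.map fun x => x⁻¹).reverse, (List.prod_inv_reverse l).symm, ?_⟩
    have h1 := map_conjInv_mem_nullTuples hl
    rw [Multiset.map_coe, List.map_map] at h1
    rw [List.map_reverse, Multiset.coe_reverse, List.map_map]
    exact h1

theorem psi_coe_map_mk (l : List G) :
    Psi G (l.map ConjClasses.mk : Multiset (ConjClasses G))
      = Additive.ofMul (Abelianization.of l.prod) := by
  induction l with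
  | nil => simp
  | cons a l ih =>
    rw [List.map_cons, ← Multiset.cons_coe, Psi_cons, ih, List.prod_cons, map_mul]
    rfl

theorem prod_flatMap_inv (l : List G) : (l.flatMap fun g => [g, g⁻¹]).prod = 1 := by
  induction l with
  | nil => rfl
  | cons a l ih => simp [ih]

theorem exists_prod_take_flatMap_inv {l : List G} {g : G} (hg : g ∈ l) :
    ∃ i < (l.flatMap fun g => [g, g⁻¹]).length,
      ((l.flatMap fun g => [g, g⁻¹]).take i).prod = g := by
  induction l with
  | nil => simp at hg
  | cons a l ih =>
    rcases List.mem_cons.1 hg with rfl | hg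
    · exact ⟨1, by simp, by simp⟩
    · obtain ⟨i, hi, h⟩ := ih hg
      exact ⟨i + 2, by simpa using hi, by simpa using h⟩

theorem coe_map_mk_flatMap_inv_mem_nullTuples (l : List G) :
    ((l.flatMap fun g => [g, g⁻¹]).map ConjClasses.mk : Multiset (ConjClasses G))
      ∈ nullTuples G := by
  induction l with
  | nil => exact AddSubmonoid.zero_mem _
  | cons a l ih =>
    rw [List.flatMap_cons, List.map_append, ← Multiset.coe_add]
    exact AddSubmonoid.add_mem _ (add_conjInv_mem_nullTuples {ConjClasses.mk a}) ih

/-- Every element of the group of singular orbit data is represented by the orbit data of an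
action. -/
theorem exists_surfaceAction_mk_eq [Finite G] {a : Multiset (ConjClasses G)}
    (ha : a ∈ OrbitTuples G) : ∃ (S : SurfaceAction G) (hS : S.orbitData ∈ OrbitTuples G),
      BGroup.mk G ⟨a, ha⟩ = BGroup.mk G ⟨S.orbitData, hS⟩ := by
  classical
  have := Fintype.ofFinite G
  obtain ⟨l₀, rfl⟩ : ∃ l : List G, (l.map ConjClasses.mk : Multiset (ConjClasses G)) = a := by
    induction a using Quotient.inductionOn with
    | _ L =>
      obtain ⟨l, rfl⟩ := List.map_surjective_iff.2 ConjClasses.mk_surjective L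
      exact ⟨l, rfl⟩
  have hcomm : l₀.prod⁻¹ ∈ commutator G := by
    rw [inv_mem_iff, ← Abelianization.ker_of G, MonoidHom.mem_ker]
    exact ofMul_eq_zero.1 ((psi_coe_map_mk l₀).symm.trans (AddMonoidHom.mem_mker.1 ha))
  -- Two additions that do not change the class: the list `l₁` makes the product trivial, and all
  -- the pairs `g, g⁻¹` in front make the partial products exhaust the group.
  obtain ⟨l₁, hl₁, hnull⟩ := exists_list_of_mem_commutator hcomm
  set L := (Finset.univ : Finset G).toList
  obtain ⟨S, n, hS⟩ := exists_surfaceAction_of_list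
    ((L.flatMap fun g => [g, g⁻¹]) ++ (l₀ ++ l₁))
    (by rw [List.prod_append, List.prod_append, hl₁, prod_flatMap_inv, one_mul, mul_inv_cancel])
    (fun g => by
      obtain ⟨i, hi, h⟩ := exists_prod_take_flatMap_inv (l := L) (g := g) (by simp [L])
      refine ⟨i, by rw [List.length_append]; lia, ?_⟩
      rw [List.take_append_of_le_length hi.le, h])
  refine ⟨S, mk_eq_mk_of_add_eq_add ha
    (AddSubmonoid.add_mem _ (coe_map_mk_flatMap_inv_mem_nullTuples L) hnull)
    (AddSubmonoid.nsmul_mem _ singleton_one_mem_nullTuples n) ?_⟩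
  rw [hS, List.map_append, List.map_append, ← Multiset.coe_add, ← Multiset.coe_add,
    add_left_comm]

end Realization

/-! ### Characters induced from trivial representations -/


section Induced

variable {G : Type u} [Group G] [Fintype G]

open Classical in
/-- The induced representation as the space of functions on `G` invariant under `H`: the class of
the point `x` corresponds to the uniform distribution on the coset `H x`. -/
theorem exists_section_mk (H : Subgroup G) :
    ∃ j : Representation.IndV H.subtype (Representation.trivial ℂ H ℂ) →ₗ[ℂ] (G → ℂ),
      ∀ x y : G, j (Representation.IndV.mk _ _ x 1) y
        = (Nat.card H : ℂ)⁻¹ * if y * x⁻¹ ∈ H then 1 else 0 := by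
  let c : G → MonoidAlgebra ℂ G →ₗ[ℂ] ℂ := fun y =>
    Finsupp.lapply y ∘ₗ (MonoidAlgebra.coeffLinearEquiv ℂ).toLinearMap
  let j₀ : MonoidAlgebra ℂ G →ₗ[ℂ] (G → ℂ) :=
    LinearMap.pi fun y => (Nat.card H : ℂ)⁻¹ • ∑ h : H, c (h * y)
  have hc : ∀ x y : G, c y (.single x 1) = if x = y then 1 else 0 := by
    intro x y
    simp [c, MonoidAlgebra.coeffLinearEquiv, Finsupp.single_apply]
  have hj₀ : ∀ x y : G, j₀ (.single x 1) y
      = (Nat.card H : ℂ)⁻¹ * if y * x⁻¹ ∈ H then 1 else 0 := by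
    intro x y
    simp only [j₀, LinearMap.pi_apply, LinearMap.smul_apply, LinearMap.sum_apply, hc, smul_eq_mul]
    congr 1
    split_ifs with h
    · rw [Finset.sum_eq_single (⟨x * y⁻¹, by simpa using H.inv_mem h⟩ : H)]
      · simp
      · rintro ⟨k, hk⟩ - hne
        refine if_neg fun e => hne (Subtype.ext ?_)
        exact eq_mul_inv_of_mul_eq e.symm
      · exact fun h' => absurd (Finset.mem_univ _) h'
    · refine Finset.sum_eq_zero fun k _ => if_neg fun e => h ?_
      rw [e]
      simp
  refine ⟨Representation.Coinvariants.lift _ (j₀ ∘ₗ (TensorProduct.rid ℂ _).toLinearMap) ?_, ?_⟩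
  · intro k
    refine TensorProduct.ext (MonoidAlgebra.lhom_ext' fun x => LinearMap.ext_ring ?_)
    refine LinearMap.ext_ring ?_
    ext y
    simp [hj₀, ← mul_assoc, H.mul_mem_cancel_right]
  · intro x y
    simp [hj₀]

open Classical in
/-- The character of the representation induced from the trivial representation of `H` counts the
fixed points on the cosets of `H`. -/
theorem character_ind_trivial (H : Subgroup G) (g : G) :
    (Representation.ind H.subtype (Representation.trivial ℂ H ℂ)).character g
      = (Nat.card H : ℂ)⁻¹ * ∑ h : G, if h⁻¹ * g * h ∈ H then 1 else 0 := by
  classical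
  obtain ⟨j, hj⟩ := exists_section_mk H
  let A := Representation.ind H.subtype (Representation.trivial ℂ H ℂ) g
  let π : (G → ℂ) →ₗ[ℂ] Representation.IndV H.subtype (Representation.trivial ℂ H ℂ) :=
    ∑ x, (Representation.IndV.mk H.subtype (Representation.trivial ℂ H ℂ) x) ∘ₗ LinearMap.proj x
  have hπ : ∀ v, π v = ∑ x, Representation.IndV.mk _ _ x (v x) := fun v => by simp [π]
  have hmk : ∀ (k : H) (x : G), Representation.IndV.mk H.subtype (Representation.trivial ℂ H ℂ)
      (k * x) (1 : ℂ) = Representation.IndV.mk _ _ x 1 := by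
    intro k x
    have := Representation.Coinvariants.mk_self_apply (Representation.tprod
      ((Representation.leftRegular ℂ G).comp H.subtype) (Representation.trivial ℂ H ℂ)) k
      (TensorProduct.mk ℂ _ _ (.single x 1) 1)
    simpa using this
  have hsmul : ∀ (x : G) (r : ℂ), Representation.IndV.mk H.subtype (Representation.trivial ℂ H ℂ)
      x r = r • Representation.IndV.mk _ _ x 1 := by
    intro x r
    rw [← map_smul, smul_eq_mul, mul_one]
  have hπj : π ∘ₗ j = LinearMap.id := by
    refine Representation.IndV.hom_ext _ _ fun x => LinearMap.ext_ring ?_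
    change π (j (Representation.IndV.mk _ _ x 1)) = Representation.IndV.mk _ _ x 1
    rw [hπ]
    have h1 : ∀ y, Representation.IndV.mk H.subtype (Representation.trivial ℂ H ℂ) y
        (j (Representation.IndV.mk _ _ x 1) y)
        = (if y * x⁻¹ ∈ H then (Nat.card H : ℂ)⁻¹ else 0) • Representation.IndV.mk _ _ x 1 := by
      intro y
      rw [hsmul, hj]
      split_ifs with h
      · have := hmk ⟨_, h⟩ x
        rw [inv_mul_cancel_right] at this
        rw [this, mul_one]
      · rw [mul_zero, zero_smul, zero_smul]
    rw [Finset.sum_congr rfl fun y _ => h1 y, ← Finset.sum_smul, ← Finset.sum_filter,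
      Finset.sum_const]
    have hcard : (Finset.univ.filter fun y => y * x⁻¹ ∈ H).card = Nat.card H := by
      rw [Nat.card_eq_fintype_card, ← Finset.card_univ (α := H)]
      refine (Finset.card_nbij' (fun k : H => (k : G) * x)
        (fun y => if h : y * x⁻¹ ∈ H then ⟨_, h⟩ else 1)
        ?_ ?_ ?_ ?_).symm
      · intro k _
        simp
      · intro y _
        simp
      · intro k _
        simp
      · intro y hy
        simp [(Finset.mem_filter.1 hy).2]
    rw [hcard, nsmul_eq_mul, mul_inv_cancel₀ (Nat.cast_ne_zero.2 Nat.card_pos.ne'), one_smul]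
  have htrace : LinearMap.trace ℂ _ A = LinearMap.trace ℂ (G → ℂ) (j ∘ₗ A ∘ₗ π) := by
    rw [← LinearMap.trace_comp_comm', LinearMap.comp_assoc, hπj, LinearMap.comp_id]
  change LinearMap.trace ℂ _ A = _
  rw [htrace, LinearMap.trace_eq_matrix_trace ℂ (Pi.basisFun ℂ G), Matrix.trace, Finset.mul_sum,
    ← Equiv.sum_comp (Equiv.inv G)]
  refine Finset.sum_congr rfl fun x _ => ?_
  rw [Matrix.diag_apply, LinearMap.toMatrix_apply, Pi.basisFun_apply, Pi.basisFun_repr]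
  have h2 : π (Pi.single (Equiv.inv G x) 1)
      = Representation.IndV.mk _ _ (Equiv.inv G x) 1 := by
    rw [hπ, Finset.sum_eq_single (Equiv.inv G x)]
    · rw [Pi.single_eq_same]
    · intro y _ hy
      rw [Pi.single_eq_of_ne hy, map_zero]
    · exact fun h => absurd (Finset.mem_univ _) h
  rw [LinearMap.comp_apply, LinearMap.comp_apply, h2, Representation.ind_mk, hj]
  simp [mul_assoc]

end Induced

theorem kappa_zero_add_kappa_zero {n : ℕ} (hn : n ≠ 0) : kappa n 0 + kappa n 0 = n - 1 := by
  have h1 : ∀ n : ℕ, (∑ a ∈ Finset.range n, (a : ℂ)) * 2 = n * (n - 1) := by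
    intro n
    induction n with
    | zero => simp
    | succ n ih =>
      rw [Finset.sum_range_succ, add_mul, ih]
      push_cast
      ring
  have hn' : (n : ℂ) ≠ 0 := Nat.cast_ne_zero.2 hn
  have h2 : kappa n 0 = (∑ a ∈ Finset.range n, (a : ℂ)) / n := by
    rw [kappa, Finset.sum_div]
    simp [rootExp_zero]
  rw [h2, ← mul_two, div_mul_eq_mul_div, h1, mul_div_cancel_left₀ _ hn']

theorem kappa_add_kappa_sub {n m : ℕ} (hm : 0 < m) (hmn : m < n) :
    kappa n m + kappa n (n - m) = -1 := by
  have h := rootExp_ne_one hm hmn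
  have h0 := rootExp_ne_zero n m
  rw [kappa_of_ne_one h, kappa_of_ne_one (rootExp_ne_one (by lia) (by lia)),
    rootExp_self_sub (by lia) hmn.le, inv_inv]
  have h1 : rootExp n m - 1 ≠ 0 := sub_ne_zero.2 h
  have h2 : (rootExp n m)⁻¹ - 1 = -(rootExp n m - 1) / rootExp n m := by
    field_simp
    ring
  rw [h2, inv_div]
  field_simp
  ring

theorem conj_kappa {n m : ℕ} (hm : m ≤ n) (hn : n ≠ 0) :
    (starRingEnd ℂ) (kappa n m) = kappa n (n - m) := by
  rw [kappa, kappa, map_sum]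
  refine Finset.sum_congr rfl fun a _ => ?_
  have h1 : (starRingEnd ℂ) (rootExp n m) = (rootExp n m)⁻¹ :=
    eq_inv_of_mul_eq_one_left (conj_rootExp_mul_self n m)
  rw [map_mul, map_pow, map_inv₀, h1, map_div₀, Complex.conj_natCast, Complex.conj_natCast,
    rootExp_self_sub hn hm]

theorem kappa_self (n : ℕ) : kappa n n = kappa n 0 := by
  rcases eq_or_ne n 0 with rfl | hn
  · rfl
  have := rootExp_self_sub hn (Nat.zero_le n)
  rw [Nat.sub_zero, rootExp_zero, inv_one] at this
  rw [kappa, kappa, this, rootExp_zero]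

section Powers

variable {G : Type u} [Group G]

open Classical in
/-- The sum that computes `coneCharacter` has at most one term for each `h`. -/
theorem sum_pow_eq_kappa {γ x : G} {m : ℕ} (hm : m < orderOf γ) (hx : x = γ ^ m) :
    (∑ k ∈ Finset.range (orderOf γ), if x = γ ^ k then kappa (orderOf γ) k else 0)
      = kappa (orderOf γ) m := by
  rw [Finset.sum_eq_single m, if_pos hx]
  · intro k hk hkm
    refine if_neg fun e => hkm ?_
    exact pow_injOn_Iio_orderOf (Finset.mem_range.1 hk) hm (e.symm.trans hx)
  · exact fun h => absurd (Finset.mem_range.2 hm) h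

open Classical in
theorem sum_pow_eq_zero {γ x : G} (hx : x ∉ Subgroup.zpowers γ) (f : ℕ → ℂ) :
    (∑ k ∈ Finset.range (orderOf γ), if x = γ ^ k then f k else 0) = 0 :=
  Finset.sum_eq_zero fun _ _ => if_neg fun e => hx (by
    rw [e]
    exact Subgroup.npow_mem_zpowers γ _)

open Classical in
theorem sum_inv_pow_eq_kappa {γ x : G} {m : ℕ} (hm : m < orderOf γ) (hx : x = γ ^ m) :
    (∑ k ∈ Finset.range (orderOf γ), if x = γ⁻¹ ^ k then kappa (orderOf γ) k else 0)
      = kappa (orderOf γ) (orderOf γ - m) := by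
  have ho : orderOf γ⁻¹ = orderOf γ := orderOf_inv γ
  rcases Nat.eq_zero_or_pos m with rfl | hm0
  · have := sum_pow_eq_kappa (γ := γ⁻¹) (x := x) (m := 0) (by lia) (by simpa using hx)
    rwa [ho, ← kappa_self, ← Nat.sub_zero (orderOf γ)] at this
  · have := sum_pow_eq_kappa (γ := γ⁻¹) (x := x) (m := orderOf γ - m) (by lia) (by
      rw [hx, inv_pow]
      refine eq_inv_of_mul_eq_one_left ?_
      rw [← pow_add, Nat.add_sub_cancel' hm.le, pow_orderOf_eq_one])
    rwa [ho] at this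

end Powers

section Duality

variable {G : Type u} [Group G] [Fintype G]

open Classical in
/-- The contributions of `γ` and `γ⁻¹` cancel modulo permutation characters. -/
theorem coneCharacter_add_inv (γ g : G) : coneCharacter γ g + coneCharacter γ⁻¹ g
    = (Representation.ind (⊥ : Subgroup G).subtype (Representation.trivial ℂ _ ℂ)).character g
      - (Representation.ind (Subgroup.zpowers γ).subtype
        (Representation.trivial ℂ _ ℂ)).character g := by
  have hν : orderOf γ ≠ 0 := (orderOf_pos γ).ne'
  have hν' : (orderOf γ : ℂ) ≠ 0 := Nat.cast_ne_zero.2 hν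
  rw [character_ind_trivial, character_ind_trivial, coneCharacter, coneCharacter, orderOf_inv,
    Nat.card_zpowers, ← mul_add, ← Finset.sum_add_distrib, Subgroup.card_bot, Nat.cast_one,
    inv_one, one_mul, Finset.mul_sum, Finset.mul_sum, ← Finset.sum_sub_distrib]
  refine Finset.sum_congr rfl fun h _ => ?_
  generalize h⁻¹ * g * h = x
  by_cases hx : x ∈ Subgroup.zpowers γ
  · obtain ⟨m, hm, hxm⟩ : ∃ m < orderOf γ, x = γ ^ m := by
      obtain ⟨n, rfl⟩ := mem_powers_iff_mem_zpowers.2 hx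
      exact ⟨n % orderOf γ, Nat.mod_lt _ (orderOf_pos γ), (pow_mod_orderOf γ n).symm⟩
    rw [sum_pow_eq_kappa hm hxm, sum_inv_pow_eq_kappa hm hxm, if_pos hx, Subgroup.mem_bot]
    rcases Nat.eq_zero_or_pos m with rfl | hm0
    · rw [Nat.sub_zero, kappa_self, kappa_zero_add_kappa_zero hν, if_pos (by simpa using hxm)]
      field_simp
    · rw [kappa_add_kappa_sub hm0 hm, if_neg]
      · ring
      · rw [hxm]
        exact pow_ne_one_of_lt_orderOf hm0.ne' hm
  · rw [sum_pow_eq_zero hx, ← orderOf_inv γ, sum_pow_eq_zero (by rwa [Subgroup.zpowers_inv]),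
      if_neg hx, if_neg]
    · ring
    · rintro h1
      exact hx (Subgroup.mem_bot.1 h1 ▸ one_mem _)

/-- Complex conjugation replaces a rotation by its inverse. -/
theorem conj_coneCharacter (γ g : G) :
    (starRingEnd ℂ) (coneCharacter γ g) = coneCharacter γ⁻¹ g := by
  classical
  have hν : orderOf γ ≠ 0 := (orderOf_pos γ).ne'
  rw [coneCharacter, coneCharacter, orderOf_inv, map_mul, map_inv₀, Complex.conj_natCast, map_sum]
  refine congrArg _ (Finset.sum_congr rfl fun h _ => ?_)
  generalize h⁻¹ * g * h = x
  by_cases hx : x ∈ Subgroup.zpowers γ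
  · obtain ⟨m, hm, hxm⟩ : ∃ m < orderOf γ, x = γ ^ m := by
      obtain ⟨n, rfl⟩ := mem_powers_iff_mem_zpowers.2 hx
      exact ⟨n % orderOf γ, Nat.mod_lt _ (orderOf_pos γ), (pow_mod_orderOf γ n).symm⟩
    rw [sum_pow_eq_kappa hm hxm, sum_inv_pow_eq_kappa hm hxm, conj_kappa hm.le hν]
  · rw [sum_pow_eq_zero hx, ← orderOf_inv γ, sum_pow_eq_zero (by rwa [Subgroup.zpowers_inv]),
      map_zero]

end Duality

/-! ### Cotangent sums and values of L-functions -/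

section Cotangent

open Filter Topology Complex HurwitzZeta

/-- A bound for the terms of the series of the odd Hurwitz zeta function that is uniform for
exponents between `1` and `2`. -/
theorem rpow_neg_sub_rpow_neg_le {δ m x y s : ℝ} (hδ : 0 < δ) (hδ1 : δ ≤ 1) (hm : δ ≤ m)
    (hx : m ≤ x) (hxy : x ≤ y) (hy : y ≤ x + 1) (hs : 1 ≤ s) (hs' : s ≤ 2) :
    x ^ (-s) - y ^ (-s) ≤ 2 * δ⁻¹ * (1 / |m| ^ (2 : ℝ)) := by
  have hm0 : 0 < m := hδ.trans_le hm
  have hx0 : 0 < x := hm0.trans_le hx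
  have hy0 : 0 < y := hx0.trans_le hxy
  have h1 : x ^ (-s) ≤ m⁻¹ * δ⁻¹ := by
    calc x ^ (-s) ≤ m ^ (-s) := Real.rpow_le_rpow_of_nonpos hm0 hx (by linarith)
      _ = m⁻¹ * m ^ (-(s - 1)) := by
        rw [← Real.rpow_neg_one m, ← Real.rpow_add hm0]
        congr 1
        ring
      _ ≤ m⁻¹ * δ ^ (-(s - 1)) := mul_le_mul_of_nonneg_left
        (Real.rpow_le_rpow_of_nonpos hδ hm (by linarith)) (inv_pos.2 hm0).le
      _ ≤ m⁻¹ * δ⁻¹ := by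
        refine mul_le_mul_of_nonneg_left ?_ (inv_pos.2 hm0).le
        rw [← Real.rpow_neg_one δ]
        exact Real.rpow_le_rpow_of_exponent_ge hδ hδ1 (by linarith)
  have h2 : y ^ (-s) = x ^ (-s) * (x / y) ^ s := by
    rw [Real.div_rpow hx0.le hy0.le, Real.rpow_neg hx0.le, Real.rpow_neg hy0.le]
    have := (Real.rpow_pos_of_pos hx0 s).ne'
    field_simp
  have h3 : 1 - (x / y) ^ s ≤ 2 * m⁻¹ := by
    have h4 : (x / y) ^ (2 : ℝ) ≤ (x / y) ^ s :=
      Real.rpow_le_rpow_of_exponent_ge (by positivity) ((div_le_one hy0).2 hxy) hs'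
    rw [Real.rpow_two] at h4
    have h5 : 1 - x / y ≤ m⁻¹ := by
      have : 1 - x / y = (y - x) / y := by field_simp
      rw [this, ← one_div]
      exact div_le_div₀ zero_le_one (by linarith) hm0 (by linarith)
    have h6 : x / y ≤ 1 := (div_le_one hy0).2 hxy
    nlinarith
  have h7 : 0 ≤ x ^ (-s) := (Real.rpow_pos_of_pos hx0 _).le
  have h8 : 0 ≤ 1 - (x / y) ^ s :=
    sub_nonneg.2 (Real.rpow_le_one (by positivity) ((div_le_one hy0).2 hxy) (by linarith))
  calc x ^ (-s) - y ^ (-s) = x ^ (-s) * (1 - (x / y) ^ s) := by rw [h2]; ring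
    _ ≤ (m⁻¹ * δ⁻¹) * (2 * m⁻¹) := mul_le_mul h1 h3 h8 (by positivity)
    _ = 2 * δ⁻¹ * (1 / |m| ^ (2 : ℝ)) := by
      rw [abs_of_pos hm0, Real.rpow_two]
      field_simp

theorem abs_rpow_neg_sub_rpow_neg_le {δ m x y s : ℝ} (hδ : 0 < δ) (hδ1 : δ ≤ 1) (hm : δ ≤ m)
    (hx : m ≤ x) (hy : m ≤ y) (hxy : |x - y| ≤ 1) (hs : 1 ≤ s) (hs' : s ≤ 2) :
    |x ^ (-s) - y ^ (-s)| ≤ 2 * δ⁻¹ * (1 / |m| ^ (2 : ℝ)) := by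
  rw [abs_le] at hxy
  rcases le_total x y with h | h
  · rw [abs_of_nonneg (sub_nonneg.2
      (Real.rpow_le_rpow_of_nonpos (by linarith) h (by linarith)))]
    exact rpow_neg_sub_rpow_neg_le hδ hδ1 hm hx h (by linarith) hs hs'
  · rw [abs_sub_comm, abs_of_nonneg (sub_nonneg.2
      (Real.rpow_le_rpow_of_nonpos (by linarith) h (by linarith)))]
    exact rpow_neg_sub_rpow_neg_le hδ hδ1 hm hy h (by linarith) hs hs'

/-- The value at `1` of the odd Hurwitz zeta function, as the limit of its Dirichlet series. -/
theorem hurwitzZetaOdd_one {a : ℝ} (h0 : 0 < a) (h1 : a < 1) :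
    hurwitzZetaOdd a 1 = Real.pi / 2 * cot (Real.pi * a) := by
  let F : ℕ → ℝ → ℂ := fun n s =>
    (((n + a) ^ (-s) - (n + 1 - a) ^ (-s) : ℝ) : ℂ) / 2
  set δ : ℝ := min a (1 - a)
  have hδ : 0 < δ := lt_min h0 (by linarith)
  have hδa : δ ≤ a := min_le_left _ _
  have hδa' : δ ≤ 1 - a := min_le_right _ _
  let B : ℕ → ℝ := fun n => 2 * δ⁻¹ * (1 / |n + δ| ^ (2 : ℝ))
  have hB : Summable B :=
    ((Real.summable_one_div_nat_add_rpow δ 2).2 one_lt_two).mul_left _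
  have hbound : ∀ s : ℝ, 1 ≤ s → s ≤ 2 → ∀ n, ‖F n s‖ ≤ B n := by
    intro s hs hs' n
    have hn : (0 : ℝ) ≤ n := Nat.cast_nonneg n
    have := abs_rpow_neg_sub_rpow_neg_le (δ := δ) (m := n + δ) (x := n + a) (y := n + 1 - a)
      hδ (by linarith) (by linarith) (by linarith) (by linarith)
      (by rw [abs_le]; constructor <;> linarith) hs hs'
    simp only [F, norm_div, Complex.norm_real, Real.norm_eq_abs, Complex.norm_ofNat]
    have h2 := abs_nonneg ((n + a) ^ (-s) - (n + 1 - a) ^ (-s))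
    change _ ≤ 2 * δ⁻¹ * (1 / |n + δ| ^ (2 : ℝ))
    linarith
  have hcont : ∀ n, Tendsto (F n) (𝓝[>] 1) (𝓝 (F n 1)) := by
    intro n
    have hn : (0 : ℝ) ≤ n := Nat.cast_nonneg n
    have : Continuous (F n) := by
      have hx : (n + a : ℝ) ≠ 0 := by linarith
      have hy : (n + 1 - a : ℝ) ≠ 0 := by linarith
      exact (continuous_ofReal.comp (((Real.continuous_const_rpow hx).comp continuous_neg).sub
        ((Real.continuous_const_rpow hy).comp continuous_neg))).div_const 2
    exact (this.tendsto 1).mono_left nhdsWithin_le_nhds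
  have hlim1 : Tendsto (fun s => ∑' n, F n s) (𝓝[>] 1) (𝓝 (∑' n, F n 1)) := by
    refine tendsto_tsum_of_dominated_convergence hB hcont ?_
    have h2 : Set.Ioc (1 : ℝ) 2 ∈ 𝓝[>] (1 : ℝ) := Ioc_mem_nhdsGT one_lt_two
    filter_upwards [h2] with s hs n
    exact hbound s hs.1.le hs.2 n
  have hsum : ∀ s : ℝ, 1 < s → ∑' n, F n s = hurwitzZetaOdd a s := by
    intro s hs
    refine HasSum.tsum_eq ?_
    refine (hasSum_nat_hurwitzZetaOdd_of_mem_Icc (a := a) ⟨h0.le, h1.le⟩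
      (s := s) (by simpa using hs)).congr_fun fun n => ?_
    have hn : (0 : ℝ) ≤ n := Nat.cast_nonneg n
    have hx : (0 : ℝ) ≤ n + a := by linarith
    have hy : (0 : ℝ) ≤ n + 1 - a := by linarith
    simp only [F]
    rw [Real.rpow_neg hx, Real.rpow_neg hy]
    push_cast
    rw [ofReal_cpow hx, ofReal_cpow hy]
    push_cast
    rw [one_div, one_div]
  have hlim2 : Tendsto (fun s : ℝ => hurwitzZetaOdd a s) (𝓝[>] 1) (𝓝 (hurwitzZetaOdd a 1)) := by
    have : Continuous fun s : ℝ => hurwitzZetaOdd a s :=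
      (differentiable_hurwitzZetaOdd a).continuous.comp continuous_ofReal
    have h2 := this.tendsto 1
    rw [ofReal_one] at h2
    exact h2.mono_left nhdsWithin_le_nhds
  -- the series converges at `1` by dominated convergence from the right
  have hval : hurwitzZetaOdd a 1 = ∑' n, F n 1 := by
    refine tendsto_nhds_unique hlim2 (hlim1.congr' ?_)
    filter_upwards [self_mem_nhdsWithin] with s hs
    exact hsum s hs
  rw [hval]
  have hsummable : Summable fun n => F n 1 :=
    Summable.of_norm_bounded hB (hbound 1 le_rfl one_le_two)
  refine ((hsummable.hasSum_iff_tendsto_nat).2 ?_).tsum_eq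
  have haC : (a : ℂ) ∈ Complex.integerComplement := by
    rintro ⟨k, hk⟩
    have hk' : (k : ℝ) = a := by exact_mod_cast hk
    rw [← hk'] at h0 h1
    have h2 : 0 < k := by exact_mod_cast h0
    have h3 : k < 1 := by exact_mod_cast h1
    lia
  have hcot := tendsto_logDeriv_euler_cot_sub haC
  -- the partial sums are those of the Mittag-Leffler series of the cotangent, up to a shift
  have hpartial : ∀ n : ℕ, ∑ j ∈ Finset.range n, F j 1
      = (1 / a + ∑ j ∈ Finset.range n, cotTerm a j - ((n + a : ℝ) : ℂ)⁻¹) / 2 := by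
    intro n
    induction n with
    | zero => simp
    | succ n ih =>
      rw [Finset.sum_range_succ, ih, Finset.sum_range_succ]
      simp only [F, cotTerm, Real.rpow_neg_one]
      push_cast
      have hd : (1 : ℂ) / (a - (n + 1)) = -(n + 1 - a : ℂ)⁻¹ := by
        rw [one_div, ← inv_neg, neg_sub]
      rw [hd]
      ring
  have hinv : Tendsto (fun n : ℕ => ((n + a : ℝ) : ℂ)⁻¹) atTop (𝓝 0) := by
    have h2 : Tendsto (fun n : ℕ => (n + a : ℝ)⁻¹) atTop (𝓝 0) :=
      tendsto_inv_atTop_zero.comp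
        (tendsto_atTop_add_const_right _ _ tendsto_natCast_atTop_atTop)
    have h3 := (continuous_ofReal.tendsto 0).comp h2
    rw [ofReal_zero] at h3
    exact h3.congr fun n => by simp
  have h2 := (((hcot.const_add (1 / (a : ℂ))).sub hinv).div_const 2)
  refine (h2.congr fun n => (hpartial n).symm).trans ?_
  rw [add_sub_cancel, sub_zero, mul_div_right_comm]

/-- For an odd Dirichlet character, the twisted sum of the contributions `kappa` is a multiple of
the value of its L-function at `1`. -/
theorem sum_char_mul_kappa_ne_zero {N : ℕ} [NeZero N] (χ : DirichletCharacter ℂ N) (hχ : χ.Odd) :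
    ∑ j : ZMod N, χ j * kappa N j.val ≠ 0 := by
  have hχ1 : χ ≠ 1 := by
    rintro rfl
    have h1 := hχ
    rw [DirichletCharacter.Odd, MulChar.one_apply isUnit_one.neg] at h1
    norm_num at h1
  have hN : N ≠ 1 := by
    rintro rfl
    exact hχ1 (Subsingleton.elim _ _)
  have hL := DirichletCharacter.LFunction_apply_one_ne_zero hχ1
  rw [DirichletCharacter.LFunction, ZMod.LFunction_def_odd hχ.to_fun] at hL
  have hsum := right_ne_zero_of_mul hL
  have hzero : ∑ j : ZMod N, χ j = 0 := MulChar.sum_eq_zero_of_ne_one hχ1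
  have hterm : ∀ j : ZMod N, χ j * kappa N j.val
      = I / Real.pi * (χ j * hurwitzZetaOdd (ZMod.toAddCircle j) 1) - χ j / 2 := by
    intro j
    by_cases hj : IsUnit j
    · have hj0 : j ≠ 0 := by
        rintro rfl
        have : Nontrivial (ZMod N) := ZMod.nontrivial_iff.2 hN
        exact not_isUnit_zero hj
      have hv : 0 < j.val := ZMod.val_pos.2 hj0
      have hvN : j.val < N := ZMod.val_lt j
      have hNpos : (0 : ℝ) < N := Nat.cast_pos.2 (NeZero.pos N)
      rw [ZMod.toAddCircle_apply, hurwitzZetaOdd_one (by positivity)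
        ((div_lt_one hNpos).2 (Nat.cast_lt.2 hvN)), Complex.cot_pi_eq_exp_ratio]
      have hw : exp (2 * Real.pi * I * ((j.val / N : ℝ) : ℂ)) = rootExp N j.val := by
        rw [rootExp]
        congr 1
        ring
      have hw1 := rootExp_ne_one hv hvN
      have hw0 := rootExp_ne_zero N j.val
      rw [hw, kappa_of_ne_one hw1]
      generalize rootExp N j.val = w at hw1 hw0
      have hd : 1 - w ≠ 0 := sub_ne_zero.2 hw1.symm
      have hd' : w⁻¹ - 1 = (1 - w) / w := by field_simp
      have hπ : (Real.pi : ℂ) ≠ 0 := ofReal_ne_zero.2 Real.pi_ne_zero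
      rw [hd']
      field_simp
      ring
    · rw [MulChar.map_nonunit χ hj]
      ring
  rw [Finset.sum_congr rfl fun j _ => hterm j, Finset.sum_sub_distrib, ← Finset.mul_sum,
    ← Finset.sum_div, hzero, zero_div, sub_zero]
  exact mul_ne_zero (div_ne_zero I_ne_zero (ofReal_ne_zero.2 Real.pi_ne_zero)) hsum

end Cotangent

/-! ### Injectivity up to torsion -/


section Deconvolution

/-- An odd function on the units modulo `N` is determined by its convolution with `kappa`. -/
theorem eq_zero_of_sum_mul_kappa {N : ℕ} [NeZero N] {f : (ZMod N)ˣ → ℂ} (hodd : ∀ u, f (-u) = -f u)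
    (hf : ∀ a : (ZMod N)ˣ, ∑ b, f b * kappa N ((a * b⁻¹ : (ZMod N)ˣ) : ZMod N).val = 0)
    (a : (ZMod N)ˣ) : f a = 0 := by
  -- All Fourier coefficients of `f` vanish: the even ones since `f` is odd, the odd ones since
  -- those of `kappa` are nonzero.
  have hχ : ∀ χ : DirichletCharacter ℂ N, ∑ b : (ZMod N)ˣ, χ b * f b = 0 := by
    intro χ
    rcases χ.even_or_odd with h | h
    · have h1 : ∑ b : (ZMod N)ˣ, χ b * f b = -∑ b : (ZMod N)ˣ, χ b * f b := by
        conv_lhs => rw [← Equiv.sum_comp (Equiv.neg _)]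
        rw [← Finset.sum_neg_distrib]
        refine Finset.sum_congr rfl fun b _ => ?_
        rw [Equiv.neg_apply, hodd, Units.val_neg, ← neg_one_mul (b : ZMod N), map_mul, h, one_mul,
          mul_neg]
      exact self_eq_neg.1 h1
    · have h1 : (∑ k : (ZMod N)ˣ, χ k * kappa N (k : ZMod N).val)
          * ∑ b : (ZMod N)ˣ, χ b * f b = 0 := by
        calc _ = ∑ b : (ZMod N)ˣ, ∑ k : (ZMod N)ˣ,
              χ k * kappa N (k : ZMod N).val * (χ b * f b) := by
              rw [Finset.sum_mul_sum, Finset.sum_comm]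
          _ = ∑ b : (ZMod N)ˣ, ∑ a : (ZMod N)ˣ,
              χ a * (f b * kappa N ((a * b⁻¹ : (ZMod N)ˣ) : ZMod N).val) := by
              refine Finset.sum_congr rfl fun b _ => ?_
              rw [← Equiv.sum_comp (Equiv.mulRight b⁻¹)]
              refine Finset.sum_congr rfl fun a _ => ?_
              have h2 : χ ((a * b⁻¹ : (ZMod N)ˣ) : ZMod N) * χ b = χ a := by
                rw [← map_mul, ← Units.val_mul, inv_mul_cancel_right]
              rw [Equiv.coe_mulRight, ← h2]
              ring
          _ = ∑ a : (ZMod N)ˣ, χ a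
              * ∑ b, f b * kappa N ((a * b⁻¹ : (ZMod N)ˣ) : ZMod N).val := by
              rw [Finset.sum_comm]
              simp only [Finset.mul_sum]
          _ = 0 := Finset.sum_eq_zero fun a _ => by rw [hf, mul_zero]
      refine (mul_eq_zero.1 h1).resolve_left ?_
      have h2 := sum_char_mul_kappa_ne_zero χ h
      rwa [← Fintype.sum_of_injective (fun u : (ZMod N)ˣ => (u : ZMod N)) Units.val_injective _ _
        (fun j hj => by
          rw [MulChar.map_nonunit χ fun hu => hj hu, zero_mul]) fun _ => rfl] at h2
  have h1 : ∑ χ : DirichletCharacter ℂ N, χ (a : ZMod N)⁻¹ * ∑ b : (ZMod N)ˣ, χ b * f b = 0 := by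
    simp [hχ]
  simp only [Finset.mul_sum, ← mul_assoc] at h1
  rw [Finset.sum_comm] at h1
  simp only [← Finset.sum_mul, DirichletCharacter.sum_char_inv_mul_char_eq ℂ a.isUnit,
    Units.val_inj] at h1
  rw [Finset.sum_eq_single a, if_pos rfl] at h1
  · refine (mul_eq_zero.1 h1).resolve_left ?_
    exact Nat.cast_ne_zero.2 (Nat.totient_pos.2 (NeZero.pos N)).ne'
  · intro b _ hb
    rw [if_neg hb.symm, zero_mul]
  · exact fun h => absurd (Finset.mem_univ _) h

variable {G : Type u} [Group G]

theorem pow_zmod_val_mul (x : G) [NeZero (orderOf x)] (i j : ZMod (orderOf x)) :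
    (x ^ i.val) ^ j.val = x ^ (i * j).val := by
  rw [← pow_mul, ZMod.val_mul, pow_mod_orderOf]

theorem pow_zmod_val_neg (x : G) [NeZero (orderOf x)] (i : ZMod (orderOf x)) :
    x ^ (-i).val = (x ^ i.val)⁻¹ := by
  refine eq_inv_of_mul_eq_one_left ?_
  rw [← pow_add, ← orderOf_dvd_iff_pow_eq_one, ← ZMod.natCast_eq_zero_iff]
  simp

theorem orderOf_pow_zmod_val (x : G) [NeZero (orderOf x)] (u : (ZMod (orderOf x))ˣ) :
    orderOf (x ^ (u : ZMod (orderOf x)).val) = orderOf x :=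
  (ZMod.val_coe_unit_coprime u).symm.orderOf_pow

open Classical in
/-- An odd function on a group can be recovered from the function obtained by spreading it over
powers with weights `kappa`: at an element of maximal order only generators of the same cyclic
group contribute. -/
theorem eq_zero_of_sum_pow_kappa [Fintype G] {n : G → ℂ} (hodd : ∀ x, n x⁻¹ = -n x)
    (hn : ∀ g : G, ∑ x, n x * ((orderOf x : ℂ)⁻¹ * ∑ k ∈ Finset.range (orderOf x),
      if g = x ^ k then kappa (orderOf x) k else 0) = 0) : n = 0 := by
  by_contra hne
  obtain ⟨x₀, hx₀, hmax⟩ := Finset.exists_max_image (Finset.univ.filter fun x => n x ≠ 0) orderOf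
    (by
      obtain ⟨x, hx⟩ := Function.ne_iff.1 hne
      exact ⟨x, Finset.mem_filter.2 ⟨Finset.mem_univ _, hx⟩⟩)
  have hx₀ := (Finset.mem_filter.1 hx₀).2
  have hN : NeZero (orderOf x₀) := ⟨(orderOf_pos x₀).ne'⟩
  let e : (ZMod (orderOf x₀))ˣ → G := fun u => x₀ ^ (u : ZMod (orderOf x₀)).val
  have he : Function.Injective e := by
    intro u v huv
    exact Units.ext (ZMod.val_injective _
      (pow_injOn_Iio_orderOf (ZMod.val_lt _) (ZMod.val_lt _) huv))
  have hconv : ∀ a : (ZMod (orderOf x₀))ˣ,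
      ∑ b, n (e b) * kappa (orderOf x₀) ((a * b⁻¹ : (ZMod (orderOf x₀))ˣ) : ZMod (orderOf x₀)).val
        = 0 := by
    intro a
    have h1 := hn (e a)
    rw [← Fintype.sum_of_injective e he
      (fun b => n (e b) * kappa (orderOf x₀)
        ((a * b⁻¹ : (ZMod (orderOf x₀))ˣ) : ZMod (orderOf x₀)).val * (orderOf x₀ : ℂ)⁻¹)] at h1
    · rw [← Finset.sum_mul] at h1
      exact (mul_eq_zero.1 h1).resolve_right
        (inv_ne_zero (Nat.cast_ne_zero.2 (orderOf_pos x₀).ne'))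
    · intro x hx
      by_cases hnx : n x = 0
      · rw [hnx, zero_mul]
      rw [sum_pow_eq_zero, mul_zero, mul_zero]
      intro hmem
      refine hx ?_
      have hle : orderOf x ≤ orderOf x₀ :=
        hmax x (Finset.mem_filter.2 ⟨Finset.mem_univ _, hnx⟩)
      have hoa : orderOf (e a) = orderOf x₀ := orderOf_pow_zmod_val x₀ a
      have hsub : Subgroup.zpowers (e a) ≤ Subgroup.zpowers x := Subgroup.zpowers_le.2 hmem
      have hsub' : Subgroup.zpowers (e a) ≤ Subgroup.zpowers x₀ :=
        Subgroup.zpowers_le.2 (Subgroup.npow_mem_zpowers x₀ _)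
      have h2 := Subgroup.eq_of_le_of_card_ge hsub (by
        rw [Nat.card_zpowers, Nat.card_zpowers, hoa]
        exact hle)
      have h3 := Subgroup.eq_of_le_of_card_ge hsub' (by
        rw [Nat.card_zpowers, Nat.card_zpowers, hoa])
      have hx : x ∈ Subgroup.zpowers x₀ := by
        rw [← h3, h2]
        exact Subgroup.mem_zpowers x
      have hox : orderOf x = orderOf x₀ := by
        rw [← Nat.card_zpowers, ← h2, h3, Nat.card_zpowers]
      obtain ⟨m, rfl⟩ := mem_powers_iff_mem_zpowers.2 hx
      have hcop : m.Coprime (orderOf x₀) := by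
        have h4 := orderOf_pow x₀ (n := m)
        simp only at hox
        rw [hox] at h4
        have h5 := Nat.div_mul_cancel (Nat.gcd_dvd_left (orderOf x₀) m)
        rw [← h4] at h5
        exact Nat.Coprime.symm (Nat.eq_of_mul_eq_mul_left (orderOf_pos x₀)
          (h5.trans (mul_one _).symm))
      refine ⟨ZMod.unitOfCoprime m hcop, ?_⟩
      change x₀ ^ ((m : ℕ) : ZMod (orderOf x₀)).val = x₀ ^ m
      rw [ZMod.val_natCast, pow_mod_orderOf]
    · intro b
      have hob : orderOf (e b) = orderOf x₀ := orderOf_pow_zmod_val x₀ b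
      rw [sum_pow_eq_kappa (m := ((a * b⁻¹ : (ZMod (orderOf x₀))ˣ) : ZMod (orderOf x₀)).val), hob]
      · ring
      · rw [hob]
        exact ZMod.val_lt _
      · change x₀ ^ _ = (x₀ ^ _) ^ _
        rw [pow_zmod_val_mul, ← Units.val_mul, mul_comm a, mul_inv_cancel_left]
  have h1 := eq_zero_of_sum_mul_kappa (f := fun u => n (e u)) (fun u => by
    change n (x₀ ^ (-(u : ZMod (orderOf x₀))).val) = _
    rw [pow_zmod_val_neg, hodd]) hconv 1
  refine hx₀ ?_
  have h2 : e 1 = x₀ := by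
    change x₀ ^ (1 : ZMod (orderOf x₀)).val = x₀
    rw [ZMod.val_one_eq_one_mod, pow_mod_orderOf, pow_one]
  rwa [h2] at h1

end Deconvolution

section OrbitTuples

variable {G : Type u} [Group G]

theorem conjInv_conjInv (c : ConjClasses G) : conjInv (conjInv c) = c := by
  induction c using Quotient.inductionOn with
  | _ g => exact congrArg ConjClasses.mk (inv_inv g)

open Classical in
/-- A tuple whose character is real contains each conjugacy class as often as its inverse. -/
theorem map_conjInv_eq_of_real [Fintype G] {m : Multiset (ConjClasses G)}
    (hm : ∀ g, (starRingEnd ℂ) (m.map fun c => classCharacter c g).sum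
      = (m.map fun c => classCharacter c g).sum) : m.map conjInv = m := by
  have := Fintype.ofFinite (ConjClasses G)
  let I : Equiv.Perm (ConjClasses G) :=
    Function.Involutive.toPerm conjInv (conjInv_conjInv (G := G))
  have hI : ∀ c, I c = conjInv c := fun _ => rfl
  have hsum : ∀ g, (m.map fun c => classCharacter c g).sum
      = ∑ c : ConjClasses G, (m.count c : ℂ) * classCharacter c g := by
    intro g
    rw [Finset.sum_multiset_map_count]
    simp only [nsmul_eq_mul]
    refine Finset.sum_subset (Finset.subset_univ _) fun c _ hc => ?_
    rw [Multiset.count_eq_zero_of_notMem fun h => hc (Multiset.mem_toFinset.2 h), Nat.cast_zero,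
      zero_mul]
  have hconj : ∀ (c : ConjClasses G) (g : G),
      (starRingEnd ℂ) (classCharacter c g) = classCharacter (conjInv c) g := by
    intro c g
    induction c using Quotient.inductionOn with
    | _ x => exact conj_coneCharacter x g
  -- the odd part of the multiplicities, first on conjugacy classes, then spread out evenly over
  -- the elements of each class
  let k : ConjClasses G → ℂ := fun c => m.count c - m.count (conjInv c)
  have hk : ∀ g, ∑ c, k c * classCharacter c g = 0 := by
    intro g
    have h1 := hm g
    rw [hsum, map_sum, ← Equiv.sum_comp I] at h1
    simp only [map_mul, Complex.conj_natCast, hconj, hI, conjInv_conjInv] at h1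
    simp only [k, sub_mul, Finset.sum_sub_distrib]
    rw [h1, sub_self]
  let d : ConjClasses G → ℕ := fun c => (Finset.univ.filter fun x => ConjClasses.mk x = c).card
  have hd : ∀ c, (d c : ℂ) ≠ 0 := by
    intro c
    obtain ⟨x, rfl⟩ := ConjClasses.mk_surjective c
    exact Nat.cast_ne_zero.2 (Finset.card_ne_zero.2
      ⟨x, Finset.mem_filter.2 ⟨Finset.mem_univ _, rfl⟩⟩)
  have hdinv : ∀ c, d (conjInv c) = d c := by
    intro c
    refine Finset.card_nbij' (fun x => x⁻¹) (fun x => x⁻¹) ?_ ?_ ?_ ?_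
    · intro x hx
      have hx := (Finset.mem_filter.1 hx).2
      refine Finset.mem_coe.2 (Finset.mem_filter.2 ⟨Finset.mem_univ _, ?_⟩)
      rw [← conjInv_conjInv c, ← hx]
      rfl
    · intro x hx
      have hx := (Finset.mem_filter.1 hx).2
      refine Finset.mem_coe.2 (Finset.mem_filter.2 ⟨Finset.mem_univ _, ?_⟩)
      rw [← hx]
      rfl
    · exact fun x _ => inv_inv x
    · exact fun x _ => inv_inv x
  let n : G → ℂ := fun x => k (ConjClasses.mk x) / d (ConjClasses.mk x)
  let V : G → G → ℂ := fun x g => (orderOf x : ℂ)⁻¹ * ∑ k ∈ Finset.range (orderOf x),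
    if g = x ^ k then kappa (orderOf x) k else 0
  have hV : ∀ x g, coneCharacter x g = ∑ h : G, V (h * x * h⁻¹) g := by
    intro x g
    rw [coneCharacter, Finset.mul_sum]
    refine Finset.sum_congr rfl fun h _ => ?_
    have ho : orderOf (h * x * h⁻¹) = orderOf x := by
      rw [← MulAut.conj_apply]
      exact MulEquiv.orderOf_eq (MulAut.conj h) x
    simp only [V, ho]
    congr 1
    refine Finset.sum_congr rfl fun j _ => ?_
    congr 1
    rw [conj_pow, eq_iff_iff]
    constructor
    · intro e
      rw [← e]
      group
    · rintro rfl
      group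
  have hn : ∀ g, ∑ x, n x * coneCharacter x g = 0 := by
    intro g
    rw [← hk g, ← Finset.sum_fiberwise (s := Finset.univ) (g := ConjClasses.mk)]
    refine Finset.sum_congr rfl fun c _ => ?_
    have h1 : ∀ x ∈ Finset.univ.filter (fun x => ConjClasses.mk x = c),
        n x * coneCharacter x g = k c / d c * classCharacter c g := by
      intro x hx
      rw [← (Finset.mem_filter.1 hx).2]
      rfl
    rw [Finset.sum_congr rfl h1, Finset.sum_const, nsmul_eq_mul]
    change (d c : ℂ) * _ = _
    have := hd c
    field_simp
  have hn' : ∀ g, ∑ x, n x * V x g = 0 := by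
    intro g
    have h1 : ∀ h : G, ∑ x, n x * V (h * x * h⁻¹) g = ∑ x, n x * V x g := by
      intro h
      rw [← Equiv.sum_comp (MulAut.conj h).toEquiv fun x => n x * V x g]
      refine Finset.sum_congr rfl fun x _ => ?_
      have h2 : ConjClasses.mk (h * x * h⁻¹) = ConjClasses.mk x :=
        ConjClasses.mk_eq_mk_iff_isConj.2 (isConj_iff.2 ⟨h, rfl⟩).symm
      change _ = n (h * x * h⁻¹) * V (h * x * h⁻¹) g
      simp only [n, h2]
    have h2 := hn g
    simp only [hV, Finset.mul_sum] at h2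
    rw [Finset.sum_comm] at h2
    simp only [h1] at h2
    rw [Finset.sum_const, nsmul_eq_mul] at h2
    exact (mul_eq_zero.1 h2).resolve_left
      (Nat.cast_ne_zero.2 (Finset.card_ne_zero.2 ⟨1, Finset.mem_univ _⟩))
  have hodd : ∀ x, n x⁻¹ = -n x := by
    intro x
    change k (conjInv (ConjClasses.mk x)) / d (conjInv (ConjClasses.mk x)) = _
    simp only [n, k, hdinv, conjInv_conjInv]
    ring
  have hzero := eq_zero_of_sum_pow_kappa hodd hn'
  refine Multiset.ext.2 fun c => ?_
  have h1 : m.count c = m.count (conjInv c) := by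
    obtain ⟨x, rfl⟩ := ConjClasses.mk_surjective c
    have h2 := (div_eq_zero_iff.1 (congrFun hzero x)).resolve_right (hd _)
    exact_mod_cast sub_eq_zero.1 h2
  rw [h1]
  conv_lhs => rw [← conjInv_conjInv c]
  exact Multiset.count_map_eq_count' _ _ I.injective _

/-- A tuple with real character has order at most two in the group of singular orbit data. -/
theorem two_nsmul_mk_eq_zero_of_real [Fintype G] (a : OrbitTuples G)
    (ha : ∀ g, (starRingEnd ℂ) ((a : Multiset (ConjClasses G)).map fun c => classCharacter c g).sum
      = ((a : Multiset (ConjClasses G)).map fun c => classCharacter c g).sum) :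
    2 • BGroup.mk G a = 0 := by
  obtain ⟨h, h0⟩ := mem_nullTuples.1 (add_conjInv_mem_nullTuples (a : Multiset (ConjClasses G)))
  rw [two_nsmul, ← map_add, ← h0]
  congr 1
  refine Subtype.ext ?_
  change (a : Multiset (ConjClasses G)) + (a : Multiset (ConjClasses G))
    = a + Multiset.map conjInv (a : Multiset (ConjClasses G))
  rw [map_conjInv_eq_of_real ha]

end OrbitTuples

/-! ### The homomorphism to the representation ring -/


section RepresentationRing

variable {G : Type u} [Group G]

theorem character_mem_repRing {V : Type*} [AddCommGroup V] [Module ℂ V] [FiniteDimensional ℂ V]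
    (ρ : Representation ℂ G V) : ρ.character ∈ RepRing G := by
  let e : V ≃ₗ[ℂ] EuclideanSpace ℂ (Fin (Module.finrank ℂ V)) :=
    LinearEquiv.ofFinrankEq _ _ (by simp)
  refine AddSubgroup.subset_closure ⟨Module.finrank ℂ V,
    (e.conjRingEquiv : Module.End ℂ V →* Module.End ℂ _).comp ρ, ?_⟩
  ext g
  exact (LinearMap.trace_conj' (ρ g) e).symm

variable (G) in
/-- The subgroup of the virtual characters generated by the permutation characters on cosets, as a
group of functions. -/
noncomputable def permCharacters : AddSubgroup (G → ℂ) := (EGroup G).map (RepRing G).subtype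

theorem character_ind_mem_permCharacters [Finite G] (H : Subgroup G) :
    (Representation.ind H.subtype (Representation.trivial ℂ H ℂ)).character
      ∈ permCharacters G := by
  exact ⟨⟨_, character_mem_repRing _⟩, AddSubgroup.subset_closure ⟨H, rfl⟩, rfl⟩

theorem conj_eq_of_mem_permCharacters [Finite G] {f : G → ℂ} (hf : f ∈ permCharacters G) (g : G) :
    (starRingEnd ℂ) (f g) = f g := by
  classical
  cases nonempty_fintype G
  obtain ⟨f, hf, rfl⟩ := hf
  induction hf using AddSubgroup.closure_induction with
  | mem f hf =>
    obtain ⟨H, hH⟩ := hf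
    change (starRingEnd ℂ) ((f : G → ℂ) g) = (f : G → ℂ) g
    rw [hH, character_ind_trivial, map_mul, map_inv₀, Complex.conj_natCast, map_sum]
    simp only [apply_ite (starRingEnd ℂ), map_one, map_zero]
  | zero => exact map_zero _
  | add x y _ _ hx hy => exact (map_add (starRingEnd ℂ) _ _).trans (congrArg₂ _ hx hy)
  | neg x _ hx => exact (map_neg (starRingEnd ℂ) _).trans (congrArg _ hx)

theorem one_mem_permCharacters [Finite G] : (1 : G → ℂ) ∈ permCharacters G := by
  cases nonempty_fintype G
  convert! character_ind_mem_permCharacters (⊤ : Subgroup G) using 1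
  ext g
  rw [character_ind_trivial]
  simp

open Classical in
theorem regular_mem_permCharacters [Fintype G] :
    (fun g : G => if g = 1 then (Fintype.card G : ℂ) else 0) ∈ permCharacters G := by
  convert! character_ind_mem_permCharacters (⊥ : Subgroup G) using 1
  ext g
  have h1 : ∀ h : G, h⁻¹ * g * h = 1 ↔ g = 1 := by
    intro h
    have := conj_eq_one_iff (a := h⁻¹) (b := g)
    rwa [inv_inv] at this
  rw [character_ind_trivial]
  simp [Subgroup.mem_bot, h1]

/-- The inclusion of the quotient of the representation ring into a quotient of the group of all
functions. -/
noncomputable def rTildeToFun : RTilde G →+ (G → ℂ) ⧸ permCharacters G :=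
  QuotientAddGroup.map (EGroup G) (permCharacters G) (RepRing G).subtype
    (AddSubgroup.le_comap_map _ _)

theorem rTildeToFun_injective : Function.Injective (rTildeToFun (G := G)) := by
  rw [injective_iff_map_eq_zero]
  intro x hx
  induction x using QuotientAddGroup.induction_on with
  | _ x =>
    obtain ⟨y, hy, hxy⟩ := (QuotientAddGroup.eq_zero_iff _).1 hx
    rw [← Subtype.ext hxy]
    exact (QuotientAddGroup.eq_zero_iff _).2 hy

variable [Fintype G]

/-- The sum of the contributions of the entries of a tuple of conjugacy classes. -/
noncomputable def tupleCharacter : Multiset (ConjClasses G) →+ (G → ℂ) :=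
  Multiset.sumAddMonoidHom.comp (Multiset.mapAddMonoidHom classCharacter)

theorem tupleCharacter_apply (m : Multiset (ConjClasses G)) (g : G) :
    tupleCharacter m g = (m.map fun c => classCharacter c g).sum := by
  change Pi.evalAddMonoidHom (fun _ : G => ℂ) g (m.map classCharacter).sum = _
  rw [map_multiset_sum, Multiset.map_map]
  rfl

variable (G) in
/-- The tuple characters modulo permutation characters, as a homomorphism on the group of singular
orbit data. -/
noncomputable def bGroupToFun : BGroup G →+ (G → ℂ) ⧸ permCharacters G :=
  AddCon.lift _ ((QuotientAddGroup.mk' (permCharacters G)).comp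
    ((tupleCharacter (G := G)).comp (OrbitTuples G).subtype)) (by
    rw [AddCon.addConGen_le]
    rintro a b ⟨rfl, h⟩
    refine (AddCon.ker_rel _).2 ?_
    rw [map_zero]
    refine (QuotientAddGroup.eq_zero_iff _).2 ?_
    change tupleCharacter (a : Multiset (ConjClasses G)) ∈ _
    rcases h with h | ⟨γ, h⟩
    · have h1 : tupleCharacter ({ConjClasses.mk (1 : G)} : Multiset (ConjClasses G)) = 0 := by
        ext g
        rw [tupleCharacter_apply, Multiset.map_singleton, Multiset.sum_singleton, classCharacter_mk,
          coneCharacter_one]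
      rw [h, h1]
      exact AddSubgroup.zero_mem _
    · have h1 : tupleCharacter ({ConjClasses.mk γ, ConjClasses.mk γ⁻¹} : Multiset (ConjClasses G))
          = (Representation.ind (⊥ : Subgroup G).subtype (Representation.trivial ℂ _ ℂ)).character
            - (Representation.ind (Subgroup.zpowers γ).subtype
              (Representation.trivial ℂ _ ℂ)).character := by
        ext g
        rw [tupleCharacter_apply, Multiset.insert_eq_cons, Multiset.map_cons, Multiset.sum_cons,
          Multiset.map_singleton, Multiset.sum_singleton, classCharacter_mk, classCharacter_mk]
        exact coneCharacter_add_inv γ g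
      rw [h, h1]
      exact AddSubgroup.sub_mem _ (character_ind_mem_permCharacters _)
        (character_ind_mem_permCharacters _))

theorem bGroupToFun_mk (a : OrbitTuples G) : bGroupToFun G (BGroup.mk G a)
    = QuotientAddGroup.mk (tupleCharacter (a : Multiset (ConjClasses G))) := rfl

/-- The unitary representation of an action has the class that is predicted by the singular orbit
data. -/
theorem bGroupToFun_mk_orbitData {S : SurfaceAction G} {n : ℕ}
    {ρ : Representation ℂ G (EuclideanSpace ℂ (Fin n))} (hρ : S.IsUnitaryRep ρ) {a : OrbitTuples G}
    (ha : (a : Multiset (ConjClasses G)) = S.orbitData) :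
    bGroupToFun G (BGroup.mk G a) = rTildeToFun (QuotientAddGroup.mk (RepRing.of ρ)) := by
  classical
  obtain ⟨t, ht⟩ := S.exists_character_eq hρ
  change _ = QuotientAddGroup.mk ρ.character
  rw [bGroupToFun_mk, QuotientAddGroup.eq, ha]
  have h1 : -tupleCharacter S.orbitData + ρ.character
      = 1 + t • fun g : G => if g = 1 then (Fintype.card G : ℂ) else 0 := by
    ext g
    rw [Pi.add_apply, Pi.neg_apply, tupleCharacter_apply, ht]
    simp only [Pi.add_apply, Pi.one_apply, Pi.smul_apply]
    rw [zsmul_eq_mul]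
    ring
  rw [h1]
  exact AddSubgroup.add_mem _ one_mem_permCharacters
    (AddSubgroup.zsmul_mem _ regular_mem_permCharacters t)

/-- The values of `bGroupToFun` are classes of virtual characters, because every element of `𝔹_G` is
the singular orbit data of an action. -/
theorem exists_isInducedByHomology_comp :
    ∃ θ : BGroup G →+ RTilde G, ∀ x, rTildeToFun (θ x) = bGroupToFun G x := by
  have h : ∀ x, bGroupToFun G x ∈ (rTildeToFun (G := G)).range := by
    intro x
    obtain ⟨⟨a, ha⟩, rfl⟩ := (addConGen (BRel G)).mk'_surjective x
    obtain ⟨S, hS, e⟩ := exists_surfaceAction_mk_eq ha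
    obtain ⟨n, ρ, hρ⟩ := S.exists_isUnitaryRep
    refine ⟨QuotientAddGroup.mk (RepRing.of ρ), ?_⟩
    rw [← bGroupToFun_mk_orbitData hρ (a := ⟨_, hS⟩) rfl, ← e]
    rfl
  refine ⟨(AddMonoidHom.ofInjective rTildeToFun_injective).symm.toAddMonoidHom.comp
    ((bGroupToFun G).codRestrict _ h), fun x => ?_⟩
  exact congrArg Subtype.val ((AddMonoidHom.ofInjective rTildeToFun_injective).apply_symm_apply
    ⟨bGroupToFun G x, h x⟩)

/-- The kernel is killed by two, since permutation characters are real. -/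
theorem two_nsmul_eq_zero_of_bGroupToFun {x : BGroup G} (hx : bGroupToFun G x = 0) :
    2 • x = 0 := by
  obtain ⟨a, rfl⟩ := (addConGen (BRel G)).mk'_surjective x
  refine two_nsmul_mk_eq_zero_of_real a fun g => ?_
  rw [← tupleCharacter_apply]
  exact conj_eq_of_mem_permCharacters ((QuotientAddGroup.eq_zero_iff _).1 hx) g

end RepresentationRing

/-- The unitary representations on the first homology of surfaces induce a well defined
homomorphism `θ : 𝔹_G → R_ℂ G / E_G`, and `θ` is injective on the free part of `𝔹_G`, i.e. on
every torsion free subgroup. -/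
theorem mainTheorem1 {G : Type u} [Group G] [Finite G] :
    (∃! θ : BGroup G →+ RTilde G, IsInducedByHomology θ) ∧
    ∀ θ : BGroup G →+ RTilde G, IsInducedByHomology θ →
      ∀ A : AddSubgroup (BGroup G), (∀ a ∈ A, IsOfFinAddOrder a → a = 0) →
        Set.InjOn θ (A : Set (BGroup G)) := by
  cases nonempty_fintype G
  obtain ⟨θ₀, hθ₀⟩ := exists_isInducedByHomology_comp (G := G)
  have hinduced : IsInducedByHomology θ₀ := by
    intro S n ρ hρ α hα
    apply rTildeToFun_injective
    rw [hθ₀, bGroupToFun_mk_orbitData hρ hα]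
  have hunique : ∀ θ : BGroup G →+ RTilde G, IsInducedByHomology θ → θ = θ₀ := by
    intro θ hθ
    ext x
    obtain ⟨⟨a, ha⟩, rfl⟩ := (addConGen (BRel G)).mk'_surjective x
    obtain ⟨S, hS, e⟩ := exists_surfaceAction_mk_eq ha
    obtain ⟨n, ρ, hρ⟩ := S.exists_isUnitaryRep
    change θ (BGroup.mk G ⟨a, ha⟩) = θ₀ (BGroup.mk G ⟨a, ha⟩)
    rw [e, hθ S n ρ hρ ⟨_, hS⟩ rfl, hinduced S n ρ hρ ⟨_, hS⟩ rfl]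
  refine ⟨⟨θ₀, hinduced, hunique⟩, fun θ hθ A hA x hx y hy hxy => ?_⟩
  rw [hunique θ hθ] at hxy
  have h1 : bGroupToFun G (x - y) = 0 := by
    rw [← hθ₀, map_sub, hxy, sub_self, map_zero]
  refine sub_eq_zero.1 (hA _ (A.sub_mem hx hy) ?_)
  exact isOfFinAddOrder_iff_nsmul_eq_zero.2
    ⟨2, two_pos, two_nsmul_eq_zero_of_bGroupToFun h1⟩
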